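/- **Diagrams.** Objects are pairs $\binom nm$ of natural numbers. A *commutative Sullivan diagram* $\Gamma$ from $\binom{n_1}{m_1}$ to $\binom{n_2}{m_2}$ consists of $n_2$ ordered white vertices $v_1,\dots,v_{n_2}$, a finite graph of black vertices and edges, and $n_1+m_1+m_2$ labelled leaves (the last $m_2$ are called outgoing). Each white vertex carries finitely many, but at least one, cyclically ordered half-edges, one of which is the start half-edge; every half-edge at a white vertex and every labelled leaf ends at a black vertex. There is no ordering at black vertices, and diagrams are identified when they differ by renaming black vertices or by contracting an edge between two different black vertices. (Thus black vertices may be taken trivalent, apart from exceptional pieces such as intervals, units and closed components, and unlabelled leaves at black vertices may be forgotten.) The degree $|v_k|$ is the number of non-start half-edges at $v_k$, and $|\Gamma|=\sum_k|v_k|$. The connected components of the black graph are the *arc components*. The half-edges $h_0$ (start)$,h_1,\dots,h_d$ of $v_k$ cut the circle around $v_k$ into oriented segments $s^k_0,\dots,s^k_d$, with $s^k_j$ running from $h_j$ to the cyclically next half-edge. A *loop* at a leaf is a finite, possibly empty, word $\varepsilon_1s_1\cdots\varepsilon_rs_r$ in oriented segments such that the first starts and the last ends at the arc component of the leaf, each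 one starts at the arc component at which the previous one ends, and no segment is followed by its own reverse. A *looped diagram* is $(\Gamma,\gamma_1,\dots,\gamma_{n_1})$ with $\gamma_i$ a loop at the $i$-th leaf. $l\mathcal D(\binom{n_1}{m_1},\binom{n_2}{m_2})$ is the free abelian group on looped diagrams, modulo those in which some non-start half-edge of a white vertex is an unlabelled leaf (i.e. can be represented so that nothing else is attached at its black end). The differential $d$ is the sum over all $k$ with $|v_k|\ge1$ and all $0\le j\le|v_k|$ of $(-1)^{1+|v_1|+\cdots+|v_{k-1}|+j}$ times the blow-up at $s^k_j$: the two half-edges bounding $s^k_j$ are joined to one half-edge (a start half-edge if one of the two was), and $s^k_j$ is deleted from all loops, which are then reduced by cancelling adjacent pairs $s,-s$. **Composition.** For $x=(\Gamma,\gamma_i)\in l\mathcal D(\binom{n_1}{m_1},\binom{n_2}{m_2})$ and $y=(\Gamma',\gamma'_i)\in l\mathcal D(\binom{n_2}{m_2},\binom{n_3}{m_3})$, $y\circ x$ is the signed sum over all ways to do the following: remove the white vertices $v_i$ of $\Gamma$; join the start half-edge of $v_i$ to the $i$-th leaf of $\Gamma'$ and the outgoing leaves of $\Gamma$ to the leaves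 $n_2+1,\dots,n_2+m_2$ of $\Gamma'$, in order; for $i=1,\dots,n_2$ successively, attach the remaining half-edges of $v_i$, in their order, to white vertices of $\Gamma'$ along the loop $\gamma'_i$, each attachment subdividing a segment (the sum is $0$ if $\gamma'_i$ is empty and $|v_i|\ge1$). The segments of $v_i$ then correspond to the consecutive pieces of $\gamma'_i$, and the new loops are the images of the $\gamma_j$, reduced by cancelling adjacent pairs $s,-s$. The sign is $(-1)^{e+f}$: $e$ is the number of transpositions needed to bring the list of the non-start half-edges of $\Gamma$ followed by those of $\Gamma'$ (each ordered by white vertex, then along the vertex) into the order of the non-start half-edges of the result, and $f$ is the number of half-edges attached to segments traversed backwards. The identity of $\binom nm$ consists of $n$ white vertices, the $k$-th with one half-edge, ending in leaf $k$, and with loop $s^k_0$, and of $m$ intervals, each joining an incoming leaf to the corresponding outgoing leaf. **Proposition.** $d$ and $\circ$ are well defined, $l\mathcal D$ is graded by $|\Gamma|$ with $d$ of degree $-1$ and $d^2=0$, and composition $$l\mathcal D(\tbinom{n_1}{m_1},\tbinom{n_2}{m_2})\otimes l\mathcal D(\tbinom{n_2}{m_2},\tbinom{n_3}{m_3})\to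 l\mathcal D(\tbinom{n_1}{m_1},\tbinom{n_3}{m_3}),\qquad x\otimes y\mapsto y\circ x,$$ is a chain map of degree $0$, i.e. $d(y\circ x)=y\circ dx+(-1)^{|x|}\,dy\circ x$. Composition is associative and unital, so that $l\mathcal D$ is a dg-category. The diagrams in which every connected component contains a white vertex or an outgoing leaf span a sub-dg-category $l\mathcal D_+$, those whose loops contain only positively oriented segments span a sub-dg-category $pl\mathcal D$, and those with both properties span a sub-dg-category $pl\mathcal D_+$. -/

import Mathlib

namespace LoopedDiagrams

/-! ### Diagrams

Objects are pairs `(n, m)` of natural numbers.  A looped diagram from `a = (n₁, m₁)` to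
`b = (n₂, m₂)` has `n₂` white vertices, `n₁ + m₁ + m₂` labelled leaves, and `n₁` loops, the `i`-th
one starting at the `i`-th leaf. -/

/-- A representative of a (not yet validated) looped diagram `a ⟶ b`.

The black part of the diagram is a finite graph with vertex set `V` and edge multiset `edges`
(multiple edges and self-loops are allowed), without any ordering at the vertices.  A half-edge at a
white vertex and a labelled leaf are each recorded by the black vertex at which they end.
The white vertex `k` has `(rest k).length + 1` half-edges: the start half-edge `start k`, followed in
cyclic order by `rest k`.

Black vertices may have any valence: representatives are only considered up to contraction
of edges between distinct black vertices (see `Move`).  So a vertex of valence at least four stands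
for all of its trivalent resolutions at once, a bivalent vertex for the middle of an edge, a black
vertex of valence one for an unlabelled leaf.

The segments of the circle around the white vertex `k` are the `(k, j)`, `j ≤ (rest k).length`,
where `(k, j)` runs from the `j`-th half-edge to the next one (the start half-edge being the
`0`-th).  A loop is a reduced word in the oriented segments, that is, an element of
the free group on the segments: in its reduced word no `s` is next to `-s`. -/
structure Diagram (a b : ℕ × ℕ) : Type 1 where
  V : Type
  finite : Finite V
  edges : Multiset (Sym2 V)
  start : Fin b.1 → V
  rest : Fin b.1 → List V
  loopLeaf : Fin a.1 → V
  inLeaf : Fin a.2 → V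
  outLeaf : Fin b.2 → V
  loop : Fin a.1 → FreeGroup (Fin b.1 × ℕ)

/-- An oriented segment: `((k, j), true)` is the segment `(k, j)` with its canonical orientation,
`((k, j), false)` is the reversed segment. -/
abbrev Letter (p : ℕ) : Type := (Fin p × ℕ) × Bool

namespace Diagram

variable {a b c : ℕ × ℕ}

/-- The degree: the number of half-edges at white vertices that are not start half-edges. -/
def degree (D : Diagram a b) : ℕ := ∑ k, (D.rest k).length

/-- The black vertex at which the `j`-th half-edge of the white vertex `k` ends
(`j` is read cyclically). -/
def slot (D : Diagram a b) (k : Fin b.1) (j : ℕ) : D.V :=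
  (D.start k :: D.rest k).getD (j % ((D.rest k).length + 1)) (D.start k)

/-- Two black vertices lie in the same arc component. -/
def SameArc (D : Diagram a b) : D.V → D.V → Prop :=
  Relation.EqvGen fun u v => s(u, v) ∈ D.edges

/-- Where an oriented segment starts. -/
def source (D : Diagram a b) (l : Letter b.1) : D.V :=
  if l.2 then D.slot l.1.1 l.1.2 else D.slot l.1.1 (l.1.2 + 1)

/-- Where an oriented segment ends. -/
def target (D : Diagram a b) (l : Letter b.1) : D.V :=
  if l.2 then D.slot l.1.1 (l.1.2 + 1) else D.slot l.1.1 l.1.2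

/-- The word `w` consists of segments of the diagram and leads from the arc component of `u` to
the arc component of `v`, each segment starting at the arc component where the previous one ends. -/
def IsPath (D : Diagram a b) : D.V → List (Letter b.1) → D.V → Prop
  | u, [], v => D.SameArc u v
  | u, l :: w, v =>
      l.1.2 ≤ (D.rest l.1.1).length ∧ D.SameArc u (D.source l) ∧ D.IsPath (D.target l) w v

/-- Every word `D.loop i` is a loop from the `i`-th leaf to itself. -/
def IsLooped (D : Diagram a b) : Prop :=
  ∀ i, D.IsPath (D.loopLeaf i) (D.loop i).toWord (D.loopLeaf i)

/-- All loops are positively oriented. -/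
def IsPositive (D : Diagram a b) : Prop :=
  ∀ i, ∀ l ∈ (D.loop i).toWord, l.2 = true

/-- Two black vertices lie in the same connected component of the whole diagram (paths may pass
through white vertices). -/
def SameComponent (D : Diagram a b) : D.V → D.V → Prop :=
  Relation.EqvGen fun u v =>
    s(u, v) ∈ D.edges ∨ ∃ k, u ∈ D.start k :: D.rest k ∧ v ∈ D.start k :: D.rest k

/-- Every connected component contains a white vertex or one of the outgoing leaves. -/
def HasPositiveBoundary (D : Diagram a b) : Prop :=
  ∀ v, ∃ w, D.SameComponent v w ∧ ((∃ k, w = D.start k) ∨ ∃ t, w = D.outLeaf t)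

/-- Transport of the diagram along a map of black vertices, with edges the image of `E`. -/
def push (D : Diagram a b) (W : Type) (hW : Finite W) (f : D.V → W) (E : Multiset (Sym2 D.V)) :
    Diagram a b where
  V := W
  finite := hW
  edges := E.map (Sym2.map f)
  start k := f (D.start k)
  rest k := (D.rest k).map f
  loopLeaf i := f (D.loopLeaf i)
  inLeaf i := f (D.inLeaf i)
  outLeaf i := f (D.outLeaf i)
  loop := D.loop

/-- The moves that do not change the diagram: renaming the black vertices, and contracting an
edge between two different black vertices. -/
inductive Move : Diagram a b → Diagram a b → Prop
  | relabel (D : Diagram a b) (W : Type) (hW : Finite W) (e : D.V ≃ W) :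
      Move D (D.push W hW e D.edges)
  | contract (D : Diagram a b) (u v : D.V) (huv : u ≠ v) (E : Multiset (Sym2 D.V))
      (hE : D.edges = s(u, v) ::ₘ E) (W : Type) (hW : Finite W) (f : D.V → W)
      (hf : Function.Surjective f) (hfuv : ∀ x y, f x = f y ↔ x = y ∨ s(x, y) = s(u, v)) :
      Move D (D.push W hW f E)

/-- Some half-edge at a white vertex that is not its start half-edge is an unlabelled leaf:
nothing else is attached to the black vertex where it ends. -/
def Degenerate (D : Diagram a b) : Prop :=
  ∃ (k : Fin b.1) (t : ℕ) (ht : t < (D.rest k).length),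
    (∀ e ∈ D.edges, (D.rest k)[t] ∉ e) ∧
    (∀ k', D.start k' ≠ (D.rest k)[t]) ∧
    (∀ (k' : Fin b.1) (t' : ℕ) (ht' : t' < (D.rest k').length),
      (D.rest k')[t'] = (D.rest k)[t] → k' = k ∧ t' = t) ∧
    (∀ i, D.loopLeaf i ≠ (D.rest k)[t]) ∧
    (∀ i, D.inLeaf i ≠ (D.rest k)[t]) ∧
    (∀ i, D.outLeaf i ≠ (D.rest k)[t])

/-! ### The differential -/

/-- Effect on the segments of forgetting the segment `(k, j)` and renumbering the later ones. -/
def collapse {p : ℕ} (k : Fin p) (j : ℕ) : FreeGroup (Fin p × ℕ) →* FreeGroup (Fin p × ℕ) :=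
  FreeGroup.lift fun s =>
    if s.1 = k then
      if s.2 = j then 1 else if j < s.2 then FreeGroup.of (k, s.2 - 1) else FreeGroup.of s
    else FreeGroup.of s

/-- The blow-up of the white vertex `k` at the segment `(k, j)`, for `j ≤ (rest k).length` and
`rest k ≠ []`: the `j`-th half-edge and the next one are joined outside the white vertex, which is
left with one half-edge in place of the two.  The new trivalent vertex is taken contracted into
one of its black neighbours, so that only the edge to the other neighbour is added; the joined
half-edge is the start half-edge if one of the two was. -/
def face (D : Diagram a b) (k : Fin b.1) (j : ℕ) : Diagram a b where
  V := D.V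
  finite := D.finite
  edges := s(D.slot k j, D.slot k (j + 1)) ::ₘ D.edges
  start := D.start
  rest := Function.update D.rest k
    (if j < (D.rest k).length then (D.rest k).eraseIdx j else (D.rest k).dropLast)
  loopLeaf := D.loopLeaf
  inLeaf := D.inLeaf
  outLeaf := D.outLeaf
  loop i := collapse k j (D.loop i)

/-- The boundary of a diagram: the sum of all blow-ups at white vertices with at least two
half-edges, the signs at the white vertex `k` alternating and starting with
`(-1) ^ (1 + ∑_{k' < k} |v_{k'}|)`. -/
noncomputable def boundary (D : Diagram a b) : Diagram a b →₀ ℤ :=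
  ∑ k, if D.rest k = [] then 0 else
    ∑ j ∈ Finset.range ((D.rest k).length + 1),
      Finsupp.single (D.face k j)
        ((-1 : ℤ) ^ (1 + ∑ k' ∈ Finset.Iio k, (D.rest k').length + j))

/-! ### Composition -/

/-- The word replacing an oriented segment when a half-edge is inserted in the segment `(k, j)`. -/
def splitLetter {q : ℕ} (k : Fin q) (j : ℕ) (l : Letter q) : List (Letter q) :=
  if l.1.1 = k then
    if l.1.2 = j then
      if l.2 then [((k, j), true), ((k, j + 1), true)]
      else [((k, j + 1), false), ((k, j), false)]
    else if j < l.1.2 then [((k, l.1.2 + 1), l.2)] else [l]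
  else [l]

/-- The word induced by `w` after a half-edge is inserted in the segment `(k, j)`. -/
def splitWord {q : ℕ} (k : Fin q) (j : ℕ) (w : List (Letter q)) : List (Letter q) :=
  w.flatMap (splitLetter k j)

/-- A stage in the gluing of the half-edges at the white vertices `Fin p` of `Γ` along the loops
of `Γ'`, whose white vertices are `Fin q`. -/
structure GlueState (p q : ℕ) (V : Type) where
  /-- the sign accumulated so far -/
  sign : ℤ
  /-- the half-edges now attached to the white vertices of `Γ'`, start half-edges excluded -/
  rest : Fin q → List V
  /-- the part of the `i`-th loop of `Γ'` along which half-edges of the `i`-th white vertex of `Γ`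
  still can be glued, i.e. the part after the half-edges that have been glued -/
  word : Fin p → List (Letter q)
  /-- the part of the loops of `Γ'` covered by a segment of `Γ`, for the segments
  ending at a half-edge that has been glued -/
  seg : Fin p × ℕ → List (Letter q)

/-- Glue the half-edge with black vertex `v`, which is the end of the segment `(i, t)` of `Γ`, in
all possible ways along the remaining part of the `i`-th loop.  Here `m` is the
number of half-edges that have been glued before.

If it is glued into the segment `(k, j)`, it has on its left (not counting start half-edges)
`∑_{k' < k} |v_{k'}| + j` half-edges.  Starting to the left of all half-edges of `Γ'` and to the
right of the half-edges of `Γ` glued before, it has to pass those half-edges of `Γ'` that end up on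
its left and those of `Γ` that end up on its right; modulo two their number is
`∑_{k' < k} |v_{k'}| + j + m`.  A half-edge glued into a segment that is traversed backwards gives
a further sign. -/
def glueEdge {p q : ℕ} {V : Type} (m : ℕ) (i : Fin p) (t : ℕ) (v : V)
    (st : GlueState p q V) : List (GlueState p q V) :=
  (List.finRange (st.word i).length).map fun ℓ =>
    let l := (st.word i).get ℓ
    let k := l.1.1
    let j := l.1.2
    let l' := splitLetter k j l
    { sign := st.sign * (-1) ^ (∑ k' ∈ Finset.Iio k, (st.rest k').length + j + m) *
        (if l.2 then 1 else -1)
      rest := Function.update st.rest k ((st.rest k).insertIdx j v)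
      word := Function.update (fun i' => splitWord k j (st.word i')) i
        (l'.drop 1 ++ splitWord k j ((st.word i).drop (ℓ + 1)))
      seg := Function.update (fun s => splitWord k j (st.seg s)) (i, t)
        (splitWord k j ((st.word i).take ℓ) ++ l'.take 1) }

/-- The half-edges of `X` that have to be glued, in their order: `(i, t, v)` stands for the
half-edge at which the segment `(i, t)` ends, i.e. the entry `t` of `X.rest i`. -/
def halfEdges (X : Diagram a b) : List (Fin b.1 × ℕ × X.V) :=
  (List.finRange b.1).flatMap fun i => (X.rest i).zipIdx.map fun vt => (i, vt.2, vt.1)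

/-- All ways to glue the half-edges of `X` along the loops of `Y`, one half-edge after the other. -/
def gluings (X : Diagram a b) (Y : Diagram b c) : List (GlueState b.1 c.1 (X.V ⊕ Y.V)) :=
  X.halfEdges.zipIdx.foldl
    (fun sts e => sts.flatMap (glueEdge e.2 e.1.1 e.1.2.1 (Sum.inl e.1.2.2)))
    [{ sign := 1
       rest := fun k => (Y.rest k).map Sum.inr
       word := fun i => (Y.loop i).toWord
       seg := fun _ => [] }]

/-- The diagram obtained from a way of gluing: the white vertices of `X` are removed, the start
half-edge of the `i`-th one is joined to the `i`-th leaf of `Y`, the outgoing leaves of `X` are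
joined to the incoming leaves of `Y`, and the loops of `X` are replaced by their images. -/
def glue (X : Diagram a b) (Y : Diagram b c) (st : GlueState b.1 c.1 (X.V ⊕ Y.V)) :
    Diagram a c where
  V := X.V ⊕ Y.V
  finite := by
    have := X.finite
    have := Y.finite
    infer_instance
  edges := X.edges.map (Sym2.map Sum.inl) + Y.edges.map (Sym2.map Sum.inr) +
    (Finset.univ.val.map fun i => s(Sum.inl (X.start i), Sum.inr (Y.loopLeaf i))) +
    (Finset.univ.val.map fun i => s(Sum.inl (X.outLeaf i), Sum.inr (Y.inLeaf i)))
  start k := Sum.inr (Y.start k)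
  rest := st.rest
  loopLeaf i := Sum.inl (X.loopLeaf i)
  inLeaf i := Sum.inl (X.inLeaf i)
  outLeaf i := Sum.inr (Y.outLeaf i)
  loop i := FreeGroup.lift
    (fun s => FreeGroup.mk (if s.2 < (X.rest s.1).length then st.seg s else st.word s.1)) (X.loop i)

/-- The composite "first `X`, then `Y`": the signed sum over all gluings. -/
noncomputable def compose (X : Diagram a b) (Y : Diagram b c) : Diagram a c →₀ ℤ :=
  ((X.gluings Y).map fun st => Finsupp.single (X.glue Y st) st.sign).sum

/-- The identity: for each `k < n` a white vertex whose only half-edge ends in the leaf `k`, with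
the loop going once around it, and `m` intervals joining an incoming to an outgoing leaf. -/
def identity (a : ℕ × ℕ) : Diagram a a where
  V := Fin a.1 ⊕ Fin a.2
  finite := inferInstance
  edges := 0
  start := Sum.inl
  rest _ := []
  loopLeaf := Sum.inl
  inLeaf := Sum.inr
  outLeaf := Sum.inr
  loop k := FreeGroup.of (k, 0)

end Diagram

/-! ### The morphism complexes -/

/-- Linear combinations of representatives. -/
abbrev Chains (a b : ℕ × ℕ) : Type 1 := Diagram a b →₀ ℤ

noncomputable def differential (a b : ℕ × ℕ) : Chains a b →ₗ[ℤ] Chains a b :=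
  Finsupp.linearCombination ℤ Diagram.boundary

noncomputable def composition (a b c : ℕ × ℕ) : Chains a b →ₗ[ℤ] Chains b c →ₗ[ℤ] Chains a c :=
  Finsupp.linearCombination ℤ fun X => Finsupp.linearCombination ℤ fun Y => X.compose Y

/-- A class of diagrams. -/
abbrev DiagramClass : Type 1 := ∀ a b : ℕ × ℕ, Diagram a b → Prop

/-- Looped diagrams. -/
def lD : DiagramClass := fun _ _ D => D.IsLooped

/-- Looped diagrams with positive boundary condition. -/
def lDPlus : DiagramClass := fun _ _ D => D.IsLooped ∧ D.HasPositiveBoundary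

/-- Positively oriented looped diagrams. -/
def plD : DiagramClass := fun _ _ D => D.IsLooped ∧ D.IsPositive

/-- Positively oriented looped diagrams with positive boundary condition. -/
def plDPlus : DiagramClass := fun _ _ D =>
  D.IsLooped ∧ D.IsPositive ∧ D.HasPositiveBoundary

/-- The linear combinations of diagrams in the class `P`. -/
noncomputable def gens (P : DiagramClass) (a b : ℕ × ℕ) : Submodule ℤ (Chains a b) :=
  Submodule.span ℤ {x | ∃ D, P a b D ∧ x = Finsupp.single D 1}

/-- The relations: diagrams that differ by a move are equal, degenerate diagrams are zero. -/
noncomputable def rels (P : DiagramClass) (a b : ℕ × ℕ) : Submodule ℤ (Chains a b) :=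
  Submodule.span ℤ
    ({x | ∃ D D', P a b D ∧ P a b D' ∧ D.Move D' ∧
        x = Finsupp.single D 1 - Finsupp.single D' 1} ∪
      {x | ∃ D, P a b D ∧ D.Degenerate ∧ x = Finsupp.single D 1})

/-- The underlying module of the complex of diagrams in the class `P`. -/
abbrev Hom (P : DiagramClass) (a b : ℕ × ℕ) : Type 1 :=
  ↥(gens P a b) ⧸ (rels P a b).submoduleOf (gens P a b)

/-- The class of a linear combination of diagrams. -/
noncomputable def toHom (P : DiagramClass) (a b : ℕ × ℕ) : ↥(gens P a b) →ₗ[ℤ] Hom P a b :=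
  Submodule.mkQ _

/-- The part of degree `k`, spanned by the classes of the diagrams of degree `k`. -/
noncomputable def grade (P : DiagramClass) (a b : ℕ × ℕ) (k : ℕ) : Submodule ℤ (Hom P a b) :=
  Submodule.span ℤ {z | ∃ (D : Diagram a b) (x : ↥(gens P a b)), P a b D ∧ D.degree = k ∧
    (x : Chains a b) = Finsupp.single D 1 ∧ z = toHom P a b x}

/-! ### Dg-categories -/

/-- The structure of a dg-category with given objects and given graded modules of morphisms
(concentrated in degrees `0, 1, 2, …`).  The composition `comp x y` is "first `x`, then `y`", and it
is a chain map `Hom X Y ⊗ Hom Y Z ⟶ Hom X Z`, where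
`d (x ⊗ y) = d x ⊗ y + (-1) ^ |x| • x ⊗ d y`. -/
structure DGCategory {Obj : Type*} (Hom : Obj → Obj → Type*) [∀ X Y, AddCommGroup (Hom X Y)]
    [∀ X Y, Module ℤ (Hom X Y)] (grade : ∀ X Y, ℕ → Submodule ℤ (Hom X Y)) where
  isInternal : ∀ X Y, DirectSum.IsInternal (grade X Y)
  d : ∀ X Y, Hom X Y →ₗ[ℤ] Hom X Y
  d_mem : ∀ X Y k, ∀ x ∈ grade X Y (k + 1), d X Y x ∈ grade X Y k
  d_eq_zero : ∀ X Y, ∀ x ∈ grade X Y 0, d X Y x = 0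
  d_d : ∀ X Y x, d X Y (d X Y x) = 0
  comp : ∀ X Y Z, Hom X Y →ₗ[ℤ] Hom Y Z →ₗ[ℤ] Hom X Z
  comp_mem : ∀ X Y Z i j, ∀ x ∈ grade X Y i, ∀ y ∈ grade Y Z j,
    comp X Y Z x y ∈ grade X Z (i + j)
  d_comp : ∀ X Y Z i, ∀ x ∈ grade X Y i, ∀ y,
    d X Z (comp X Y Z x y) = comp X Y Z (d X Y x) y + (-1 : ℤ) ^ i • comp X Y Z x (d Y Z y)
  comp_assoc : ∀ W X Y Z x y z,
    comp W Y Z (comp W X Y x y) z = comp W X Z x (comp X Y Z y z)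
  one : ∀ X, Hom X X
  one_mem : ∀ X, one X ∈ grade X X 0
  d_one : ∀ X, d X X (one X) = 0
  one_comp : ∀ X Y x, comp X X Y (one X) x = x
  comp_one : ∀ X Y x, comp X Y Y x (one Y) = x

end LoopedDiagrams

namespace LoopedDiagrams

set_option linter.unusedSectionVars false

/-! ### Cutting elements of a free group on segments -/

/-! A composite is a signed sum over ways to attach half-edges, one after the other, along words of
segments. Everything therefore rests on one operation: cutting a word in the interior of one of its
letters, a reversed letter counting with sign `-1` (`cut`). The two cuts in a cancelling pair `s,
-s` yield the same pieces with opposite signs (`cutList_cancel`), so `cut` is defined on the free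
group, where it obeys a product rule like that of a Fox derivative (`cut_mul`). Reducing loops thus
needs no separate treatment, and the rules for two cuts in either order (`cut_cut`,
`cut_right_eq_cut_left`), for collapsed segments (`cut_coll`) and for substitution (`cut_lift`)
follow by induction on free group elements.

A stage of the gluing is a `Conf`, and `Conf.cutAt` attaches one half-edge in all possible ways. Two
such operators anticommute up to renaming segments (`Conf.cutAt_cutAt`). By `Diagram.map_compose`,
composition is an iterated `cutAt` with the global sign `(-1) ^ tri n`, where `n` is the number of
half-edges that are glued.

Composition is a chain map for the following reason. The faces that do not touch a newly attached
half-edge cancel against the faces taken before it was attached. The two faces that do touch it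
telescope along the path on which it moves. Attaching along a path is thus a chain homotopy between
attaching at its start and at its end (`Conf.cutAt_dOp_add`). The two end terms are the faces of the
source on both sides of the half-edge, and induction on the number of half-edges gives
`Conf.cuts_dOp`.

For associativity, attaching a half-edge and then gluing all half-edges of the intermediate diagram
is compared with gluing these first and then attaching the half-edge along the substituted word
(`Conf.cutAt_through`). For the units, there is nothing to glue on one side, and exactly one way to
glue on the other (`Conf.cuts_diagonal`); the superfluous edges are contracted by `cls_pendant`.

The square of the differential is a sum over ordered pairs of distinct segments, and exchanging the
two is a sign-reversing involution (`pos_old_swap`), because ends may be slid along edges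
(`cls_slide`). A degenerate half-edge stays degenerate in all faces but the two that touch it, and
these cancel (`toQuo_boundary_degenerate`).

The four classes of diagrams are invariant under moves and closed under faces and gluings
(`DiagramClass.Closed`). Invariance under moves makes the projection onto the span of a class
compatible with the relations. Hence each morphism complex embeds in the quotient `Quo` of all
diagrams (`mem_rels_of_mem_gens`), in which the dg-category identities can be checked. The same
projection, applied to the diagrams of one degree, gives the grading. -/

/-- A segment of one of `q` circles. -/
abbrev Seg (q : ℕ) : Type := Fin q × ℕ

namespace Seg

variable {p q : ℕ}

/-- The following segment on the same circle. -/
def up (s : Seg q) : Seg q := (s.1, s.2 + 1)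

/-- The name, before a point was inserted in the segment `s`, of the segment `u`. -/
def old (s u : Seg q) : Seg q := if s.1 = u.1 ∧ s.2 < u.2 then (u.1, u.2 - 1) else u

/-- If points are inserted first in `s` and then in `t`, then the order can be exchanged by
inserting first in `old s t` and then in `new s t`. -/
def new (s t : Seg q) : Seg q := if s.1 = t.1 ∧ t.2 ≤ s.2 then up s else s

/-- The name, after a point was inserted in the segment `s`, of a segment `u ≠ s`. -/
def shift (s u : Seg q) : Seg q := if s.1 = u.1 ∧ s.2 < u.2 then up u else u

theorem up_ne (s : Seg q) : up s ≠ s := by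
  rcases s with ⟨k, j⟩; simp [up]

theorem ne_up (s : Seg q) : s ≠ up s := (up_ne s).symm

@[simp] theorem up_inj {s t : Seg q} : up s = up t ↔ s = t := by
  rcases s with ⟨k, j⟩; rcases t with ⟨k', j'⟩; simp [up, Prod.ext_iff]

/-- Exchanging the order of two insertions twice leads back to the first insertion. -/
theorem old_old (s t : Seg q) : old (old s t) (new s t) = s := by
  rcases s with ⟨k, j⟩; rcases t with ⟨k', j'⟩
  grind [old, new, up]

theorem old_shift {s u : Seg q} : old s (shift s u) = u := by
  rcases s with ⟨k, j⟩; rcases u with ⟨k', j'⟩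
  grind [old, shift, up]

theorem old_self (s : Seg q) : old s s = s := by
  rcases s with ⟨k, j⟩; simp [old]

theorem old_up (s : Seg q) : old s (up s) = s := by
  rcases s with ⟨k, j⟩; simp [old, up]

theorem old_up_self (s : Seg q) : old (up s) s = s := by
  rcases s with ⟨k, j⟩; simp [old, up]

theorem new_self (s : Seg q) : new s s = up s := by
  rcases s with ⟨k, j⟩; simp [new]

theorem new_up (s : Seg q) : new s (up s) = s := by
  rcases s with ⟨k, j⟩; simp [new, up]

/-- The original name of a segment does not depend on the order in which the two points were
inserted. -/
theorem old_old_old (s t u : Seg q) : old s (old t u) = old (old s t) (old (new s t) u) := by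
  rcases s with ⟨k, j⟩; rcases t with ⟨k', j'⟩; rcases u with ⟨k'', j''⟩
  grind [old, new, up]

theorem shift_up (s : Seg q) : shift s (up s) = up (up s) := by
  rcases s with ⟨k, j⟩; simp [shift, up]

theorem shift_up_self (s : Seg q) : shift (up s) s = s := by
  rcases s with ⟨k, j⟩; simp [shift, up]

end Seg

open Seg

/-- The group of words in the segments of `q` circles. -/
abbrev Words (q : ℕ) : Type := FreeGroup (Fin q × ℕ)

section

variable {p q r : ℕ}

/-- Effect on words of inserting a point in the segment `s`. -/
def split (s : Seg q) : Words q →* Words q :=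
  FreeGroup.lift fun u =>
    if u = s then FreeGroup.of s * FreeGroup.of (up s) else FreeGroup.of (shift s u)

theorem split_of_self (s : Seg q) :
    split s (FreeGroup.of s) = FreeGroup.of s * FreeGroup.of (up s) := by
  simp [split]

theorem split_of_ne {s u : Seg q} (h : u ≠ s) :
    split s (FreeGroup.of u) = FreeGroup.of (shift s u) := by
  simp [split, h]

/-- Both sides insert the same two points, in the two possible orders. On generators, the only cases
in which both points fall into one original segment are `t = s` and `t = up s`. -/
theorem split_split (s t : Seg q) (x : Words q) :
    split t (split s x) = split (new s t) (split (old s t) x) := by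
  suffices h : (split t).comp (split s) = (split (new s t)).comp (split (old s t)) from
    DFunLike.congr_fun h x
  ext u
  simp only [MonoidHom.comp_apply]
  by_cases h1 : u = s
  · subst h1
    by_cases h2 : t = u
    · subst h2
      simp [new_self, old_self, split_of_self, split_of_ne (up_ne _), split_of_ne (ne_up _),
        shift_up, shift_up_self, mul_assoc]
    · by_cases h3 : t = up u
      · subst h3
        simp [new_up, old_up, split_of_self, split_of_ne (ne_up u), split_of_ne (up_ne u),
          shift_up, shift_up_self, mul_assoc]
      · have h : u ≠ old u t ∧ shift t u = new u t ∧ shift t (up u) = up (new u t) ∧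
            shift (old u t) u = new u t := by
          rcases u with ⟨k, j⟩; rcases t with ⟨k', j'⟩; grind (splits := 30) [shift, up, old, new]
        simp [split_of_self, split_of_ne (Ne.symm h2), split_of_ne (Ne.symm h3),
          split_of_ne h.1, h.2]
  · rw [split_of_ne h1]
    by_cases h2 : shift s u = t
    · have h : old s t = u ∧ u ≠ new s t ∧ up u ≠ new s t ∧ shift (new s t) u = t ∧
          shift (new s t) (up u) = up t := by
        rcases u with ⟨k, j⟩; rcases t with ⟨k', j'⟩; rcases s with ⟨k'', j''⟩
        grind (splits := 30) [shift, up, old, new]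
      rw [h2, h.1]
      simp [split_of_self, split_of_ne h.2.1, split_of_ne h.2.2.1, h.2.2.2]
    · have h : u ≠ old s t ∧ shift (old s t) u ≠ new s t ∧
          shift (new s t) (shift (old s t) u) = shift t (shift s u) := by
        rcases u with ⟨k, j⟩; rcases t with ⟨k', j'⟩; rcases s with ⟨k'', j''⟩
        grind (splits := 30) [shift, up, old, new]
      rw [split_of_ne h2, split_of_ne h.1, split_of_ne h.2.1, h.2.2]

theorem collapse_of_self (s : Seg q) :
    Diagram.collapse s.1 s.2 (FreeGroup.of s) = 1 := by
  simp [Diagram.collapse]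

theorem collapse_of_ne {s u : Seg q} (h : u ≠ s) :
    Diagram.collapse s.1 s.2 (FreeGroup.of u) = FreeGroup.of (old s u) := by
  rcases s with ⟨k, j⟩; rcases u with ⟨k', j'⟩
  simp only [Diagram.collapse, FreeGroup.lift_apply_of, old]
  grind

/-- The collapse of a segment as a homomorphism indexed by segments. -/
def coll (s : Seg q) : Words q →* Words q := Diagram.collapse s.1 s.2

theorem coll_self (s : Seg q) : coll s (FreeGroup.of s) = 1 := collapse_of_self s

theorem coll_ne {s u : Seg q} (h : u ≠ s) : coll s (FreeGroup.of u) = FreeGroup.of (old s u) :=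
  collapse_of_ne h

/-- A point is forgotten by collapsing either of the two segments next to it; this is the segment
before the point, and `coll_up_split` treats the one after it. -/
theorem coll_split (s : Seg q) (x : Words q) : coll s (split s x) = x := by
  suffices h : (coll s).comp (split s) = MonoidHom.id _ from DFunLike.congr_fun h x
  ext u
  by_cases h : u = s
  · subst h
    simp [split_of_self, coll_self, coll_ne (up_ne u), old_up]
  · have : shift s u ≠ s := by
      rcases s with ⟨k, j⟩; rcases u with ⟨k', j'⟩; grind [shift, up]
    simp [split_of_ne h, coll_ne this, old_shift]

theorem coll_up_split (s : Seg q) (x : Words q) : coll (up s) (split s x) = x := by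
  suffices h : (coll (up s)).comp (split s) = MonoidHom.id _ from DFunLike.congr_fun h x
  ext u
  by_cases h : u = s
  · subst h
    simp [split_of_self, coll_self, coll_ne (ne_up u), old_up_self]
  · have : shift s u ≠ up s ∧ old (up s) (shift s u) = u := by
      rcases s with ⟨k, j⟩; rcases u with ⟨k', j'⟩; grind [shift, up, old]
    simp [split_of_ne h, coll_ne this.1, this.2]

/-- Insertion and collapse at different segments commute, once each segment is renamed to account
for the other operation. -/
theorem coll_shift_split {s t : Seg q} (h : t ≠ s) (x : Words q) :
    coll (shift t s) (split t x) = split (old s t) (coll s x) := by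
  suffices h : (coll (shift t s)).comp (split t) = (split (old s t)).comp (coll s) from
    DFunLike.congr_fun h x
  ext u
  simp only [MonoidHom.comp_apply]
  by_cases h1 : u = t
  · subst h1
    have h2 : u ≠ shift u s ∧ up u ≠ shift u s ∧ old (shift u s) u = old s u ∧
        old (shift u s) (up u) = up (old s u) := by
      rcases s with ⟨k, j⟩; rcases u with ⟨k', j'⟩; grind [shift, up, old]
    simp [split_of_self, coll_ne h, coll_ne h2.1, coll_ne h2.2.1, h2.2.2]
  · by_cases h2 : u = s
    · subst h2
      simp [split_of_ne h1, coll_self]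
    · have h3 : shift t u ≠ shift t s ∧ old s u ≠ old s t ∧
          old (shift t s) (shift t u) = shift (old s t) (old s u) := by
        rcases s with ⟨k, j⟩; rcases u with ⟨k', j'⟩; rcases t with ⟨k'', j''⟩
        grind [shift, up, old]
      simp [split_of_ne h1, coll_ne h2, coll_ne h3.1, split_of_ne h3.2.1, h3.2.2]

variable {M : Type*} [AddCommGroup M]

/-- The left part of a letter in which a point has been inserted. -/
def leftPart (l : Letter q) : Words q :=
  if l.2 then FreeGroup.of l.1 else (FreeGroup.of (up l.1))⁻¹

/-- The right part of a letter in which a point has been inserted. -/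
def rightPart (l : Letter q) : Words q :=
  if l.2 then FreeGroup.of (up l.1) else (FreeGroup.of l.1)⁻¹

/-- The orientation sign of a letter. -/
def letterSign (l : Letter q) : ℤ := if l.2 then 1 else -1

/-- The sum over all ways to cut a word in the interior of one of its letters. -/
def cutList : List (Letter q) → (Seg q → Words q → Words q → M) → M
  | [], _ => 0
  | l :: w, g => letterSign l • g l.1 (leftPart l) (rightPart l * split l.1 (FreeGroup.mk w)) +
      cutList w fun s a b => g s (split s (FreeGroup.mk [l]) * a) b

theorem split_mk_singleton (l : Letter q) :
    split l.1 (FreeGroup.mk [l]) = leftPart l * rightPart l := by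
  rcases l with ⟨s, _ | _⟩
  · have : (FreeGroup.mk [(s, false)]) = (FreeGroup.of s)⁻¹ := rfl
    simp [this, leftPart, rightPart, split_of_self]
  · exact (split_of_self s).trans (by simp [leftPart, rightPart])

theorem mk_append (w w' : List (Letter q)) :
    FreeGroup.mk (w ++ w') = FreeGroup.mk w * FreeGroup.mk w' := FreeGroup.mul_mk.symm

theorem mk_cons (l : Letter q) (w : List (Letter q)) :
    FreeGroup.mk (l :: w) = FreeGroup.mk [l] * FreeGroup.mk w := mk_append [l] w

/-- The product rule: the cut lies in one factor, and the other factor is split at the same segment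
and joined to the piece next to it. -/
theorem cutList_append (w w' : List (Letter q)) (g : Seg q → Words q → Words q → M) :
    cutList (w ++ w') g = cutList w (fun s a b => g s a (b * split s (FreeGroup.mk w'))) +
      cutList w' fun s a b => g s (split s (FreeGroup.mk w) * a) b := by
  induction w generalizing g with
  | nil => simp [cutList, ← FreeGroup.one_eq_mk]
  | cons l w ih =>
    simp only [List.cons_append, cutList, ih, mk_append, map_mul, mul_assoc, add_assoc]
    simp only [mk_cons l w, map_mul, mul_assoc]

/-- Both cuts produce the same two pieces in the free group, since the rest of the pair cancels; the
orientation signs are opposite. This is what makes the gluing independent of the reduction of loops.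
-/
theorem cutList_cancel (s : Seg q) (b : Bool) (g : Seg q → Words q → Words q → M) :
    cutList [(s, b), (s, !b)] g = 0 := by
  cases b
  · have : (FreeGroup.mk [(s, false)]) = (FreeGroup.of s)⁻¹ := rfl
    have h : (FreeGroup.mk [(s, true)]) = (FreeGroup.of s) := by simp [FreeGroup.of]
    simp [cutList, letterSign, leftPart, rightPart, this, h, split_of_self,
      ← FreeGroup.one_eq_mk]
  · have : (FreeGroup.mk [(s, false)]) = (FreeGroup.of s)⁻¹ := rfl
    have h : (FreeGroup.mk [(s, true)]) = (FreeGroup.of s) := by simp [FreeGroup.of]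
    simp [cutList, letterSign, leftPart, rightPart, this, h, split_of_self,
      ← FreeGroup.one_eq_mk, ← mul_assoc]

theorem cutList_step {w w' : List (Letter q)} (h : FreeGroup.Red.Step w w')
    (g : Seg q → Words q → Words q → M) : cutList w g = cutList w' g := by
  cases h with
  | @not L₁ L₂ x b =>
    have e : L₁ ++ (x, b) :: (x, !b) :: L₂ = L₁ ++ ([(x, b), (x, !b)] ++ L₂) := by simp
    have e1 : FreeGroup.mk [(x, b), (x, !b)] = 1 := by
      rw [FreeGroup.one_eq_mk]
      exact FreeGroup.Red.exact.2 ⟨[], Relation.ReflTransGen.single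
        (FreeGroup.Red.Step.not (L₁ := []) (L₂ := [])), Relation.ReflTransGen.refl⟩
    rw [e, cutList_append, cutList_append, cutList_append, cutList_cancel, mk_append, e1]
    simp

/-- The sum over all ways to cut an element of the free group in the interior of a letter; a letter
that is traversed backwards contributes with a minus sign. -/
def cut (x : Words q) (g : Seg q → Words q → Words q → M) : M :=
  Quot.liftOn x (fun w => cutList w g) fun _ _ h => cutList_step h g

theorem cut_mk (w : List (Letter q)) (g : Seg q → Words q → Words q → M) :
    cut (FreeGroup.mk w) g = cutList w g := rfl

theorem cut_one (g : Seg q → Words q → Words q → M) : cut 1 g = 0 := rfl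

theorem cut_of (s : Seg q) (g : Seg q → Words q → Words q → M) :
    cut (FreeGroup.of s) g = g s (FreeGroup.of s) (FreeGroup.of (up s)) := by
  simp [FreeGroup.of, cut_mk, cutList, letterSign, leftPart, rightPart, ← FreeGroup.one_eq_mk]

theorem cut_mul (x y : Words q) (g : Seg q → Words q → Words q → M) :
    cut (x * y) g = cut x (fun s a b => g s a (b * split s y)) +
      cut y fun s a b => g s (split s x * a) b := by
  induction x using Quot.inductionOn with | _ w
  induction y using Quot.inductionOn with | _ w'
  exact cutList_append w w' g

theorem cutList_zero (w : List (Letter q)) :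
    cutList w (fun _ _ _ => (0 : M)) = 0 := by
  induction w with
  | nil => rfl
  | cons l w ih => simp [cutList, ih]

theorem cutList_add (w : List (Letter q)) (g g' : Seg q → Words q → Words q → M) :
    cutList w (fun s a b => g s a b + g' s a b) = cutList w g + cutList w g' := by
  induction w generalizing g g' with
  | nil => simp [cutList]
  | cons l w ih => simp only [cutList, ih, smul_add]; abel

theorem cut_zero (x : Words q) : cut x (fun _ _ _ => (0 : M)) = 0 := by
  induction x using Quot.inductionOn with | _ w
  exact cutList_zero w

theorem cut_add (x : Words q) (g g' : Seg q → Words q → Words q → M) :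
    cut x (fun s a b => g s a b + g' s a b) = cut x g + cut x g' := by
  induction x using Quot.inductionOn with | _ w
  exact cutList_add w g g'

/-- Cutting as an additive function. -/
def cutHom (x : Words q) : (Seg q → Words q → Words q → M) →+ M where
  toFun := cut x
  map_zero' := cut_zero x
  map_add' := cut_add x

theorem cut_neg (x : Words q) (g : Seg q → Words q → Words q → M) :
    cut x (fun s a b => - g s a b) = - cut x g := map_neg (cutHom x) g

theorem cut_zsmul (x : Words q) (n : ℤ) (g : Seg q → Words q → Words q → M) :
    cut x (fun s a b => n • g s a b) = n • cut x g := map_zsmul (cutHom x) n g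

theorem cut_sum {ι : Type*} (t : Finset ι) (x : Words q) (g : ι → Seg q → Words q → Words q → M) :
    cut x (fun s a b => ∑ i ∈ t, g i s a b) = ∑ i ∈ t, cut x (g i) := by
  have h := map_sum (cutHom (M := M) x) g t
  have e : (fun s a b => ∑ i ∈ t, g i s a b) = ∑ i ∈ t, g i := by
    funext s a b; simp [Finset.sum_apply]
  rw [e]; exact h

theorem cutList_congr {w : List (Letter q)} {g g' : Seg q → Words q → Words q → M}
    (h : ∀ w₁ l w₂, w = w₁ ++ l :: w₂ →
      g l.1 (split l.1 (FreeGroup.mk w₁) * leftPart l)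
          (rightPart l * split l.1 (FreeGroup.mk w₂)) =
        g' l.1 (split l.1 (FreeGroup.mk w₁) * leftPart l)
          (rightPart l * split l.1 (FreeGroup.mk w₂))) :
    cutList w g = cutList w g' := by
  induction w generalizing g g' with
  | nil => rfl
  | cons l w ih =>
    have h0 := h [] l w rfl
    simp only [← FreeGroup.one_eq_mk, map_one, one_mul] at h0
    simp only [cutList, h0]
    congr 1
    refine ih fun w₁ l' w₂ e => ?_
    have h1 := h (l :: w₁) l' w₂ (by simp [e])
    simpa only [mk_cons l w₁, map_mul, mul_assoc] using h1

/-- The pieces of a cut always multiply to the split word, so nothing else about `g` matters. -/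
theorem cut_congr {x : Words q} {g g' : Seg q → Words q → Words q → M}
    (h : ∀ s a b, a * b = split s x → g s a b = g' s a b) : cut x g = cut x g' := by
  induction x using Quot.inductionOn with | _ w
  refine cutList_congr fun w₁ l w₂ e => h _ _ _ ?_
  change _ = split l.1 (FreeGroup.mk w)
  rw [e, mk_append, mk_cons, map_mul, map_mul, split_mk_singleton]
  simp only [mul_assoc]

/-- A finer version of `cut_congr`: only cuts of the reduced word have to be compared. It is needed
where the validity of the letters enters, which is known for the reduced word. -/
theorem cut_congr_toWord {x : Words q} {g g' : Seg q → Words q → Words q → M}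
    (h : ∀ w₁ l w₂, x.toWord = w₁ ++ l :: w₂ →
      g l.1 (split l.1 (FreeGroup.mk w₁) * leftPart l)
          (rightPart l * split l.1 (FreeGroup.mk w₂)) =
        g' l.1 (split l.1 (FreeGroup.mk w₁) * leftPart l)
          (rightPart l * split l.1 (FreeGroup.mk w₂))) : cut x g = cut x g' := by
  rw [← FreeGroup.mk_toWord (x := x), cut_mk, cut_mk]
  exact cutList_congr h

/-- The product rule is applied to `x⁻¹ * x = 1`, which has no cuts. -/
theorem cut_inv (x : Words q) (g : Seg q → Words q → Words q → M) :
    cut x⁻¹ g = - cut x fun s a b => g s b⁻¹ a⁻¹ := by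
  have h := cut_mul x⁻¹ x fun s a b => g s a (b * split s x⁻¹)
  rw [inv_mul_cancel, cut_one] at h
  simp only [map_inv, mul_assoc, mul_inv_cancel, mul_one] at h
  rw [eq_neg_iff_add_eq_zero, h]
  congr 1
  refine cut_congr fun s a b e => ?_
  rw [← e]
  group

/-- Cutting two words in both orders. -/
theorem cut_cut (x y : Words q)
    (K : Seg q → Seg q → Words q → Words q → Words q → Words q → M) :
    cut x (fun s a b => cut (split s y) fun t c d =>
        K (old s t) (new s t) (split t a) (split t b) c d) =
      cut y fun t c d => cut (split t x) fun s a b => K t s a b (split s c) (split s d) := by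
  induction x using FreeGroup.induction_on generalizing K y with
  | C1 => simp [cut_one, cut_zero]
  | of s =>
    induction y using FreeGroup.induction_on generalizing K with
    | C1 => simp [cut_one, cut_zero]
    | of t =>
      -- If both words are the same letter, then the first cut leaves two letters in the other word.
      -- Each side has two terms, and they agree in reversed order.
      by_cases h : t = s
      · subst h
        simp [cut_of, split_of_self, cut_mul, old_self, new_self, old_up, new_up,
          split_of_ne (up_ne t), split_of_ne (ne_up t), shift_up, shift_up_self]
        abel
      · have h1 : shift s t ≠ s ∧ shift s t ≠ up s ∧ old s (shift s t) = t ∧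
            new s (shift s t) = shift t s ∧ shift (shift s t) s = shift t s ∧
            shift (shift s t) (up s) = up (shift t s) ∧ t ≠ shift t s ∧ up t ≠ shift t s ∧
            shift (shift t s) t = shift s t ∧ shift (shift t s) (up t) = up (shift s t) := by
          rcases s with ⟨k, j⟩; rcases t with ⟨k', j'⟩; grind (splits := 30) [shift, up, old, new]
        obtain ⟨e1, e2, e3, e4, e5, e6, e7, e8, e9, e10⟩ := h1
        simp [cut_of, split_of_ne h, split_of_ne (Ne.symm h), split_of_ne e1.symm,
          split_of_ne e2.symm, e3, e4, e5, e6, split_of_ne e7, split_of_ne e8, e9, e10]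
    | inv_of t ih =>
      simp only [cut_inv, map_inv] at ih ⊢
      rw [← ih fun t s a b c d => K t s a b d⁻¹ c⁻¹]
      simp [cut_of]
    | mul y z ih1 ih2 =>
      simp only [map_mul, cut_mul]
      rw [← ih1 fun t s a b c d => K t s a b c (d * split s (split t z)),
        ← ih2 fun t s a b c d => K t s a b (split s (split t y) * c) d]
      simp [cut_of, ← split_split]
  | inv_of s ih =>
    simp only [cut_inv, map_inv, cut_neg]
    rw [ih y fun t s a b c d => K t s b⁻¹ a⁻¹ c d]
  | mul x z ih1 ih2 =>
    simp only [map_mul, cut_mul, cut_add]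
    rw [← ih1 y fun t s a b c d => K t s a (b * split s (split t z)) c d,
      ← ih2 y fun t s a b c d => K t s (split s (split t x) * a) b c d]
    simp only [← split_split]

/-- Cutting one word twice: cutting the right part after the first cut amounts to cutting
the left part after the second cut. -/
theorem cut_right_eq_cut_left (x : Words q)
    (K : Seg q → Seg q → Words q → Words q → Words q → M) :
    cut x (fun s a b => cut b fun t c d => K (old s t) (new s t) (split t a) c d) =
      cut x fun t a b => cut a fun s c d => K t s c d (split s b) := by
  induction x using FreeGroup.induction_on generalizing K with
  | C1 => simp [cut_one]
  | of s => simp [cut_of, old_up, new_up, split_of_ne (ne_up s), shift_up_self,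
      split_of_ne (up_ne s), shift_up]
  | inv_of s ih =>
    simp [cut_of, cut_inv, old_self, new_self, split_of_ne (up_ne s), split_of_ne (ne_up s),
      shift_up, shift_up_self]
  | mul x y ih1 ih2 =>
    -- Either both cuts lie in `x`, or both in `y`, or there is one in each factor; the mixed terms
    -- are compared by `cut_cut`.
    simp only [cut_mul, cut_add, map_mul]
    have h1 := ih1 fun t s a c d => K t s a c (d * split s (split t y))
    have h2 := ih2 fun t s a c d => K t s (split s (split t x) * a) c d
    have h3 := cut_cut x y fun t s a b c d => K t s a (b * c) d
    simp only [← split_split] at h1 h2 h3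
    rw [h1, h2, h3]
    abel

/-- Cutting a word after a segment has been collapsed. -/
theorem cut_coll (f : Seg q) (x : Words q) (g : Seg q → Words q → Words q → M) :
    cut (coll f x) g = cut x fun t a b =>
      if t = f then 0 else g (old f t) (coll (shift t f) a) (coll (shift t f) b) := by
  induction x using FreeGroup.induction_on generalizing g with
  | C1 => simp [cut_one]
  | of t =>
    -- For the collapsed segment itself both sides vanish: on the left nothing remains to be cut,
    -- and on the right the term is excluded.
    by_cases h : t = f
    · simp [h, coll_self, cut_one, cut_of]
    · have h1 : t ≠ shift t f ∧ up t ≠ shift t f ∧ old (shift t f) t = old f t ∧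
          old (shift t f) (up t) = up (old f t) := by
        rcases f with ⟨k, j⟩; rcases t with ⟨k', j'⟩; grind [shift, up, old]
      simp [cut_of, coll_ne h, h, coll_ne h1.1, coll_ne h1.2.1, h1.2.2]
  | inv_of t ih =>
    rw [map_inv, cut_inv, cut_inv, ih]
    simp
  | mul x y ih1 ih2 =>
    simp only [map_mul, cut_mul, ih1, ih2]
    congr 1 <;> congr 1 <;> funext t a b <;> split_ifs with h
    · rfl
    · simp [coll_shift_split h]
    · rfl
    · simp [coll_shift_split h]

/-- The pieces after a point has been inserted in the segment `s` of the source, and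
its image in the segment `t` of the target. -/
def insTrack (s : Seg p) (t : Seg q) (a b : Words q) (P : Seg p → Words q) (u : Seg p) : Words q :=
  if u = s then a else if u = up s then b else split t (P (old s u))

theorem insTrack_self (s : Seg p) (t : Seg q) (a b : Words q) (P : Seg p → Words q) :
    insTrack s t a b P s = a := if_pos rfl

theorem insTrack_up (s : Seg p) (t : Seg q) (a b : Words q) (P : Seg p → Words q) :
    insTrack s t a b P (up s) = b := by simp [insTrack, up_ne]

theorem insTrack_shift {s u : Seg p} (h : u ≠ s) (t : Seg q) (a b : Words q)
    (P : Seg p → Words q) : insTrack s t a b P (shift s u) = split t (P u) := by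
  have : shift s u ≠ s ∧ shift s u ≠ up s := by
    rcases s with ⟨k, j⟩; rcases u with ⟨k', j'⟩; grind [shift, up]
  simp [insTrack, this, old_shift]

/-- Substitution intertwines inserting a point in the source with inserting its image in the target,
provided that `a` and `b` are the two pieces of the word substituted for `s`. -/
theorem lift_insTrack_split {s : Seg p} {t : Seg q} {a b : Words q} {P : Seg p → Words q}
    (h : a * b = split t (P s)) (x : Words p) :
    FreeGroup.lift (insTrack s t a b P) (split s x) = split t (FreeGroup.lift P x) := by
  suffices h : (FreeGroup.lift (insTrack s t a b P)).comp (split s) =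
      (split t).comp (FreeGroup.lift P) from DFunLike.congr_fun h x
  ext u
  by_cases hu : u = s
  · subst hu
    simp [split_of_self, insTrack_self, insTrack_up, h]
  · simp [split_of_ne hu, insTrack_shift hu]

/-- A cut of a substituted word lies in the image of one letter, so it consists of a choice of that
letter and a cut of the word substituted for it. This is the source of associativity. -/
theorem cut_lift (P : Seg p → Words q) (x : Words p) (g : Seg q → Words q → Words q → M) :
    cut (FreeGroup.lift P x) g = cut x fun s a b => cut (P s) fun t c d =>
      g t (FreeGroup.lift (insTrack s t c d P) a) (FreeGroup.lift (insTrack s t c d P) b) := by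
  induction x using FreeGroup.induction_on generalizing g with
  | C1 => simp [cut_one]
  | of s => simp [cut_of, insTrack_self, insTrack_up]
  | inv_of s ih =>
    simp only [map_inv, cut_inv, ih]
  | mul x y ih1 ih2 =>
    simp only [map_mul, cut_mul, ih1, ih2]
    congr 1 <;> (congr 1; funext s a b; refine cut_congr fun t c d h => ?_) <;>
      rw [lift_insTrack_split h]

end

/-! ### Configurations of half-edges on circles -/

/-- Half-edges on `q` circles, each ending at a vertex in `V`, together with edges between these
vertices and words in the segments of the `q` circles, one for each segment of `p` circles. -/
@[ext] structure Conf (p q : ℕ) (V : Type) where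
  edges : Multiset (Sym2 V)
  /-- the number of half-edges on each circle -/
  len : Fin q → ℕ
  rest : Fin q → List V
  track : Seg p → Words q

section

variable {p q r : ℕ} {V : Type} {M : Type*} [AddCommGroup M]

/-- The number of half-edges before the end of a segment. -/
def pos (len : Fin q → ℕ) (s : Seg q) : ℕ := ∑ k ∈ Finset.Iio s.1, len k + s.2

theorem pos_update (len : Fin q → ℕ) (k : Fin q) (s : Seg q) :
    pos (Function.update len k (len k + 1)) s = pos len s + if k < s.1 then 1 else 0 := by
  unfold pos
  split_ifs with h
  · have hk : k ∈ Finset.Iio s.1 := by simpa using h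
    rw [Finset.sum_update_of_mem hk, ← Finset.sum_sdiff (Finset.singleton_subset_iff.2 hk)]
    simp only [Finset.sum_singleton]
    ring
  · rw [Finset.sum_update_of_notMem (by simpa using not_lt.1 h)]
    simp

/-- Of two inserted points the left one raises the position of the right one by one, but only if it
is inserted first. Hence the two orders differ by exactly one sign. -/
theorem pos_swap (len : Fin q → ℕ) (s t : Seg q) :
    (-1 : ℤ) ^ pos len s * (-1) ^ pos (Function.update len s.1 (len s.1 + 1)) t =
      -((-1) ^ pos len (old s t) *
        (-1) ^ pos (Function.update len (old s t).1 (len (old s t).1 + 1)) (new s t)) := by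
  rw [pos_update, pos_update, ← pow_add, ← pow_add,
    show ∀ n : ℕ, -(-1 : ℤ) ^ n = (-1) ^ (n + 1) from fun n => by rw [pow_succ]; ring]
  apply neg_one_pow_congr
  rcases s with ⟨k, j⟩; rcases t with ⟨k', j'⟩
  rcases lt_trichotomy k k' with h | h | h
  · simp only [old, new, h.ne, false_and, if_false, h, if_true, not_lt_of_gt h]
    simp only [Nat.even_iff]; omega
  · subst h
    by_cases h2 : j < j'
    · simp only [pos, old, new, h2, true_and, if_true, not_le_of_gt h2, if_false, lt_irrefl]
      simp only [Nat.even_iff]; omega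
    · simp only [pos, old, new, h2, true_and, if_true, not_lt.1 h2, if_false, lt_irrefl, up]
      simp only [Nat.even_iff]; omega
  · simp only [old, new, h.ne', false_and, if_false, h, if_true, not_lt_of_gt h]
    simp only [Nat.even_iff]; omega

/-- No bound on `j` is needed: beyond the end of the list, `insertIdx` does nothing. -/
theorem insertIdx_insertIdx {α : Type*} (l : List α) (i j : ℕ) (h : i ≤ j) (x y : α) :
    (l.insertIdx j x).insertIdx i y = (l.insertIdx i y).insertIdx (j + 1) x := by
  by_cases hj : j ≤ l.length
  · exact (List.insertIdx_comm y x h hj).symm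
  · have := List.length_insertIdx_le_succ (l := l) (x := y) (i := i)
    rw [List.insertIdx_of_length_lt (by omega : l.length < j),
      List.insertIdx_of_length_lt (by omega : (l.insertIdx i y).length < j + 1)]

theorem insertIdx_eq_take_append {α : Type*} {l : List α} {j : ℕ} (x : α) (h : j ≤ l.length) :
    l.insertIdx j x = l.take j ++ x :: l.drop j := by
  induction l generalizing j with
  | nil => simp_all
  | cons y l ih => cases j with
    | zero => simp
    | succ j => simp [ih (by simpa using h)]

namespace Conf

/-- Attach a half-edge in the segment `t`, which is the end of the segment `s` of the source. -/
def insert (c : Conf p q V) (s : Seg p) (t : Seg q) (v : V) (a b : Words q) : Conf p q V where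
  edges := c.edges
  len := Function.update c.len t.1 (c.len t.1 + 1)
  rest := Function.update c.rest t.1 ((c.rest t.1).insertIdx t.2 v)
  track := insTrack s t a b c.track

/-- The signed sum over all ways to attach a half-edge along the word of the segment `s`. -/
def cutAt (s : Seg p) (v : V) (φ : Conf p q V → M) (c : Conf p q V) : M :=
  cut (c.track s) fun t a b => (-1 : ℤ) ^ pos c.len t • φ (c.insert s t v a b)

/-- Since `len` is recorded independently of the lists, it grows at each insertion, even at an index
that is out of range. So the exchange rules hold for all configurations, without hypotheses on the
indices. -/
theorem insert_len_swap (len : Fin q → ℕ) (s t : Seg q) :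
    Function.update (Function.update len s.1 (len s.1 + 1)) t.1
        (Function.update len s.1 (len s.1 + 1) t.1 + 1) =
      Function.update (Function.update len (old s t).1 (len (old s t).1 + 1)) (new s t).1
        (Function.update len (old s t).1 (len (old s t).1 + 1) (new s t).1 + 1) := by
  have h : (old s t).1 = t.1 ∧ (new s t).1 = s.1 := by
    rcases s with ⟨k, j⟩; rcases t with ⟨k', j'⟩; grind [old, new, up]
  rw [h.1, h.2]
  by_cases hk : s.1 = t.1
  · rw [hk]
  · rw [Function.update_of_ne (Ne.symm hk), Function.update_of_ne hk, Function.update_comm hk]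

theorem insert_rest_swap (rest : Fin q → List V) (s t : Seg q) (v v' : V) :
    Function.update (Function.update rest s.1 ((rest s.1).insertIdx s.2 v)) t.1
        ((Function.update rest s.1 ((rest s.1).insertIdx s.2 v) t.1).insertIdx t.2 v') =
      Function.update (Function.update rest (old s t).1
          ((rest (old s t).1).insertIdx (old s t).2 v')) (new s t).1
        ((Function.update rest (old s t).1
          ((rest (old s t).1).insertIdx (old s t).2 v') (new s t).1).insertIdx (new s t).2 v) := by
  rcases s with ⟨k, j⟩; rcases t with ⟨k', j'⟩
  by_cases hk : k = k'
  · subst hk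
    by_cases h2 : j < j'
    · have e : old (k, j) (k, j') = (k, j' - 1) ∧ new (k, j) (k, j') = (k, j) := by
        grind [old, new, up]
      simp only [e, Function.update_self, Function.update_idem]
      rw [insertIdx_insertIdx _ j (j' - 1) (by omega), Nat.sub_add_cancel (by omega)]
    · have e : old (k, j) (k, j') = (k, j') ∧ new (k, j) (k, j') = (k, j + 1) := by
        grind [old, new, up]
      simp only [e, Function.update_self, Function.update_idem]
      rw [insertIdx_insertIdx _ j' j (by omega)]
  · have e : old (k, j) (k', j') = (k', j') ∧ new (k, j) (k', j') = (k, j) := by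
      grind [old, new, up]
    simp only [e, Function.update_of_ne (Ne.symm hk), Function.update_of_ne hk]
    rw [Function.update_comm hk]

/-- Apart from `track`, two attachments may be exchanged. The words `a` and `b` on the right are
irrelevant, since `track` is overwritten. -/
theorem insert_insert (c : Conf p q V) (s t : Seg p) (v v' : V) (σ τ : Seg q)
    (a b a' b' : Words q) :
    (c.insert s σ v a b).insert t τ v' a' b' =
      { (c.insert (old s t) (old σ τ) v' a b).insert (new s t) (new σ τ) v a' b' with
        track := insTrack t τ a' b' (insTrack s σ a b c.track) } := by
  simp only [insert, mk.injEq, true_and, and_true]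
  exact ⟨insert_len_swap _ _ _, insert_rest_swap _ _ _ _ _⟩

/-- The half-edges are attached along the words of two different segments of `c`, so `cut_cut`
applies; the sign comes from `pos_swap`. -/
theorem cutAt_cutAt_of_ne {s t : Seg p} (h1 : t ≠ s) (h2 : t ≠ up s) (v v' : V)
    (φ : Conf p q V → M) (c : Conf p q V) :
    cutAt s v (cutAt t v' φ) c = -cutAt (old s t) v' (cutAt (new s t) v φ) c := by
  have hf : (new s t ≠ t ∧ new s t ≠ up t ∧ up (new s t) ≠ t ∧ up (new s t) ≠ up t) ∧
      (old t (new s t) = s ∧ old t (up (new s t)) = up s) ∧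
      (old (new s t) t = old s t ∧ old (new s t) (up t) = up (old s t)) ∧
      new s t ≠ old s t ∧ new s t ≠ up (old s t) := by
    rcases s with ⟨k, j⟩; rcases t with ⟨k', j'⟩
    grind (splits := 30) [old, new, up]
  have hf2 : ∀ u, u ≠ new s t → u ≠ up (new s t) → u ≠ t → u ≠ up t →
      (old t u ≠ s ∧ old t u ≠ up s) ∧
      (old (new s t) u ≠ old s t ∧ old (new s t) u ≠ up (old s t)) := by
    intro u
    rcases s with ⟨k, j⟩; rcases t with ⟨k', j'⟩; rcases u with ⟨k'', j''⟩
    grind (splits := 40) [old, new, up]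
  obtain ⟨⟨d1, d2, d3, d4⟩, ⟨e1, e2⟩, ⟨e3, e4⟩, d5, d6⟩ := hf
  -- `T` lists the words after both attachments: the four pieces of the two words that were cut, and
  -- all others split twice. Both orders of attachment lead to it.
  let T : Seg q → Seg q → Words q → Words q → Words q → Words q → Seg p → Words q :=
    fun τ σ A B C D u => if u = new s t then A else if u = up (new s t) then B else
      if u = t then C else if u = up t then D else
        split σ (split τ (c.track (old (old s t) (old (new s t) u))))
  have T1 : ∀ σ τ a b a' b', insTrack t τ a' b' (insTrack s σ a b c.track) =
      T (old σ τ) (new σ τ) (split τ a) (split τ b) a' b' := by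
    intro σ τ a b a' b'
    funext u
    by_cases u1 : u = new s t
    · simp [T, insTrack, u1, d1, d2, e1]
    by_cases u2 : u = up (new s t)
    · simp [T, insTrack, u2, up_ne, d3, d4, e2]
    by_cases u3 : u = t
    · simp [T, insTrack, u3, Ne.symm d1, Ne.symm d3]
    by_cases u4 : u = up t
    · have := Ne.symm d1
      simp [T, insTrack, u4, up_ne, Ne.symm d2, this]
    · obtain ⟨⟨f1, f2⟩, f3, f4⟩ := hf2 u u1 u2 u3 u4
      simp only [T, insTrack, u1, u2, u3, u4, f1, f2, if_false]
      rw [split_split, old_old_old]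
  have T2 : ∀ σ τ a b a' b', insTrack (new s t) σ a b (insTrack (old s t) τ a' b' c.track) =
      T τ σ a b (split σ a') (split σ b') := by
    intro σ τ a b a' b'
    funext u
    by_cases u1 : u = new s t
    · simp [T, insTrack, u1]
    by_cases u2 : u = up (new s t)
    · simp [T, insTrack, u2]
    by_cases u3 : u = t
    · simp [T, insTrack, u3, Ne.symm d1, Ne.symm d3, e3]
    by_cases u4 : u = up t
    · have := Ne.symm d1
      simp [T, insTrack, u4, up_ne, Ne.symm d2, this, e4]
    · obtain ⟨⟨f1, f2⟩, f3, f4⟩ := hf2 u u1 u2 u3 u4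
      simp only [T, insTrack, u1, u2, u3, u4, f3, f4, if_false]
  -- The words `1` are placeholders: they only enter `track`, which is replaced by `T`.
  have key := cut_cut (c.track s) (c.track (old s t)) fun τ σ A B C D =>
    -(((-1 : ℤ) ^ pos c.len τ * (-1) ^ pos (Function.update c.len τ.1 (c.len τ.1 + 1)) σ) •
      φ { (c.insert (old s t) τ v' 1 1).insert (new s t) σ v 1 1 with
        track := T τ σ A B C D })
  have g1 : ∀ σ a b, insTrack s σ a b c.track t = split σ (c.track (old s t)) := by
    intro σ a b; simp [insTrack, h1, h2]
  have g2 : ∀ τ a b, insTrack (old s t) τ a b c.track (new s t) = split τ (c.track s) := by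
    intro σ a b; simp [insTrack, d5, d6, old_old]
  refine Eq.trans ?_ (key.trans ?_)
  · refine congrArg (cut _) (funext fun σ => funext fun a => funext fun b => ?_)
    change (-1 : ℤ) ^ pos c.len σ • cut (insTrack s σ a b c.track t) _ = _
    rw [g1, ← cut_zsmul]
    refine congrArg (cut _) (funext fun τ => funext fun a' => funext fun b' => ?_)
    rw [smul_smul, insert_insert, ← neg_smul, ← pos_swap, T1]
    rfl
  · simp only [cut_neg]
    refine congrArg Neg.neg (congrArg (cut _)
      (funext fun τ => funext fun a' => funext fun b' => ?_))
    change _ = (-1 : ℤ) ^ pos c.len τ • cut (insTrack (old s t) τ a' b' c.track (new s t)) _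
    rw [g2, ← cut_zsmul]
    refine congrArg (cut _) (funext fun σ => funext fun a => funext fun b => ?_)
    rw [smul_smul, ← T2]
    rfl

/-- Here both half-edges lie on the word of `s`, with `v` before `v'`. Either `v` comes first and
`v'` is attached to the right part, or `v'` comes first and `v` is attached to the left part;
`cut_right_eq_cut_left` compares the two. -/
theorem cutAt_cutAt_up (s : Seg p) (v v' : V) (φ : Conf p q V → M) (c : Conf p q V) :
    cutAt s v (cutAt (up s) v' φ) c = -cutAt s v' (cutAt s v φ) c := by
  have hf2 : ∀ u, u ≠ s → u ≠ up s → u ≠ up (up s) →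
      (old (up s) u ≠ s ∧ old (up s) u ≠ up s) ∧ (old s u ≠ s ∧ old s u ≠ up s) ∧
      old s (old (up s) u) = old s (old s u) := by
    intro u
    rcases s with ⟨k, j⟩; rcases u with ⟨k'', j''⟩
    grind (splits := 40) [old, up]
  have e1 : old (up s) s = s := old_up_self s
  have e2 : old s (up (up s)) = up s := by
    rcases s with ⟨k, j⟩; grind [old, up]
  have d1 : up (up s) ≠ s := by
    rcases s with ⟨k, j⟩; grind [up]
  let T : Seg q → Seg q → Words q → Words q → Words q → Seg p → Words q :=
    fun τ σ A B C u => if u = s then A else if u = up s then B else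
      if u = up (up s) then C else split σ (split τ (c.track (old s (old s u))))
  have T1 : ∀ σ τ a b a' b', insTrack (up s) τ a' b' (insTrack s σ a b c.track) =
      T (old σ τ) (new σ τ) (split τ a) a' b' := by
    intro σ τ a b a' b'
    funext u
    by_cases u1 : u = s
    · simp [T, insTrack, u1, ne_up, d1.symm, e1]
    by_cases u2 : u = up s
    · simp [T, insTrack, u2, up_ne]
    by_cases u3 : u = up (up s)
    · simp [T, insTrack, u3, up_ne, d1]
    · obtain ⟨⟨f1, f2⟩, ⟨f3, f4⟩, f5⟩ := hf2 u u1 u2 u3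
      simp only [T, insTrack, u1, u2, u3, f1, f2, if_false]
      rw [split_split, f5]
  have T2 : ∀ σ τ a b a' b', insTrack s σ a' b' (insTrack s τ a b c.track) =
      T τ σ a' b' (split σ b) := by
    intro σ τ a b a' b'
    funext u
    by_cases u1 : u = s
    · simp [T, insTrack, u1]
    by_cases u2 : u = up s
    · simp [T, insTrack, u2, up_ne]
    by_cases u3 : u = up (up s)
    · simp [T, insTrack, u3, up_ne, d1, e2]
    · obtain ⟨⟨f1, f2⟩, ⟨f3, f4⟩, f5⟩ := hf2 u u1 u2 u3
      simp only [T, insTrack, u1, u2, u3, f3, f4, if_false]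
  have key := cut_right_eq_cut_left (c.track s) fun τ σ A B C =>
    -(((-1 : ℤ) ^ pos c.len τ * (-1) ^ pos (Function.update c.len τ.1 (c.len τ.1 + 1)) σ) •
      φ { (c.insert s τ v' 1 1).insert s σ v 1 1 with track := T τ σ A B C })
  refine Eq.trans ?_ (key.trans ?_)
  · refine congrArg (cut _) (funext fun σ => funext fun a => funext fun b => ?_)
    change (-1 : ℤ) ^ pos c.len σ • cut (insTrack s σ a b c.track (up s)) _ = _
    rw [insTrack_up, ← cut_zsmul]
    refine congrArg (cut _) (funext fun τ => funext fun a' => funext fun b' => ?_)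
    rw [smul_smul, insert_insert, ← neg_smul, ← pos_swap, T1]
    rfl
  · simp only [cut_neg]
    refine congrArg Neg.neg (congrArg (cut _)
      (funext fun τ => funext fun a' => funext fun b' => ?_))
    change _ = (-1 : ℤ) ^ pos c.len τ • cut (insTrack s τ a' b' c.track s) _
    rw [insTrack_self, ← cut_zsmul]
    refine congrArg (cut _) (funext fun σ => funext fun a => funext fun b => ?_)
    rw [smul_smul, ← T2 σ τ a' b' a b]
    rfl

/-- Attaching two half-edges in the two possible orders. -/
theorem cutAt_cutAt (s t : Seg p) (v v' : V) (φ : Conf p q V → M) :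
    cutAt s v (cutAt t v' φ) = -cutAt (old s t) v' (cutAt (new s t) v φ) := by
  funext c
  by_cases h1 : t = s
  · subst h1
    rw [old_self, new_self, Pi.neg_apply, cutAt_cutAt_up, neg_neg]
  by_cases h2 : t = up s
  · subst h2
    rw [old_up, new_up, Pi.neg_apply, cutAt_cutAt_up]
  exact cutAt_cutAt_of_ne h1 h2 v v' φ c

theorem cutAt_add (s : Seg p) (v : V) (φ ψ : Conf p q V → M) :
    cutAt s v (φ + ψ) = cutAt s v φ + cutAt s v ψ := by
  funext c
  simp only [cutAt, Pi.add_apply, smul_add, cut_add]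

theorem cutAt_zero (s : Seg p) (v : V) : cutAt s v (0 : Conf p q V → M) = 0 := by
  funext c
  simp only [cutAt, Pi.zero_apply, smul_zero, cut_zero]

/-- Attaching a half-edge as an additive function. -/
def cutAtHom (s : Seg p) (v : V) : (Conf p q V → M) →+ (Conf p q V → M) where
  toFun := cutAt s v
  map_zero' := cutAt_zero s v
  map_add' := cutAt_add s v

/-- Attaching several half-edges, one after the other. -/
def cuts (L : List (Seg p × V)) : (Conf p q V → M) →+ (Conf p q V → M) :=
  L.foldr (fun e f => (cutAtHom e.1 e.2).comp f) (AddMonoidHom.id _)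

theorem cuts_nil (φ : Conf p q V → M) : cuts [] φ = φ := rfl

theorem cuts_cons (e : Seg p × V) (L : List (Seg p × V)) (φ : Conf p q V → M) :
    cuts (e :: L) φ = cutAt e.1 e.2 (cuts L φ) := rfl

theorem cuts_append (L L' : List (Seg p × V)) (φ : Conf p q V → M) :
    cuts (L ++ L') φ = cuts L (cuts L' φ) := by
  induction L with
  | nil => rfl
  | cons e L ih => rw [List.cons_append, cuts_cons, ih, cuts_cons]

theorem cutAt_zsmul (s : Seg p) (v : V) (n : ℤ) (φ : Conf p q V → M) :
    cutAt s v (n • φ) = n • cutAt s v φ := map_zsmul (cutAtHom s v) n φ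

/-- The effect on the name of a later segment of attaching a half-edge in the segment `s`. -/
def later (s : Seg p) (e : Seg p × V) : Seg p × V := (if e.1.1 = s.1 then up e.1 else e.1, e.2)

/-- The new half-edge is moved past those of `L` one at a time. Each exchange costs a sign and
undoes the shift of a label on the same circle. -/
theorem cutAt_cuts_later (s : Seg p) (v : V) (L : List (Seg p × V))
    (hL : ∀ e ∈ L, e.1.1 = s.1 → s.2 ≤ e.1.2) (φ : Conf p q V → M) :
    cutAt s v (cuts (L.map (later s)) φ) = (-1 : ℤ) ^ L.length • cuts L (cutAt s v φ) := by
  induction L with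
  | nil => simp [cuts_nil]
  | cons e L ih =>
    have h := hL e (by simp)
    have h1 : old s (later s e).1 = e.1 ∧ new s (later s e).1 = s := by
      rcases s with ⟨k, j⟩; rcases e with ⟨⟨k', j'⟩, w⟩
      simp only [later] at h ⊢
      grind [old, new, up]
    rw [List.map_cons, cuts_cons, cutAt_cutAt, h1.1, h1.2, ih fun e he => hL e (by simp [he]),
      cutAt_zsmul, List.length_cons, pow_succ, cuts_cons]
    simp [later]

end Conf

/-- The list of all half-edges, in their order; the half-edge at which the segment `s` ends is
labelled by `s`. -/
def halfList (R : Fin p → List V) : List (Seg p × V) :=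
  (List.finRange p).flatMap fun i => (R i).zipIdx.map fun vt => ((i, vt.2), vt.1)

theorem length_halfList (R : Fin p → List V) : (halfList R).length = ∑ k, (R k).length := by
  simp [halfList, List.length_flatMap, Fin.sum_univ_def]

/-- The list is broken where the new half-edge belongs. The length of the first part is its
position, which determines the sign, and only the labels in the second part change. -/
theorem halfList_insert (R : Fin p → List V) (s : Seg p) (hs : s.2 ≤ (R s.1).length) (v : V) :
    ∃ A B, halfList R = A ++ B ∧
      halfList (Function.update R s.1 ((R s.1).insertIdx s.2 v)) =
        A ++ (s, v) :: B.map (Conf.later s) ∧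
      A.length = pos (fun k => (R k).length) s ∧
      ∀ e ∈ B, e.1.1 = s.1 → s.2 ≤ e.1.2 := by
  rcases s with ⟨k, j⟩
  obtain ⟨l₁, l₂, hl⟩ := List.append_of_mem (List.mem_finRange k)
  have hnd := List.nodup_finRange p
  rw [hl] at hnd
  have hk1 : k ∉ l₁ := fun h => by simpa using List.disjoint_of_nodup_append hnd h
  have hk2 : k ∉ l₂ := (List.nodup_cons.1 (List.nodup_append.1 hnd).2.1).1
  have hl1 : ∀ i, i ∈ l₁ ↔ i < k := by
    intro i
    have hs : (l₁ ++ k :: l₂).Pairwise (· < ·) := hl ▸ List.pairwise_lt_finRange p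
    rw [List.pairwise_append, List.pairwise_cons] at hs
    constructor
    · exact fun h => hs.2.2 i h k (by simp)
    · intro h
      have hi : i ∈ l₁ ++ k :: l₂ := hl ▸ List.mem_finRange i
      rcases List.mem_append.1 hi with hi | hi
      · exact hi
      · rcases List.mem_cons.1 hi with rfl | hi
        · exact absurd h (lt_irrefl _)
        · exact absurd (hs.2.1.1 i hi) (not_lt_of_gt h)
  let g : (Fin p → List V) → Fin p → List (Seg p × V) :=
    fun R i => (R i).zipIdx.map fun vt => ((i, vt.2), vt.1)
  refine ⟨l₁.flatMap (g R) ++ ((R k).take j).zipIdx.map fun vt => ((k, vt.2), vt.1),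
    (((R k).drop j).zipIdx j).map (fun vt => ((k, vt.2), vt.1)) ++ l₂.flatMap (g R),
    ?_, ?_, ?_, ?_⟩
  · have e : (R k).zipIdx = ((R k).take j).zipIdx ++ ((R k).drop j).zipIdx j := by
      conv_lhs => rw [← List.take_append_drop j (R k), List.zipIdx_append]
      simp [min_eq_left hs]
    simp only [halfList, hl, List.flatMap_append, List.flatMap_cons, e, List.map_append, g,
      List.append_assoc]
  · have e : ((R k).insertIdx j v).zipIdx = ((R k).take j).zipIdx ++ (v, j) ::
        ((R k).drop j).zipIdx (j + 1) := by
      rw [insertIdx_eq_take_append _ hs, List.zipIdx_append]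
      simp [min_eq_left hs]
    have e1 : l₁.flatMap (g (Function.update R k ((R k).insertIdx j v))) = l₁.flatMap (g R) := by
      refine List.flatMap_congr fun i hi => ?_
      simp only [g]
      rw [Function.update_of_ne fun h : i = k => hk1 (h ▸ hi)]
    have e2 : l₂.flatMap (g (Function.update R k ((R k).insertIdx j v))) =
        (l₂.flatMap (g R)).map (Conf.later (k, j)) := by
      rw [List.map_flatMap]
      refine List.flatMap_congr fun i hi => ?_
      have hik : i ≠ k := fun h => hk2 (h ▸ hi)
      simp only [g]
      rw [Function.update_of_ne hik, List.map_map]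
      simp [Conf.later, hik, Function.comp_def]
    change (List.finRange p).flatMap (g _) = _
    rw [hl, List.flatMap_append, List.flatMap_cons, e1, e2]
    simp only [g, Function.update_self, e, List.map_append, List.map_cons, List.append_assoc,
      List.cons_append, List.map_map]
    congr 4
    rw [List.zipIdx_succ, List.map_map]
    simp [Conf.later, up, Function.comp_def]
  · rw [List.length_append, List.length_flatMap, pos]
    congr 1
    · have : Finset.Iio k = l₁.toFinset := by ext i; simp [hl1]
      rw [this, List.sum_toFinset _ (List.nodup_append.1 hnd).1]
      simp [g]
    · simpa using hs
  · intro e he h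
    rcases List.mem_append.1 he with he | he
    · obtain ⟨⟨w, t⟩, ht, rfl⟩ := List.mem_map.1 he
      exact (List.mem_zipIdx ht).1
    · obtain ⟨i, hi, he⟩ := List.mem_flatMap.1 he
      obtain ⟨⟨w, t⟩, ht, rfl⟩ := List.mem_map.1 he
      exact absurd hi fun hi => hk2 ((show i = k from h) ▸ hi)

/-- Attaching a half-edge after all others, instead of at its place, costs one sign for each
half-edge behind it; modulo two, their number is the sum of the total number and the position. -/
theorem cuts_halfList_insert (R : Fin p → List V) (s : Seg p) (hs : s.2 ≤ (R s.1).length) (v : V)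
    (φ : Conf p q V → M) :
    Conf.cuts (halfList (Function.update R s.1 ((R s.1).insertIdx s.2 v))) φ =
      (-1 : ℤ) ^ ((halfList R).length + pos (fun k => (R k).length) s) •
        Conf.cuts (halfList R) (Conf.cutAt s v φ) := by
  obtain ⟨A, B, h1, h2, h3, h4⟩ := halfList_insert R s hs v
  rw [h2, h1, ← h3, Conf.cuts_append, Conf.cuts_append, Conf.cuts_cons,
    Conf.cutAt_cuts_later s v B h4, map_zsmul]
  congr 1
  apply neg_one_pow_congr
  simp only [List.length_append, Nat.even_iff]
  omega

/-- Add a half-edge at the end of a circle. -/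
def snoc (R : Fin p → List V) (k : Fin p) (v : V) : Fin p → List V :=
  Function.update R k (R k ++ [v])

/-- As the circles after `k` are empty, the second part in `halfList_insert` is empty, and the new
half-edge is the last one overall. -/
theorem halfList_snoc (R : Fin p → List V) (k : Fin p) (v : V) (hk : ∀ i, k < i → R i = []) :
    halfList (snoc R k v) = halfList R ++ [((k, (R k).length), v)] := by
  obtain ⟨A, B, h1, h2, h3, h4⟩ := halfList_insert R (k, (R k).length) le_rfl v
  have hB : B = [] := by
    have h5 := length_halfList R
    rw [h1, List.length_append, h3, pos] at h5
    have h6 : ∑ i, (R i).length = ∑ i ∈ Finset.Iio k, (R i).length + (R k).length := by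
      rw [← Finset.sum_subset (Finset.subset_univ (Finset.Iic k))]
      · rw [← Finset.Iio_insert, Finset.sum_insert (by simp), add_comm]
      · intro i _ hi
        rw [hk i (by simpa using hi), List.length_nil]
    simp only [h6] at h5
    exact List.length_eq_zero_iff.1 (by omega)
  subst hB
  simp only [List.insertIdx_length_self] at h2
  rw [snoc, h2, h1]
  simp

/-- Every family of half-edges is obtained by adding successively last half-edges. -/
theorem snoc_induction {motive : (Fin p → List V) → Prop} (nil : motive fun _ => [])
    (snoc : ∀ R k v, (∀ i, k < i → R i = []) → motive R → motive (snoc R k v))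
    (R : Fin p → List V) : motive R := by
  generalize hn : ∑ i, (R i).length = n
  induction n generalizing R with
  | zero =>
    have : R = fun _ => [] := by
      funext i
      rw [Finset.sum_eq_zero_iff] at hn
      exact List.length_eq_zero_iff.1 (hn i (Finset.mem_univ i))
    rw [this]
    exact nil
  | succ n ih =>
    have hne : (Finset.univ.filter fun i => R i ≠ []).Nonempty := by
      by_contra h
      rw [Finset.not_nonempty_iff_eq_empty, Finset.filter_eq_empty_iff] at h
      have : ∑ i, (R i).length = 0 := Finset.sum_eq_zero fun i hi => by
        have := h hi
        push Not at this
        rw [this, List.length_nil]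
      omega
    -- The last circle that carries a half-edge; the last half-edge on it is split off.
    let k := (Finset.univ.filter fun i => R i ≠ []).max' hne
    have hk : R k ≠ [] := (Finset.mem_filter.1 (Finset.max'_mem _ hne)).2
    have hk2 : ∀ i, k < i → R i = [] := by
      intro i hi
      by_contra h
      exact absurd (Finset.le_max' _ i (by simp [h])) (not_le_of_gt hi)
    have e : R = LoopedDiagrams.snoc (Function.update R k (R k).dropLast) k
        ((R k).getLast hk) := by
      simp [LoopedDiagrams.snoc, List.dropLast_append_getLast]
    rw [e]
    refine snoc _ _ _ (fun i hi => ?_) (ih _ ?_)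
    · rw [Function.update_of_ne hi.ne', hk2 i hi]
    · have h1 : ∀ f : Fin p → List V, ∑ i, (f i).length =
          (f k).length + ∑ i ∈ Finset.univ.erase k, (f i).length := fun f =>
        (Finset.add_sum_erase _ _ (Finset.mem_univ k)).symm
      rw [h1] at hn ⊢
      rw [Finset.sum_congr rfl fun i hi => by
        rw [Function.update_of_ne (Finset.ne_of_mem_erase hi)]]
      have := List.length_pos_iff.2 hk
      simp only [Function.update_self, List.length_dropLast]
      omega

end

/-! ### Diagrams up to moves -/

section

variable {a b : ℕ × ℕ}

/-- The class of all diagrams, whether their loops are valid or not. -/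
def anyDiagram : DiagramClass := fun _ _ _ => True

/-- Linear combinations of diagrams up to moves and degenerate diagrams. -/
abbrev Quo (a b : ℕ × ℕ) : Type 1 := Chains a b ⧸ rels anyDiagram a b

/-- The class of a diagram up to moves and degenerate diagrams. -/
noncomputable def cls (D : Diagram a b) : Quo a b :=
  Submodule.Quotient.mk (Finsupp.single D 1)

theorem cls_move {D D' : Diagram a b} (h : D.Move D') : cls D = cls D' := by
  rw [cls, cls, Submodule.Quotient.eq]
  exact Submodule.subset_span (Or.inl ⟨D, D', trivial, trivial, h, rfl⟩)

theorem cls_degenerate {D : Diagram a b} (h : D.Degenerate) : cls D = 0 := by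
  rw [cls, Submodule.Quotient.mk_eq_zero]
  exact Submodule.subset_span (Or.inr ⟨D, trivial, h, rfl⟩)

/-- Two vertices are joined by a path of edges. -/
def Joined {V : Type} (E : Multiset (Sym2 V)) : V → V → Prop :=
  Relation.EqvGen fun u v => s(u, v) ∈ E

theorem Joined.refl {V : Type} {E : Multiset (Sym2 V)} (x : V) : Joined E x x :=
  Relation.EqvGen.refl x

theorem Joined.symm {V : Type} {E : Multiset (Sym2 V)} {x y : V} (h : Joined E x y) :
    Joined E y x := Relation.EqvGen.symm _ _ h

theorem Joined.trans {V : Type} {E : Multiset (Sym2 V)} {x y z : V} (h : Joined E x y)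
    (h' : Joined E y z) : Joined E x z := Relation.EqvGen.trans _ _ _ h h'

theorem Joined.of_mem {V : Type} {E : Multiset (Sym2 V)} {x y : V} (h : s(x, y) ∈ E) :
    Joined E x y := Relation.EqvGen.rel _ _ h

theorem Joined.map {V W : Type} {E : Multiset (Sym2 V)} {E' : Multiset (Sym2 W)} {f : V → W}
    (hf : ∀ x y, s(x, y) ∈ E → Joined E' (f x) (f y)) {x y : V} (h : Joined E x y) :
    Joined E' (f x) (f y) := by
  induction h with
  | rel x y h => exact hf x y h
  | refl x => exact .refl _
  | symm x y _ ih => exact ih.symm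
  | trans x y z _ _ ih ih' => exact ih.trans ih'

theorem Joined.mono {V : Type} {E E' : Multiset (Sym2 V)} (hE : E ≤ E') {x y : V}
    (h : Joined E x y) : Joined E' x y :=
  h.map (f := id) fun _ _ h => .of_mem (Multiset.mem_of_le hE h)

/-- Edges with joined ends. -/
def JoinedEdges {V : Type} (E : Multiset (Sym2 V)) (e e' : Sym2 V) : Prop :=
  ∃ x y x' y', e = s(x, y) ∧ e' = s(x', y') ∧ Joined E x x' ∧ Joined E y y'

/-- The ends of half-edges, edges and leaves can be moved along edges. -/
theorem cls_slide {V : Type} (hV : Finite V) (E X X' : Multiset (Sym2 V))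
    (start start' : Fin b.1 → V) (rest rest' : Fin b.1 → List V) (loopLeaf loopLeaf' : Fin a.1 → V)
    (inLeaf inLeaf' : Fin a.2 → V) (outLeaf outLeaf' : Fin b.2 → V)
    (loop : Fin a.1 → FreeGroup (Fin b.1 × ℕ))
    (hX : Multiset.Rel (JoinedEdges E) X X')
    (hstart : ∀ k, Joined E (start k) (start' k))
    (hrest : ∀ k, List.Forall₂ (Joined E) (rest k) (rest' k))
    (hloop : ∀ k, Joined E (loopLeaf k) (loopLeaf' k))
    (hin : ∀ k, Joined E (inLeaf k) (inLeaf' k))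
    (hout : ∀ k, Joined E (outLeaf k) (outLeaf' k)) :
    cls (⟨V, hV, X + E, start, rest, loopLeaf, inLeaf, outLeaf, loop⟩ : Diagram a b) =
      cls ⟨V, hV, X' + E, start', rest', loopLeaf', inLeaf', outLeaf', loop⟩ := by
  -- An edge of `E` between different vertices is contracted in both diagrams at once, which lowers
  -- the number of edges in `E`. When only self-loops are left in `E`, joined vertices are equal and
  -- the two diagrams coincide.
  generalize hn : Multiset.card E = n
  induction n generalizing V with
  | zero =>
    have h0 : ∀ x y, Joined E x y → x = y := by
      intro x y h
      rw [Multiset.card_eq_zero] at hn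
      subst hn
      induction h with
      | rel x y h => simp at h
      | refl x => rfl
      | symm x y _ ih => exact ih.symm
      | trans x y z _ _ ih ih' => exact ih.trans ih'
    have e1 : X = X' := by
      rw [← Multiset.rel_eq]
      refine hX.mono ?_
      rintro e _ e' _ ⟨x, y, x', y', rfl, rfl, h, h'⟩
      rw [h0 _ _ h, h0 _ _ h']
    have e2 : rest = rest' := by
      funext k
      rw [← List.forall₂_eq_eq_eq]
      exact (hrest k).imp fun x y h => h0 x y h
    obtain rfl : start = start' := funext fun k => h0 _ _ (hstart k)
    obtain rfl : loopLeaf = loopLeaf' := funext fun k => h0 _ _ (hloop k)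
    obtain rfl : inLeaf = inLeaf' := funext fun k => h0 _ _ (hin k)
    obtain rfl : outLeaf = outLeaf' := funext fun k => h0 _ _ (hout k)
    rw [e1, e2]
  | succ n ih =>
    by_cases hne : ∃ u v, u ≠ v ∧ s(u, v) ∈ E
    · obtain ⟨u, v, huv, huvE⟩ := hne
      obtain ⟨E', rfl⟩ := Multiset.exists_cons_of_mem huvE
      classical
      let f : V → {x // x ≠ v} := fun x => if h : x = v then ⟨u, huv⟩ else ⟨x, h⟩
      have fv : f v = ⟨u, huv⟩ := dif_pos rfl
      have fne : ∀ x (h : x ≠ v), f x = ⟨x, h⟩ := fun x h => dif_neg h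
      have hf : Function.Surjective f := fun x => ⟨x.1, fne _ x.2⟩
      have hfuv : ∀ x y, f x = f y ↔ x = y ∨ s(x, y) = s(u, v) := by
        intro x y
        by_cases hx : x = v <;> by_cases hy : y = v
        · simp [hx, hy]
        · subst hx
          rw [fv, fne y hy]
          simp only [Subtype.mk.injEq, Sym2.eq_iff]
          grind
        · subst hy
          rw [fv, fne x hx]
          simp only [Subtype.mk.injEq, Sym2.eq_iff]
          grind
        · rw [fne x hx, fne y hy]
          simp only [Subtype.mk.injEq, Sym2.eq_iff, hx, hy, and_false, false_and, or_false]
      have hJ : ∀ {x y}, Joined (s(u, v) ::ₘ E') x y →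
          Joined (E'.map (Sym2.map f)) (f x) (f y) := by
        intro x y h
        refine h.map fun x y h => ?_
        rcases Multiset.mem_cons.1 h with h | h
        · rw [(hfuv x y).2 (Or.inr h)]
          exact .refl _
        · exact .of_mem (Multiset.mem_map.2 ⟨_, h, rfl⟩)
      have hW : Finite {x // x ≠ v} := inferInstance
      rw [cls_move (Diagram.Move.contract _ u v huv (X + E') (by simp) _ hW f hf hfuv),
        cls_move (Diagram.Move.contract ⟨V, hV, X' + s(u, v) ::ₘ E', start', rest', loopLeaf',
          inLeaf', outLeaf', loop⟩ u v huv (X' + E') (by simp) _ hW f hf hfuv)]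
      simp only [Diagram.push, Multiset.map_add]
      refine ih hW _ _ _ _ _ _ _ _ _ _ _ _ _ ?_ (fun k => hJ (hstart k)) (fun k => ?_)
        (fun k => hJ (hloop k)) (fun k => hJ (hin k)) (fun k => hJ (hout k)) ?_
      · rw [Multiset.rel_map]
        refine hX.mono ?_
        rintro e _ e' _ ⟨x, y, x', y', rfl, rfl, h, h'⟩
        exact ⟨_, _, _, _, rfl, rfl, hJ h, hJ h'⟩
      · rw [List.forall₂_map_left_iff, List.forall₂_map_right_iff]
        exact (hrest k).imp fun x y h => hJ h
      · simpa using hn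
    · push Not at hne
      have h0 : ∀ x y, Joined E x y → x = y := by
        intro x y h
        induction h with
        | rel x y h => exact not_imp_comm.1 (hne x y) (by simpa using h)
        | refl x => rfl
        | symm x y _ ih => exact ih.symm
        | trans x y z _ _ ih ih' => exact ih.trans ih'
      have e1 : X = X' := by
        rw [← Multiset.rel_eq]
        refine hX.mono ?_
        rintro e _ e' _ ⟨x, y, x', y', rfl, rfl, h, h'⟩
        rw [h0 _ _ h, h0 _ _ h']
      have e2 : rest = rest' := by
        funext k
        rw [← List.forall₂_eq_eq_eq]
        exact (hrest k).imp fun x y h => h0 x y h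
      obtain rfl : start = start' := funext fun k => h0 _ _ (hstart k)
      obtain rfl : loopLeaf = loopLeaf' := funext fun k => h0 _ _ (hloop k)
      obtain rfl : inLeaf = inLeaf' := funext fun k => h0 _ _ (hin k)
      obtain rfl : outLeaf = outLeaf' := funext fun k => h0 _ _ (hout k)
      rw [e1, e2]

/-- A family of vertices, each attached to the rest of the diagram by one edge, can be removed
by contracting these edges. -/
theorem cls_pendant {A B : Type} [hA : Finite A] [Fintype B] (hAB : Finite (A ⊕ B))
    (E : Multiset (Sym2 A)) (g : B → A) (start : Fin b.1 → A ⊕ B) (rest : Fin b.1 → List (A ⊕ B))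
    (loopLeaf : Fin a.1 → A ⊕ B) (inLeaf : Fin a.2 → A ⊕ B) (outLeaf : Fin b.2 → A ⊕ B)
    (loop : Fin a.1 → FreeGroup (Fin b.1 × ℕ)) :
    cls (⟨A ⊕ B, hAB, E.map (Sym2.map Sum.inl) +
        (Finset.univ : Finset B).val.map (fun x => s(Sum.inl (g x), Sum.inr x)),
        start, rest, loopLeaf, inLeaf, outLeaf, loop⟩ : Diagram a b) =
      cls ⟨A, hA, E, fun k => Sum.elim id g (start k), fun k => (rest k).map (Sum.elim id g),
        fun k => Sum.elim id g (loopLeaf k), fun k => Sum.elim id g (inLeaf k),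
        fun k => Sum.elim id g (outLeaf k), loop⟩ := by
  -- Induction on `B`, where the edge at the vertex `none` is contracted. All ends are generalised,
  -- because the contraction moves those at `none` to `g none`.
  refine Fintype.induction_empty_option (P := fun B _ => ∀ (hAB : Finite (A ⊕ B)) (g : B → A)
      (start : Fin b.1 → A ⊕ B) (rest : Fin b.1 → List (A ⊕ B)) (loopLeaf : Fin a.1 → A ⊕ B)
      (inLeaf : Fin a.2 → A ⊕ B) (outLeaf : Fin b.2 → A ⊕ B),
      cls (⟨A ⊕ B, hAB, E.map (Sym2.map Sum.inl) +
        (Finset.univ : Finset B).val.map (fun x => s(Sum.inl (g x), Sum.inr x)),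
        start, rest, loopLeaf, inLeaf, outLeaf, loop⟩ : Diagram a b) =
      cls ⟨A, hA, E, fun k => Sum.elim id g (start k), fun k => (rest k).map (Sum.elim id g),
        fun k => Sum.elim id g (loopLeaf k), fun k => Sum.elim id g (inLeaf k),
        fun k => Sum.elim id g (outLeaf k), loop⟩) ?_ ?_ ?_ B hAB g start rest loopLeaf inLeaf
      outLeaf
  · intro B B' hB' e ih hAB g start rest loopLeaf inLeaf outLeaf
    have hAB2 : Finite (A ⊕ B) := Finite.of_equiv _ (Equiv.sumCongr (Equiv.refl A) e.symm)
    rw [cls_move (Diagram.Move.relabel _ _ hAB2 (Equiv.sumCongr (Equiv.refl A) e.symm))]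
    let _ := Fintype.ofEquiv B' e.symm
    have he : (Finset.univ : Finset B').val = (Finset.univ : Finset B).val.map e :=
      (Multiset.map_univ_val_equiv e).symm
    have hc : ∀ x, Sum.elim id (fun x => g (e x)) ((Equiv.sumCongr (Equiv.refl A) e.symm) x) =
        Sum.elim id g x := by
      rintro (x | x) <;> simp
    have := ih hAB2 (fun x => g (e x)) (fun k => Equiv.sumCongr (Equiv.refl A) e.symm (start k))
      (fun k => (rest k).map (Equiv.sumCongr (Equiv.refl A) e.symm))
      (fun k => Equiv.sumCongr (Equiv.refl A) e.symm (loopLeaf k))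
      (fun k => Equiv.sumCongr (Equiv.refl A) e.symm (inLeaf k))
      (fun k => Equiv.sumCongr (Equiv.refl A) e.symm (outLeaf k))
    simp only [hc, List.map_map, Function.comp_def] at this
    rw [← this]
    simp only [Diagram.push, Multiset.map_add, Multiset.map_map, he, Function.comp_def,
      Sym2.map_mk, Sym2.map_map]
    simp
  · intro hAB g start rest loopLeaf inLeaf outLeaf
    rw [cls_move (Diagram.Move.relabel _ _ hA (Equiv.sumEmpty A PEmpty))]
    have hc : (Equiv.sumEmpty A PEmpty : A ⊕ PEmpty → A) = Sum.elim id g := by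
      funext x
      rcases x with x | x
      · rfl
      · exact x.elim
    rw [hc]
    simp [Diagram.push, Multiset.map_map, Sym2.map_map, Function.comp_def]
  · intro B hB ih hAB g start rest loopLeaf inLeaf outLeaf
    let f : A ⊕ Option B → A ⊕ B := Sum.elim Sum.inl fun x => x.elim (Sum.inl (g none)) Sum.inr
    have hAB2 : Finite (A ⊕ B) := Finite.of_surjective f (by
      rintro (x | x)
      · exact ⟨Sum.inl x, rfl⟩
      · exact ⟨Sum.inr (some x), rfl⟩)
    rw [cls_move (Diagram.Move.contract _ (Sum.inl (g none)) (Sum.inr none) (by simp)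
      (E.map (Sym2.map Sum.inl) +
        (Finset.univ : Finset B).val.map (fun x => s(Sum.inl (g (some x)), Sum.inr (some x))))
      ?_ _ hAB2 f ?_ ?_)]
    · have hc : ∀ x, Sum.elim id (fun x => g (some x)) (f x) = Sum.elim id g x := by
        rintro (x | _ | x) <;> rfl
      have := ih hAB2 (fun x => g (some x)) (fun k => f (start k)) (fun k => (rest k).map f)
        (fun k => f (loopLeaf k)) (fun k => f (inLeaf k)) (fun k => f (outLeaf k))
      simp only [hc, List.map_map, Function.comp_def] at this
      rw [← this]
      simp only [Diagram.push, Multiset.map_add, Multiset.map_map, Function.comp_def,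
        Sym2.map_mk, Sym2.map_map]
      rfl
    · simp [univ_option, Finset.insertNone]
    · rintro (x | x)
      · exact ⟨Sum.inl x, rfl⟩
      · exact ⟨Sum.inr (some x), rfl⟩
    · rintro (x | _ | x) (y | _ | y) <;> simp [f, eq_comm]

end

/-! ### Paths -/

namespace Diagram

variable {a b a' b' : ℕ × ℕ}

theorem IsPath.congr_left {D : Diagram a b} {u u' : D.V} (h : D.SameArc u' u)
    {w : List (Letter b.1)} {v : D.V} (hw : D.IsPath u w v) : D.IsPath u' w v := by
  cases w with
  | nil => exact Joined.trans h hw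
  | cons l w => exact ⟨hw.1, Joined.trans h hw.2.1, hw.2.2⟩

theorem isPath_append {D : Diagram a b} {u v : D.V} {w w' : List (Letter b.1)} :
    D.IsPath u (w ++ w') v ↔ ∃ m, D.IsPath u w m ∧ D.IsPath m w' v := by
  induction w generalizing u with
  | nil =>
    exact ⟨fun h => ⟨u, .refl u, h⟩, fun ⟨m, h, h'⟩ => h'.congr_left h⟩
  | cons l w ih =>
    simp only [List.cons_append, IsPath, ih]
    constructor
    · rintro ⟨h1, h2, m, h3, h4⟩
      exact ⟨m, ⟨h1, h2, h3⟩, h4⟩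
    · rintro ⟨m, ⟨h1, h2, h3⟩, h4⟩
      exact ⟨h1, h2, m, h3, h4⟩

theorem IsPath.congr_right {D : Diagram a b} {u v v' : D.V} (h : D.SameArc v v')
    {w : List (Letter b.1)} (hw : D.IsPath u w v) : D.IsPath u w v' := by
  rw [← List.append_nil w, isPath_append]
  exact ⟨v, hw, h⟩

theorem source_not (D : Diagram a b) (s : Fin b.1 × ℕ) (o : Bool) :
    D.source (s, !o) = D.target (s, o) := by
  cases o <;> rfl

theorem target_not (D : Diagram a b) (s : Fin b.1 × ℕ) (o : Bool) :
    D.target (s, !o) = D.source (s, o) := by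
  cases o <;> rfl

/-- A cancelling pair leaves an arc component and comes back to it, so the remaining word still fits
together. -/
theorem IsPath.red {D : Diagram a b} {u v : D.V} {w w' : List (Letter b.1)}
    (h : FreeGroup.Red w w') (hw : D.IsPath u w v) : D.IsPath u w' v := by
  induction h with
  | refl => exact hw
  | tail _ h ih =>
    cases h with
    | @not L₁ L₂ x o =>
      rw [isPath_append] at ih ⊢
      obtain ⟨m, h1, h2⟩ := ih
      obtain ⟨_, h3, _, _, h4⟩ := h2
      rw [target_not] at h4
      exact ⟨m, h1, h4.congr_left h3⟩

/-- An element of the free group is a path between two black vertices. -/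
def PathTo (D : Diagram a b) (u : D.V) (x : Words b.1) (v : D.V) : Prop :=
  D.IsPath u x.toWord v

theorem pathTo_mk {D : Diagram a b} {u v : D.V} {w : List (Letter b.1)} (h : D.IsPath u w v) :
    D.PathTo u (FreeGroup.mk w) v := by
  rw [PathTo, FreeGroup.toWord_mk]
  exact h.red FreeGroup.reduce.red

theorem pathTo_one {D : Diagram a b} {u v : D.V} (h : D.SameArc u v) : D.PathTo u 1 v := by
  rw [PathTo, FreeGroup.toWord_one]
  exact h

theorem PathTo.mul {D : Diagram a b} {u v w : D.V} {x y : Words b.1} (h : D.PathTo u x v)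
    (h' : D.PathTo v y w) : D.PathTo u (x * y) w := by
  rw [← FreeGroup.mk_toWord (x := x), ← FreeGroup.mk_toWord (x := y), FreeGroup.mul_mk]
  exact pathTo_mk (isPath_append.2 ⟨v, h, h'⟩)

theorem IsPath.invRev {D : Diagram a b} {u v : D.V} {w : List (Letter b.1)}
    (h : D.IsPath u w v) : D.IsPath v (FreeGroup.invRev w) u := by
  induction w generalizing u with
  | nil => exact Joined.symm h
  | cons l w ih =>
    obtain ⟨h1, h2, h3⟩ := h
    have : FreeGroup.invRev (l :: w) = FreeGroup.invRev w ++ [(l.1, !l.2)] := by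
      simp [FreeGroup.invRev]
    rw [this, isPath_append]
    refine ⟨_, ih h3, h1, ?_, ?_⟩
    · rw [source_not]
      exact Joined.refl _
    · rw [target_not]
      exact Joined.symm h2

theorem PathTo.inv {D : Diagram a b} {u v : D.V} {x : Words b.1} (h : D.PathTo u x v) :
    D.PathTo v x⁻¹ u := by
  rw [PathTo, FreeGroup.toWord_inv]
  exact IsPath.invRev h

theorem PathTo.congr {D : Diagram a b} {u v u' v' : D.V} {x : Words b.1} (h : D.PathTo u x v)
    (hu : D.SameArc u' u) (hv : D.SameArc v v') : D.PathTo u' x v' :=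
  (IsPath.congr_left hu h).congr_right hv

theorem pathTo_of (D : Diagram a b) (s : Seg b.1) (h : s.2 ≤ (D.rest s.1).length) :
    D.PathTo (D.slot s.1 s.2) (FreeGroup.of s) (D.slot s.1 (s.2 + 1)) := by
  rw [PathTo, FreeGroup.toWord_of]
  exact ⟨h, Joined.refl _, Joined.refl _⟩

/-- A homomorphism that maps segments to paths maps paths to paths. -/
theorem PathTo.map {D : Diagram a b} {D' : Diagram a' b'} (f : D.V → D'.V)
    (h : Words b.1 →* Words b'.1) (hf : ∀ x y, D.SameArc x y → D'.SameArc (f x) (f y))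
    (hs : ∀ s : Seg b.1, s.2 ≤ (D.rest s.1).length →
      D'.PathTo (f (D.slot s.1 s.2)) (h (FreeGroup.of s)) (f (D.slot s.1 (s.2 + 1))))
    {u v : D.V} {x : Words b.1} (hx : D.PathTo u x v) : D'.PathTo (f u) (h x) (f v) := by
  rw [← FreeGroup.mk_toWord (x := x)]
  unfold PathTo at hx
  generalize x.toWord = w at hx
  induction w generalizing u with
  | nil => exact (map_one h).symm ▸ pathTo_one (hf _ _ hx)
  | cons l w ih =>
    obtain ⟨h1, h2, h3⟩ := hx
    rw [mk_cons, map_mul]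
    refine PathTo.mul ?_ (ih h3)
    rcases l with ⟨s, _ | _⟩
    · have e : FreeGroup.mk [(s, false)] = (FreeGroup.of s)⁻¹ := rfl
      rw [e, map_inv]
      exact (hs s h1).inv.congr (hf _ _ h2) (Joined.refl _)
    · exact (hs s h1).congr (hf _ _ h2) (Joined.refl _)

end Diagram

/-! ### Positive words -/

/-- Elements of the free group that are products of generators. -/
def PosWord {q : ℕ} (x : Words q) : Prop := x ∈ Submonoid.closure (Set.range FreeGroup.of)

section

variable {p q : ℕ}

theorem posWord_mk {w : List (Letter q)} (h : ∀ l ∈ w, l.2 = true) : PosWord (FreeGroup.mk w) := by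
  induction w with
  | nil => exact Submonoid.one_mem _
  | cons l w ih =>
    rw [mk_cons]
    refine Submonoid.mul_mem _ (Submonoid.subset_closure ⟨l.1, ?_⟩) (ih fun l hl => h l (by simp [hl]))
    rcases l with ⟨s, o⟩
    obtain rfl := h (s, o) (by simp)
    rfl

/-- Reduction only deletes letters, so any positive word representing `x` has a positive reduced
form. The description by a submonoid is the one that is stable under homomorphisms. -/
theorem posWord_iff {x : Words q} : PosWord x ↔ ∀ l ∈ x.toWord, l.2 = true := by
  constructor
  · intro h
    suffices h : ∃ w : List (Letter q), (∀ l ∈ w, l.2 = true) ∧ FreeGroup.mk w = x by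
      obtain ⟨w, hw, rfl⟩ := h
      intro l hl
      rw [FreeGroup.toWord_mk] at hl
      exact hw l (FreeGroup.Red.sublist FreeGroup.reduce.red |>.subset hl)
    induction h using Submonoid.closure_induction with
    | mem x h =>
      obtain ⟨s, rfl⟩ := h
      exact ⟨[(s, true)], by simp, rfl⟩
    | one => exact ⟨[], by simp, rfl⟩
    | mul x y _ _ hx hy =>
      obtain ⟨w, hw, rfl⟩ := hx
      obtain ⟨w', hw', rfl⟩ := hy
      refine ⟨w ++ w', fun l hl => ?_, FreeGroup.mul_mk.symm⟩
      rcases List.mem_append.1 hl with hl | hl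
      · exact hw l hl
      · exact hw' l hl
  · intro h
    rw [← FreeGroup.mk_toWord (x := x)]
    exact posWord_mk h

theorem PosWord.mul {x y : Words q} (hx : PosWord x) (hy : PosWord y) : PosWord (x * y) :=
  Submonoid.mul_mem _ hx hy

theorem posWord_of (s : Seg q) : PosWord (FreeGroup.of s) :=
  Submonoid.subset_closure ⟨s, rfl⟩

theorem PosWord.map {h : Words p →* Words q} (hs : ∀ s, PosWord (h (FreeGroup.of s)))
    {x : Words p} (hx : PosWord x) : PosWord (h x) := by
  induction hx using Submonoid.closure_induction with
  | mem x h =>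
    obtain ⟨s, rfl⟩ := h
    exact hs s
  | one => rw [map_one]; exact Submonoid.one_mem _
  | mul x y _ _ hx hy => rw [map_mul]; exact hx.mul hy

end

section

variable {p q r : ℕ} {V : Type} {M : Type*} [AddCommGroup M]

/-! ### Slots -/

/-- The vertex at which the `j`-th half-edge of the circle `k` ends, read cyclically. -/
def slotOf (start : Fin q → V) (rest : Fin q → List V) (s : Seg q) : V :=
  (start s.1 :: rest s.1).getD (s.2 % ((rest s.1).length + 1)) (start s.1)

theorem slotOf_zero (start : Fin q → V) (rest : Fin q → List V) (k : Fin q) :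
    slotOf start rest (k, 0) = start k := by simp [slotOf]

theorem slotOf_succ (start : Fin q → V) (rest : Fin q → List V) (k : Fin q) {j : ℕ}
    (h : j < (rest k).length) : slotOf start rest (k, j + 1) = (rest k)[j] := by
  simp [slotOf, Nat.mod_eq_of_lt (Nat.succ_lt_succ h), h]

theorem slotOf_end (start : Fin q → V) (rest : Fin q → List V) (k : Fin q) :
    slotOf start rest (k, (rest k).length + 1) = start k := by simp [slotOf]

theorem slotOf_congr {start : Fin q → V} {rest rest' : Fin q → List V} {s : Seg q}
    (h : rest s.1 = rest' s.1) : slotOf start rest s = slotOf start rest' s := by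
  simp [slotOf, h]

/-- Insertion of a half-edge in the segment `t`. -/
def insertRest (rest : Fin q → List V) (t : Seg q) (v : V) : Fin q → List V :=
  Function.update rest t.1 ((rest t.1).insertIdx t.2 v)

variable {start : Fin q → V} {rest : Fin q → List V} {t : Seg q}

theorem length_insertRest (ht : t.2 ≤ (rest t.1).length) (v : V) (k : Fin q) :
    (insertRest rest t v k).length = (rest k).length + if k = t.1 then 1 else 0 := by
  by_cases h : k = t.1
  · subst h
    simp [insertRest, List.length_insertIdx_of_le_length ht]
  · simp [insertRest, h]

theorem slotOf_insertRest_of_le (ht : t.2 ≤ (rest t.1).length) (v : V) {j : ℕ} (hj : j ≤ t.2) :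
    slotOf start (insertRest rest t v) (t.1, j) = slotOf start rest (t.1, j) := by
  rcases j with _ | j
  · rw [slotOf_zero, slotOf_zero]
  · have h1 : j < (insertRest rest t v t.1).length := by rw [length_insertRest ht]; simp; omega
    rw [slotOf_succ _ _ _ h1, slotOf_succ _ _ _ (by omega)]
    simp only [insertRest, Function.update_self]
    rw [List.getElem_insertIdx_of_lt (by omega)]

theorem slotOf_insertRest_up (ht : t.2 ≤ (rest t.1).length) (v : V) :
    slotOf start (insertRest rest t v) (up t) = v := by
  have h1 : t.2 < (insertRest rest t v t.1).length := by rw [length_insertRest ht]; simp; omega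
  rw [up, slotOf_succ _ _ _ h1]
  simp [insertRest]

theorem slotOf_insertRest_of_lt (ht : t.2 ≤ (rest t.1).length) (v : V) {j : ℕ} (hj : t.2 < j)
    (hj' : j ≤ (rest t.1).length + 1) :
    slotOf start (insertRest rest t v) (t.1, j + 1) = slotOf start rest (t.1, j) := by
  obtain ⟨j, rfl⟩ : ∃ i, j = i + 1 := ⟨j - 1, by omega⟩
  have hl : (insertRest rest t v t.1).length = (rest t.1).length + 1 := by
    rw [length_insertRest ht]; simp
  rcases Nat.lt_or_ge j (rest t.1).length with h | h
  · rw [slotOf_succ _ _ _ (by omega), slotOf_succ _ _ _ h]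
    simp only [insertRest, Function.update_self]
    rw [List.getElem_insertIdx_of_gt (by omega)]
    simp
  · obtain rfl : j = (rest t.1).length := by omega
    rw [slotOf_end]
    have := slotOf_end start (insertRest rest t v) t.1
    rwa [hl] at this

/-- Only the segment that receives the new point changes its ends; all others are merely renamed. -/
theorem slotOf_insertRest_shift (ht : t.2 ≤ (rest t.1).length) (v : V) {f : Seg q}
    (hf : f.2 ≤ (rest f.1).length) (hft : f ≠ t) :
    slotOf start (insertRest rest t v) (shift t f) = slotOf start rest f ∧
      slotOf start (insertRest rest t v) (up (shift t f)) = slotOf start rest (up f) := by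
  rcases t with ⟨k, i⟩; rcases f with ⟨k', j⟩
  by_cases h : k = k'
  · subst h
    rcases lt_trichotomy j i with h | h | h
    · have e : shift (k, i) (k, j) = (k, j) := by grind [shift]
      rw [e]
      exact ⟨slotOf_insertRest_of_le ht v h.le, slotOf_insertRest_of_le (t := (k, i)) ht v h⟩
    · exact absurd (by rw [h]) hft
    · have e : shift (k, i) (k, j) = (k, j + 1) := by grind [shift, up]
      rw [e]
      exact ⟨slotOf_insertRest_of_lt (t := (k, i)) ht v h (by simp at hf ⊢; omega),
        slotOf_insertRest_of_lt (t := (k, i)) ht v (Nat.lt_succ_of_lt h) (by simp at hf ⊢; omega)⟩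
  · have e : shift (k, i) (k', j) = (k', j) := by grind [shift, up]
    rw [e]
    exact ⟨slotOf_congr (by simp [insertRest, Ne.symm h]),
      slotOf_congr (by simp [insertRest, up, Ne.symm h])⟩

/-- The half-edges after the half-edges at the ends of the segment `s` have been joined. -/
def faceRest (rest : Fin q → List V) (s : Seg q) : Fin q → List V :=
  Function.update rest s.1
    (if s.2 < (rest s.1).length then (rest s.1).eraseIdx s.2 else (rest s.1).dropLast)

/-- The last segment of a circle ends at the start half-edge, which has to survive, so there the
half-edge at its beginning is removed. The minimum covers this case together with the others. -/
theorem faceRest_eq_eraseIdx (rest : Fin q → List V) (s : Seg q) :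
    faceRest rest s = Function.update rest s.1
      ((rest s.1).eraseIdx (min s.2 ((rest s.1).length - 1))) := by
  unfold faceRest
  congr 1
  split_ifs with h
  · rw [min_eq_left (by omega)]
  · rw [min_eq_right (by omega)]
    rcases Nat.eq_zero_or_pos (rest s.1).length with h0 | h0
    · rw [List.length_eq_zero_iff.1 h0]; rfl
    · rw [List.eraseIdx_eq_dropLast (by omega)]

/-- A face at a segment other than `t` commutes with an insertion in `t`; each operation renames the
segment used by the other. -/
theorem faceRest_insertRest_shift (ht : t.2 ≤ (rest t.1).length) (v : V) {f : Seg q}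
    (hf : f.2 ≤ (rest f.1).length) (hft : f ≠ t) :
    faceRest (insertRest rest t v) (shift t f) = insertRest (faceRest rest f) (old f t) v := by
  rcases t with ⟨k, i⟩; rcases f with ⟨k', j⟩
  by_cases h : k = k'
  · subst h
    simp only [faceRest_eq_eraseIdx]
    have hl := length_insertRest ht v k
    simp only [if_true] at hl ht hf
    have h1 : (shift (k, i) (k, j)).1 = k ∧ (old (k, j) (k, i)).1 = k := by grind [shift, old, up]
    rw [h1.1]
    unfold insertRest at hl ⊢
    rw [h1.2]
    simp only [Function.update_self, Function.update_idem] at hl ⊢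
    rw [hl]
    congr 1
    rcases lt_trichotomy j i with h | h | h
    · have e : (shift (k, i) (k, j)).2 = j ∧ (old (k, j) (k, i)).2 = i - 1 := by
        grind [shift, old, up]
      rw [e.1, e.2, min_eq_left (by omega), min_eq_left (by omega),
        List.insertIdx_eraseIdx_of_ge (by omega) (by omega), Nat.sub_add_cancel (by omega)]
    · exact absurd (by rw [h]) hft
    · have e : (shift (k, i) (k, j)).2 = j + 1 ∧ (old (k, j) (k, i)).2 = i := by
        grind [shift, old, up]
      rw [e.1, e.2, List.insertIdx_eraseIdx_of_le (by omega) (by omega)]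
      congr 1
      omega
  · have e : shift (k, i) (k', j) = (k', j) ∧ old (k', j) (k, i) = (k, i) := by
      grind [shift, up, old]
    rw [e.1, e.2]
    simp only [faceRest_eq_eraseIdx, insertRest, Function.update_of_ne h,
      Function.update_of_ne (Ne.symm h)]
    rw [Function.update_comm h]

theorem faceRest_insertRest_self (ht : t.2 ≤ (rest t.1).length) (v : V) :
    faceRest (insertRest rest t v) t = rest := by
  have hl := length_insertRest ht v t.1
  simp only [if_true] at hl
  rw [faceRest, if_pos (by omega)]
  simp [insertRest, List.eraseIdx_insertIdx_self]

/-- The half-edge at the end of the segment `t` replaced. -/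
theorem faceRest_insertRest_up (ht : t.2 ≤ (rest t.1).length) (v : V) :
    faceRest (insertRest rest t v) (up t) = Function.update rest t.1 ((rest t.1).set t.2 v) := by
  have hl := length_insertRest ht v t.1
  simp only [if_true] at hl
  rw [faceRest_eq_eraseIdx]
  simp only [up, hl]
  simp only [insertRest, Function.update_self, Function.update_idem]
  congr 1
  rw [insertIdx_eq_take_append v ht]
  rcases Nat.lt_or_ge t.2 (rest t.1).length with h | h
  · rw [min_eq_left (by omega), List.eraseIdx_append_of_length_le (by simp)]
    simp only [List.length_take, min_eq_left ht]
    rw [show t.2 + 1 - t.2 = 1 by omega, List.eraseIdx_cons_succ, List.drop_eq_getElem_cons h,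
      List.eraseIdx_cons_zero, List.set_eq_take_append_cons_drop, if_pos h]
  · obtain e : t.2 = (rest t.1).length := by omega
    rw [min_eq_right (by omega), List.set_eq_of_length_le h, e]
    simp [List.eraseIdx_append_of_length_le]

/-! ### The differential of configurations -/

namespace Conf

/-- The diagram underlying a configuration. -/
def diag (c : Conf p q V) [hV : Finite V] (start : Fin q → V) : Diagram (0, 0) (q, 0) where
  V := V
  finite := hV
  edges := c.edges
  start := start
  rest := c.rest
  loopLeaf := Fin.elim0
  inLeaf := Fin.elim0
  outLeaf := Fin.elim0
  loop := Fin.elim0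

/-- The configuration with the half-edges at the ends of the segment `s` joined. -/
def face (start : Fin q → V) (s : Seg q) (c : Conf p q V) : Conf p q V where
  edges := s(slotOf start c.rest s, slotOf start c.rest (up s)) ::ₘ c.edges
  len := Function.update c.len s.1 (c.len s.1 - 1)
  rest := faceRest c.rest s
  track u := coll s (c.track u)

/-- The signed sum over all joinings of adjacent half-edges. -/
def dOp (start : Fin q → V) (φ : Conf p q V → M) (c : Conf p q V) : M :=
  ∑ k, if c.rest k = [] then 0 else ∑ j ∈ Finset.range ((c.rest k).length + 1),
    (-1 : ℤ) ^ (1 + pos (fun k => (c.rest k).length) (k, j)) • φ (c.face start (k, j))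

theorem insert_rest (c : Conf p q V) (s : Seg p) (t : Seg q) (v : V) (a b : Words q) :
    (c.insert s t v a b).rest = insertRest c.rest t v := rfl

/-- The faces that do not touch the new half-edge correspond to the faces taken before it is
attached. These are the terms that cancel in the commutator with the differential. -/
theorem face_insert_shift {start : Fin q → V} {c : Conf p q V} {t f : Seg q}
    (hlen : c.len = fun k => (c.rest k).length) (ht : t.2 ≤ (c.rest t.1).length)
    (hf : f.2 ≤ (c.rest f.1).length) (hft : f ≠ t) (s : Seg p) (v : V) (a b : Words q) :
    (c.insert s t v a b).face start (shift t f) =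
      (c.face start f).insert s (old f t) v (coll (shift t f) a) (coll (shift t f) b) := by
  have h1 := slotOf_insertRest_shift (start := start) ht v hf hft
  ext1
  · simp only [face, insert_rest, h1]
    rfl
  · have h2 : (shift t f).1 = f.1 ∧ (old f t).1 = t.1 := by
      rcases f with ⟨k, j⟩; rcases t with ⟨k', j'⟩; grind [old, shift, up]
    simp only [face, insert, h2]
    by_cases h : f.1 = t.1
    -- Two different segments on one circle require a half-edge other than the start, so the
    -- subtraction in `face` is not truncated.
    · have : c.len f.1 ≠ 0 := by
        rw [hlen]
        simp only
        rcases f with ⟨k, j⟩; rcases t with ⟨k', j'⟩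
        simp only at h
        subst h
        intro h0
        simp only [h0, Nat.le_zero] at ht hf
        exact hft (by rw [ht, hf])
      rw [h] at this
      rw [h]
      simp only [Function.update_self, Function.update_idem]
      congr 1
      omega
    · rw [Function.update_of_ne h, Function.update_of_ne (Ne.symm h), Function.update_comm h]
  · exact faceRest_insertRest_shift ht v hf hft
  · funext u
    simp only [face, insert, insTrack]
    split_ifs
    · rfl
    · rfl
    · exact coll_shift_split hft.symm _

/-- The configuration with a new edge and with the word of the segment `s` cut in two. -/
def cutTrack (c : Conf p q V) (s : Seg p) (e : Sym2 V) (A B : Words q) : Conf p q V :=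
  { c with
    edges := e ::ₘ c.edges
    track := fun u => if u = s then A else if u = up s then B else c.track (old s u) }

/-- Joining the new half-edge to the preceding one removes the new half-edge from the circle and
leaves an edge from `v` to the predecessor. The circles return to their former state, and only the
word of `s` stays cut. -/
theorem face_insert_self {start : Fin q → V} {c : Conf p q V} {t : Seg q}
    (ht : t.2 ≤ (c.rest t.1).length) (s : Seg p) (v : V) (a b : Words q) :
    (c.insert s t v a b).face start t =
      c.cutTrack s s(v, slotOf start c.rest t) (coll t a) (coll t b) := by
  ext1
  · simp only [face, insert_rest, cutTrack, slotOf_insertRest_up ht]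
    rw [Sym2.eq_swap, show t = (t.1, t.2) from rfl, slotOf_insertRest_of_le ht v le_rfl]
    rfl
  · simp [face, insert, cutTrack]
  · exact faceRest_insertRest_self ht v
  · funext u
    simp only [face, insert, insTrack, cutTrack]
    split_ifs
    · rfl
    · rfl
    · exact coll_split _ _

/-- Functions of configurations that do not change when ends are moved along edges. -/
def SlideInv (φ : Conf p q V → M) : Prop :=
  ∀ (E X X' : Multiset (Sym2 V)) (len : Fin q → ℕ) (rest rest' : Fin q → List V)
    (track : Seg p → Words q), Multiset.Rel (JoinedEdges E) X X' →
    (∀ k, List.Forall₂ (Joined E) (rest k) (rest' k)) →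
    φ ⟨X + E, len, rest, track⟩ = φ ⟨X' + E, len, rest', track⟩

/-- Joining the new half-edge to the following one may leave an end at `v` in place of the old end.
The two vertices are joined by the new edge, so `φ` does not see the difference. -/
theorem face_insert_up {φ : Conf p q V → M} (hφ : SlideInv φ) {start : Fin q → V}
    {c : Conf p q V} {t : Seg q} (ht : t.2 ≤ (c.rest t.1).length) (s : Seg p) (v : V)
    (a b : Words q) :
    φ ((c.insert s t v a b).face start (up t)) =
      φ (c.cutTrack s s(v, slotOf start c.rest (up t)) (coll (up t) a) (coll (up t) b)) := by
  have e1 : (c.insert s t v a b).face start (up t) =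
      { c.cutTrack s s(v, slotOf start c.rest (up t)) (coll (up t) a) (coll (up t) b) with
        rest := Function.update c.rest t.1 ((c.rest t.1).set t.2 v) } := by
    ext1
    · simp only [face, insert_rest, cutTrack, slotOf_insertRest_up ht]
      have := slotOf_insertRest_of_lt (start := start) ht v (Nat.lt_succ_self t.2) (by simpa using ht)
      rw [show up (up t) = (t.1, t.2 + 1 + 1) from rfl]
      simp only [Nat.succ_eq_add_one] at this
      rw [this]
      rfl
    · simp [face, insert, cutTrack, up]
    · exact faceRest_insertRest_up ht v
    · funext u
      simp only [face, insert, insTrack, cutTrack]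
      split_ifs
      · rfl
      · rfl
      · exact coll_up_split _ _
  rw [e1]
  have := hφ (s(v, slotOf start c.rest (up t)) ::ₘ c.edges) 0 0 c.len
    (Function.update c.rest t.1 ((c.rest t.1).set t.2 v)) c.rest
    (c.cutTrack s s(v, slotOf start c.rest (up t)) (coll (up t) a) (coll (up t) b)).track
    Multiset.Rel.zero (fun k => ?_)
  · simp only [zero_add] at this
    exact this
  · by_cases hk : k = t.1
    · subst hk
      rw [Function.update_self, List.forall₂_iff_get]
      refine ⟨by simp, fun i h1 h2 => ?_⟩
      simp only [List.get_eq_getElem, List.getElem_set]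
      split_ifs with hi
      · subst hi
        refine .of_mem (Multiset.mem_cons.2 (Or.inl ?_))
        rw [show up t = (t.1, t.2 + 1) from rfl, slotOf_succ start c.rest t.1 h2]
      · exact .refl _
    · rw [Function.update_of_ne hk]
      exact List.forall₂_same.2 fun x _ => .refl x

/-- The segments after an insertion in `t` are the two halves of `t` and the shifted copies of the
other segments. -/
theorem sum_range_insert (F : ℕ → M) {n t : ℕ} (ht : t ≤ n) :
    ∑ i ∈ Finset.range (n + 2), F i = F t + F (t + 1) +
      ∑ j ∈ Finset.range (n + 1), if t = j then 0 else F (if t < j then j + 1 else j) := by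
  obtain ⟨m, rfl⟩ := Nat.exists_eq_add_of_le ht
  rw [add_assoc t m 2, add_assoc t m 1, Finset.sum_range_add F t (m + 2),
    Finset.sum_range_add _ t (m + 1), Finset.sum_range_succ' _ (m + 1),
    Finset.sum_range_succ' _ m, Finset.sum_range_succ' _ m]
  have h1 : ∑ j ∈ Finset.range t, (if t = j then 0 else F (if t < j then j + 1 else j)) =
      ∑ j ∈ Finset.range t, F j := by
    refine Finset.sum_congr rfl fun j hj => ?_
    rw [Finset.mem_range] at hj
    rw [if_neg (by omega), if_neg (by omega)]
  have h2 : ∑ j ∈ Finset.range m, (if t = t + (j + 1) then 0 else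
      F (if t < t + (j + 1) then t + (j + 1) + 1 else t + (j + 1))) =
      ∑ j ∈ Finset.range m, F (t + (j + 1 + 1)) := by
    refine Finset.sum_congr rfl fun j hj => ?_
    rw [if_neg (by omega), if_pos (by omega)]
    rfl
  rw [h1, h2]
  simp only [add_zero, if_true, zero_add]
  abel

theorem pos_pred {len : Fin q → ℕ} {k : Fin q} (hk : len k ≠ 0) (s : Seg q) :
    pos len s = pos (Function.update len k (len k - 1)) s + if k < s.1 then 1 else 0 := by
  have := pos_update (Function.update len k (len k - 1)) k s
  rw [Function.update_self, Function.update_idem, Nat.sub_add_cancel (by omega),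
    Function.update_eq_self] at this
  exact this

/-- A mixed form of `pos_swap`: an insertion to the left raises the position of the face by one, and
a face to the left lowers the position of the insertion by one. Exactly one of the two happens. -/
theorem pos_shift_old {len : Fin q → ℕ} {f t : Seg q} (hf : len f.1 ≠ 0) (hft : f ≠ t) :
    (-1 : ℤ) ^ pos len t * (-1) ^ (1 + pos (Function.update len t.1 (len t.1 + 1)) (shift t f)) =
      -((-1) ^ (1 + pos len f) *
        (-1) ^ pos (Function.update len f.1 (len f.1 - 1)) (old f t)) := by
  have h1 := pos_pred hf (old f t)
  rw [pos_update, ← pow_add, ← pow_add,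
    show ∀ n : ℕ, -(-1 : ℤ) ^ n = (-1) ^ (n + 1) from fun n => by rw [pow_succ]; ring]
  apply neg_one_pow_congr
  rcases f with ⟨k, j⟩; rcases t with ⟨k', j'⟩
  rcases lt_trichotomy k k' with h | h | h
  · simp only [old, shift, h.ne, h.ne', false_and, if_false, h, if_true, not_lt_of_gt h] at h1 ⊢
    simp only [Nat.even_iff]; omega
  · subst h
    have hj : j ≠ j' := fun h => hft (by rw [h])
    by_cases h2 : j < j'
    · simp only [pos, old, shift, h2, true_and, if_true, not_lt_of_gt h2, if_false, lt_irrefl] at h1 ⊢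
      simp only [Nat.even_iff]; omega
    · have h3 : j' < j := by omega
      simp only [pos, old, shift, h2, h3, true_and, if_true, if_false, lt_irrefl, up] at h1 ⊢
      simp only [Nat.even_iff]; omega
  · simp only [old, shift, h.ne, h.ne', false_and, if_false, h, if_true, not_lt_of_gt h] at h1 ⊢
    simp only [Nat.even_iff]; omega

/-- The faces of a configuration with a new half-edge that are adjacent to this half-edge
are the only ones that do not cancel. -/
theorem dOp_insert_add {φ : Conf p q V → M} (hφ : SlideInv φ) {start : Fin q → V}
    {c : Conf p q V} (hlen : c.len = fun k => (c.rest k).length) {t : Seg q}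
    (ht : t.2 ≤ (c.rest t.1).length) (s : Seg p) (v : V) (a b : Words q) :
    (-1 : ℤ) ^ pos c.len t • dOp start φ (c.insert s t v a b) +
      (∑ k, if c.rest k = [] then 0 else ∑ j ∈ Finset.range ((c.rest k).length + 1),
        (-1 : ℤ) ^ (1 + pos (fun k => (c.rest k).length) (k, j)) • if t = (k, j) then 0 else
          (-1 : ℤ) ^ pos (c.face start (k, j)).len (old (k, j) t) •
            φ ((c.face start (k, j)).insert s (old (k, j) t) v (coll (shift t (k, j)) a)
              (coll (shift t (k, j)) b))) =
      φ (c.cutTrack s s(v, slotOf start c.rest (up t)) (coll (up t) a) (coll (up t) b)) -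
        φ (c.cutTrack s s(v, slotOf start c.rest t) (coll t a) (coll t b)) := by
  have hl' : (fun k => ((c.insert s t v a b).rest k).length) =
      Function.update c.len t.1 (c.len t.1 + 1) := by
    funext k
    rw [insert_rest, length_insertRest ht, hlen]
    by_cases hk : k = t.1
    · subst hk; simp
    · simp [hk]
  -- A face away from the new half-edge occurs in both sums, with opposite signs.
  have hcancel : ∀ f : Seg q, f.2 ≤ (c.rest f.1).length → c.rest f.1 ≠ [] → f ≠ t →
      (-1 : ℤ) ^ pos c.len t • ((-1 : ℤ) ^ (1 + pos
        (Function.update c.len t.1 (c.len t.1 + 1)) (shift t f)) •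
          φ ((c.insert s t v a b).face start (shift t f))) =
      -((-1 : ℤ) ^ (1 + pos (fun k => (c.rest k).length) f) •
        (-1 : ℤ) ^ pos (c.face start f).len (old f t) •
            φ ((c.face start f).insert s (old f t) v (coll (shift t f) a)
              (coll (shift t f) b))) := by
    intro f hf hne hft
    have h0 : c.len f.1 ≠ 0 := by
      rw [hlen]
      exact fun h => hne (List.length_eq_zero_iff.1 h)
    rw [face_insert_shift hlen ht hf hft, smul_smul, smul_smul, pos_shift_old h0 hft, neg_smul,
      ← hlen]
    rfl
  -- On the circles other than `t.1` everything cancels, so only the circle of the new half-edge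
  -- remains.
  rw [dOp, hl', Finset.smul_sum, ← Finset.sum_add_distrib, Finset.sum_eq_single t.1]
  · have hne : (c.insert s t v a b).rest t.1 ≠ [] := by
      intro h
      have := congrFun hl' t.1
      simp [h] at this
    have hlt : ((c.insert s t v a b).rest t.1).length = (c.rest t.1).length + 1 := by
      have := congrFun hl' t.1
      simpa [hlen] using this
    rw [if_neg hne, hlt, sum_range_insert _ ht]
    have e1 : (-1 : ℤ) ^ pos c.len t • (-1 : ℤ) ^ (1 + pos
        (Function.update c.len t.1 (c.len t.1 + 1)) (t.1, t.2)) •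
          φ ((c.insert s t v a b).face start (t.1, t.2)) =
        -φ (c.cutTrack s s(v, slotOf start c.rest t) (coll t a) (coll t b)) := by
      have := face_insert_self (start := start) ht s v a b
      rw [show (t.1, t.2) = t from rfl, this, pos_update, if_neg (lt_irrefl _), smul_smul,
        ← pow_add, Odd.neg_one_pow ⟨pos c.len t, by ring⟩, neg_one_smul]
    have e2 : (-1 : ℤ) ^ pos c.len t • (-1 : ℤ) ^ (1 + pos
        (Function.update c.len t.1 (c.len t.1 + 1)) (t.1, t.2 + 1)) •
          φ ((c.insert s t v a b).face start (t.1, t.2 + 1)) =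
        φ (c.cutTrack s s(v, slotOf start c.rest (up t)) (coll (up t) a) (coll (up t) b)) := by
      rw [show (t.1, t.2 + 1) = up t from rfl, face_insert_up hφ ht, pos_update,
        if_neg (show ¬ t.1 < (up t).1 from lt_irrefl _), smul_smul, ← pow_add, show pos c.len (up t) = pos c.len t + 1 from rfl,
        Even.neg_one_pow ⟨pos c.len t + 1, by ring⟩, one_smul]
    rw [smul_add, smul_add, e1, e2]
    have e3 : (if c.rest t.1 = [] then 0 else ∑ j ∈ Finset.range ((c.rest t.1).length + 1),
        (-1 : ℤ) ^ (1 + pos (fun k => (c.rest k).length) (t.1, j)) • if t = (t.1, j) then 0 else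
          (-1 : ℤ) ^ pos (c.face start (t.1, j)).len (old (t.1, j) t) •
            φ ((c.face start (t.1, j)).insert s (old (t.1, j) t) v (coll (shift t (t.1, j)) a)
              (coll (shift t (t.1, j)) b))) =
        -((-1 : ℤ) ^ pos c.len t • ∑ j ∈ Finset.range ((c.rest t.1).length + 1),
          if t.2 = j then 0 else (fun i => (-1 : ℤ) ^ (1 + pos
        (Function.update c.len t.1 (c.len t.1 + 1)) (t.1, i)) •
          φ ((c.insert s t v a b).face start (t.1, i))) (if t.2 < j then j + 1 else j)) := by
      by_cases hn : c.rest t.1 = []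
      -- The circle carried only its start half-edge. Then `t.2 = 0` is the only index, and it is
      -- excluded from the sum.
      · rw [if_pos hn, hn]
        have : t.2 = 0 := by simpa [hn] using ht
        simp [this]
      · rw [if_neg hn, Finset.smul_sum, ← Finset.sum_neg_distrib]
        refine Finset.sum_congr rfl fun j hj => ?_
        by_cases hj2 : t.2 = j
        · rw [if_pos hj2, if_pos (by rw [← hj2])]; simp
        · have h3 : (t.1, j) ≠ t := fun h => hj2 (by rw [← h])
          rw [if_neg hj2, if_neg h3.symm]
          have e4 : (t.1, if t.2 < j then j + 1 else j) = shift t (t.1, j) := by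
            simp only [shift, true_and, up]
            split_ifs <;> rfl
          beta_reduce
          rw [e4, hcancel (t.1, j) (by simpa [Nat.lt_succ_iff] using hj) hn h3, neg_neg]
    rw [e3]
    abel
  · intro k _ hk
    have hrk : (c.insert s t v a b).rest k = c.rest k := by
      simp [insert, hk]
    rw [hrk]
    split_ifs with hn
    · simp
    · rw [Finset.smul_sum, ← Finset.sum_add_distrib]
      refine Finset.sum_eq_zero fun j hj => ?_
      have h3 : (k, j) ≠ t := fun h => hk (by rw [← h])
      have h4 := hcancel (k, j) (by simpa [Nat.lt_succ_iff] using hj) hn h3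
      have h5 : shift t (k, j) = (k, j) := by simp [shift, Ne.symm hk]
      rw [if_neg h3.symm]
      rw [h5] at h4 ⊢
      rw [h4, neg_add_cancel]
  · simp

/-- The terms of the commutator of the differential with the attachment of a half-edge telescope
along a path. -/
theorem cutList_telescope [Finite V] {start : Fin q → V} {c : Conf p q V}
    (H : V → Words q → Words q → M)
    (hH : ∀ u u' A B, Joined c.edges u u' → H u A B = H u' A B)
    (pre : Words q) (x y : V) (w : List (Letter q)) (hw : (c.diag start).IsPath x w y) :
    cutList w (fun t a b => H (slotOf start c.rest (up t)) (pre * coll (up t) a) (coll (up t) b) -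
        H (slotOf start c.rest t) (pre * coll t a) (coll t b)) =
      H y (pre * FreeGroup.mk w) 1 - H x pre (FreeGroup.mk w) := by
  induction w generalizing pre x with
  | nil =>
    have : FreeGroup.mk ([] : List (Letter q)) = 1 := rfl
    rw [this, cutList, mul_one, hH x y pre 1 hw, sub_self]
  | cons l w ih =>
    obtain ⟨h1, h2, h3⟩ := hw
    rw [cutList]
    simp only [map_mul, coll_split, coll_up_split, ← mul_assoc]
    rw [ih (pre * FreeGroup.mk [l]) _ h3, hH x _ pre _ h2, mk_cons l w]
    -- For a letter traversed backwards, its sign compensates for the exchange of its two ends.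
    rcases l with ⟨t, _ | _⟩
    · have e : FreeGroup.mk [(t, false)] = (FreeGroup.of t)⁻¹ := rfl
      simp only [letterSign, leftPart, rightPart, e]
      simp only [Bool.false_eq_true, if_false, map_inv, coll_self, coll_ne (up_ne t),
        coll_ne (ne_up t), old_up, old_up_self, neg_smul, one_smul, inv_one, mul_one, one_mul]
      change -(H (slotOf start c.rest (up t)) _ _ - H (slotOf start c.rest t) _ _) +
        (_ - H (slotOf start c.rest t) _ _) = _ - H (slotOf start c.rest (up t)) _ _
      simp only [mul_assoc]
      abel
    · have e : FreeGroup.mk [(t, true)] = FreeGroup.of t := rfl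
      simp only [letterSign, leftPart, rightPart, e, if_true, coll_self, coll_ne (up_ne t),
        coll_ne (ne_up t), old_up, old_up_self, one_smul, mul_one, one_mul]
      change (H (slotOf start c.rest (up t)) _ _ - H (slotOf start c.rest t) _ _) +
        (_ - H (slotOf start c.rest (up t)) _ _) = _ - H (slotOf start c.rest t) _ _
      simp only [mul_assoc]
      abel

/-- Attaching a half-edge along a path is a chain homotopy between attaching it at the start and
at the end of the path. -/
theorem cutAt_dOp_add [Finite V] {φ : Conf p q V → M} (hφ : SlideInv φ) {start : Fin q → V}
    {c : Conf p q V} (hlen : c.len = fun k => (c.rest k).length) (s : Seg p) (v x y : V)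
    (hpath : (c.diag start).PathTo x (c.track s) y) :
    cutAt s v (dOp start φ) c + dOp start (cutAt s v φ) c =
      φ (c.cutTrack s s(v, y) (c.track s) 1) - φ (c.cutTrack s s(v, x) 1 (c.track s)) := by
  -- The attachments after a face are rewritten, by `cut_coll`, as cuts of the word before the
  -- collapse. Both sums then run over the same cuts.
  have h1 : dOp start (cutAt s v φ) c = cut (c.track s) fun t a b =>
      ∑ k, if c.rest k = [] then 0 else ∑ j ∈ Finset.range ((c.rest k).length + 1),
        (-1 : ℤ) ^ (1 + pos (fun k => (c.rest k).length) (k, j)) • if t = (k, j) then 0 else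
          (-1 : ℤ) ^ pos (c.face start (k, j)).len (old (k, j) t) •
            φ ((c.face start (k, j)).insert s (old (k, j) t) v (coll (shift t (k, j)) a)
              (coll (shift t (k, j)) b)) := by
    rw [cut_sum, dOp]
    refine Finset.sum_congr rfl fun k _ => ?_
    split_ifs with hn
    · rw [cut_zero]
    · rw [cut_sum]
      refine Finset.sum_congr rfl fun j _ => ?_
      rw [cut_zsmul]
      exact congrArg _ (cut_coll (k, j) (c.track s) fun t a b =>
        (-1 : ℤ) ^ pos (c.face start (k, j)).len t • φ ((c.face start (k, j)).insert s t v a b))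
  rw [h1, cutAt, ← cut_add]
  have h2 := cutList_telescope (c := c) (start := start)
    (fun u A B => φ (c.cutTrack s s(v, u) A B)) (fun u u' A B h => ?_) 1 x y _ hpath
  · rw [FreeGroup.mk_toWord, one_mul, ← cut_mk, FreeGroup.mk_toWord] at h2
    rw [← h2]
    -- The letters of the reduced word are segments of the diagram, because this word is a path;
    -- `dOp_insert_add` needs this bound.
    refine cut_congr_toWord fun w₁ l w₂ e => ?_
    unfold Diagram.PathTo at hpath
    rw [e] at hpath
    obtain ⟨m, _, hl, _⟩ := (Diagram.isPath_append (D := c.diag start)).1 hpath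
    simp only [one_mul]
    exact dOp_insert_add hφ hlen hl s v _ _
  · have := hφ c.edges {s(v, u)} {s(v, u')} c.len c.rest c.rest
      (c.cutTrack s s(v, u) A B).track ?_ fun k => List.forall₂_same.2 fun x _ => .refl x
    · exact this
    · rw [← Multiset.cons_zero, ← Multiset.cons_zero, Multiset.rel_cons_left]
      exact ⟨_, 0, ⟨v, u, v, u', rfl, rfl, .refl v, h⟩, Multiset.Rel.zero, rfl⟩

end Conf

end

section

variable {p q r : ℕ} {V : Type} {M : Type*} [AddCommGroup M]

/-! ### Invariants of the gluing process -/

/-- The data that do not change while half-edges are glued along words. -/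
structure GlueFrame (p q : ℕ) (V : Type) where
  edges : Multiset (Sym2 V)
  start : Fin q → V
  /-- the half-edges that are present at the beginning -/
  rest : Fin q → List V
  /-- the start half-edges of the circles whose half-edges are glued -/
  base : Fin p → V
  /-- whether the words are positive -/
  positive : Prop

/-- A configuration obtained by gluing the half-edges `R`. -/
structure Conf.Good [Finite V] (F : GlueFrame p q V) (R : Fin p → List V) (c : Conf p q V) :
    Prop where
  edges_eq : c.edges = F.edges
  len_eq : c.len = fun k => (c.rest k).length
  subset : ∀ k, F.rest k ⊆ c.rest k
  total : ∑ k, (c.rest k : Multiset V) = ∑ k, (F.rest k : Multiset V) + ∑ i, (R i : Multiset V)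
  path : ∀ s : Seg p, s.2 ≤ (R s.1).length →
    (c.diag F.start).PathTo (slotOf (V := V) F.base R s) (c.track s)
      (slotOf (V := V) F.base R (up s))
  pos : F.positive → ∀ s : Seg p, s.2 ≤ (R s.1).length → PosWord (c.track s)

theorem sum_insertRest (R : Fin p → List V) (t : Seg p) (ht : t.2 ≤ (R t.1).length) (v : V) :
    ∑ i, (insertRest R t v i : Multiset V) = v ::ₘ ∑ i, (R i : Multiset V) := by
  rw [← Finset.add_sum_erase _ _ (Finset.mem_univ t.1),
    ← Finset.add_sum_erase _ (fun i => (R i : Multiset V)) (Finset.mem_univ t.1),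
    Finset.sum_congr rfl fun i hi => by
      rw [insertRest, Function.update_of_ne (Finset.ne_of_mem_erase hi)]]
  rw [← Multiset.cons_add]
  congr 1
  rw [insertRest, Function.update_self]
  exact Multiset.coe_eq_coe.2 (List.perm_insertIdx v _ ht)

/-- Apart from the two halves of `s`, every segment after the insertion comes from a unique old one.
-/
theorem exists_shift_of_insertRest {R : Fin p → List V} {s u : Seg p} {v : V}
    (hs : s.2 ≤ (R s.1).length) (hu : u.2 ≤ (insertRest R s v u.1).length) (h1 : u ≠ s)
    (h2 : u ≠ up s) :
    old s u ≠ s ∧ (old s u).2 ≤ (R (old s u).1).length ∧ shift s (old s u) = u := by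
  rw [length_insertRest hs] at hu
  rcases s with ⟨k, j⟩; rcases u with ⟨k', j'⟩
  grind [old, shift, up]

/-- The invariants survive each attachment. `path` makes the next attachment meaningful and the new
loops valid, `pos` serves the positive classes, `subset` connectivity, and `total` both the degree
and degeneracy. -/
theorem Conf.Good.insert [Finite V] {F : GlueFrame p q V} {R : Fin p → List V} {c : Conf p q V}
    (hc : c.Good F R) {s : Seg p} (hs : s.2 ≤ (R s.1).length) (v : V) {w₁ w₂ : List (Letter q)}
    {l : Letter q} (hw : (c.track s).toWord = w₁ ++ l :: w₂) :
    l.1.2 ≤ (c.rest l.1.1).length ∧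
    (c.insert s l.1 v (split l.1 (FreeGroup.mk w₁) * leftPart l)
      (rightPart l * split l.1 (FreeGroup.mk w₂))).Good F (insertRest R s v) := by
  have hp : (c.diag F.start).IsPath (slotOf F.base R s) (c.track s).toWord
    (slotOf F.base R (up s)) := hc.path s hs
  rw [hw] at hp
  obtain ⟨m, hw1, hl, hm, hw2⟩ := (Diagram.isPath_append (D := c.diag F.start)).1 hp
  have hl' : l.1.2 ≤ (c.rest l.1.1).length := hl
  refine ⟨hl, ?_⟩
  set a := split l.1 (FreeGroup.mk w₁) * leftPart l
  set b := rightPart l * split l.1 (FreeGroup.mk w₂)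
  set c' := c.insert s l.1 v a b
  have hup : slotOf F.start c'.rest (up l.1) = v := slotOf_insertRest_up hl' v
  have hself : slotOf F.start c'.rest l.1 = slotOf F.start c.rest l.1 :=
    slotOf_insertRest_of_le hl' v le_rfl
  have hupup : slotOf F.start c'.rest (up (up l.1)) = slotOf F.start c.rest (up l.1) :=
    slotOf_insertRest_of_lt hl' v (Nat.lt_succ_self _) (Nat.succ_le_succ hl')
  have hlen : (c'.rest l.1.1).length = (c.rest l.1.1).length + 1 := by
    have := length_insertRest hl' v l.1.1
    rwa [if_pos rfl] at this
  have hof : ∀ u : Seg q, u.2 ≤ (c'.rest u.1).length →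
      (c'.diag F.start).PathTo (slotOf (V := V) F.start c'.rest u) (FreeGroup.of u)
        (slotOf (V := V) F.start c'.rest (up u)) := fun u hu => Diagram.pathTo_of (c'.diag F.start) u hu
  have hof1 := hof l.1 (by omega)
  have hof2 := hof (up l.1) (by simp only [up, hlen]; omega)
  rw [hup, hself] at hof1
  rw [hup, hupup] at hof2
  -- An old path remains a path with the same ends: the subdivided segment is replaced by its two
  -- halves, which meet at `v`.
  have hsplit : ∀ {x : Words q} {u u' : V}, (c.diag F.start).PathTo u x u' →
      (c'.diag F.start).PathTo u (split l.1 x) u' := by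
    intro x u u' hx
    refine Diagram.PathTo.map (D := c.diag F.start) (D' := c'.diag F.start) id (split l.1)
      (fun _ _ h => h) (fun u hu => ?_) hx
    by_cases hul : u = l.1
    · rw [hul, split_of_self]
      exact hof1.mul hof2
    · rw [split_of_ne hul]
      have h3 := slotOf_insertRest_shift (start := F.start) hl' v hu hul
      have h4 := hof (shift l.1 u) ?_
      · rw [show slotOf F.start c'.rest (shift l.1 u) = _ from h3.1,
          show slotOf F.start c'.rest (up (shift l.1 u)) = _ from h3.2] at h4
        exact h4
      · change _ ≤ (insertRest c.rest l.1 v _).length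
        rw [length_insertRest hl']
        have hu' : u.2 ≤ (c.rest u.1).length := hu
        simp only [shift, up]
        split_ifs <;> grind
  have hleft : (c'.diag F.start).PathTo ((c.diag F.start).source l) (leftPart l) v := by
    rcases l with ⟨t, _ | _⟩
    · exact hof2.inv
    · exact hof1
  have hright : (c'.diag F.start).PathTo v (rightPart l) ((c.diag F.start).target l) := by
    rcases l with ⟨t, _ | _⟩
    · exact hof1.inv
    · exact hof2
  refine ⟨hc.edges_eq, ?_, fun k => ?_, ?_, fun u hu => ?_, fun hpos u hu => ?_⟩
  · funext k
    have := length_insertRest hl' v k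
    rw [show c'.rest = insertRest c.rest l.1 v from rfl, this]
    simp only [c', Conf.insert, hc.len_eq]
    by_cases hk : k = l.1.1
    · subst hk; simp
    · simp [hk]
  · intro x hx
    by_cases hk : k = l.1.1
    · subst hk
      simp only [c', Conf.insert, Function.update_self]
      rw [List.mem_insertIdx hl']
      exact Or.inr (hc.subset _ hx)
    · simp only [c', Conf.insert, Function.update_of_ne hk]
      exact hc.subset _ hx
  · rw [show c'.rest = insertRest c.rest l.1 v from rfl, sum_insertRest _ _ hl',
      sum_insertRest _ _ hs, hc.total, Multiset.add_cons]
  · by_cases h1 : u = s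
    · rw [h1, show s = (s.1, s.2) from rfl, slotOf_insertRest_of_le hs v le_rfl,
        show up (s.1, s.2) = up s from rfl, slotOf_insertRest_up hs]
      have : c'.track s = a := insTrack_self ..
      rw [this]
      exact (hsplit (Diagram.pathTo_mk hw1)).mul (hleft.congr hm (Joined.refl _))
    · by_cases h2 : u = up s
      · rw [h2, slotOf_insertRest_up hs, show up (up s) = (s.1, s.2 + 1 + 1) from rfl,
          slotOf_insertRest_of_lt hs v (Nat.lt_succ_self _) (by simpa using hs)]
        have : c'.track (up s) = b := insTrack_up ..
        rw [this]
        exact hright.mul (hsplit (Diagram.pathTo_mk hw2))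
      · obtain ⟨h3, h4, h5⟩ := exists_shift_of_insertRest hs hu h1 h2
        have h6 := slotOf_insertRest_shift (start := F.base) hs v h4 h3
        have : c'.track u = split l.1 (c.track (old s u)) := by
          simp [c', Conf.insert, insTrack, h1, h2]
        rw [h5] at h6
        rw [this, h6.1, h6.2]
        exact hsplit (hc.path _ h4)
  · have hposs := posWord_iff.1 (hc.pos hpos s hs)
    rw [hw] at hposs
    have hsp : ∀ {x : Words q}, PosWord x → PosWord (split l.1 x) := PosWord.map fun u => by
      by_cases hul : u = l.1
      · rw [hul, split_of_self]
        exact (posWord_of _).mul (posWord_of _)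
      · rw [split_of_ne hul]
        exact posWord_of _
    have hl2 : l.2 = true := hposs l (by simp)
    by_cases h1 : u = s
    · have : c'.track u = a := h1 ▸ insTrack_self ..
      rw [this]
      refine (hsp (posWord_mk fun l hl => hposs l (by simp [hl]))).mul ?_
      rw [leftPart, if_pos hl2]
      exact posWord_of _
    · by_cases h2 : u = up s
      · have : c'.track u = b := h2 ▸ insTrack_up ..
        rw [this]
        refine PosWord.mul ?_ (hsp (posWord_mk fun l hl => hposs l (by simp [hl])))
        rw [rightPart, if_pos hl2]
        exact posWord_of _
      · obtain ⟨h3, h4, h5⟩ := exists_shift_of_insertRest hs hu h1 h2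
        have : c'.track u = split l.1 (c.track (old s u)) := by
          simp [c', Conf.insert, insTrack, h1, h2]
        rw [this]
        exact hsp (hc.pos hpos _ h4)

theorem length_halfList_eq_pos {R : Fin p → List V} {k : Fin p} (hk : ∀ i, k < i → R i = []) :
    (halfList R).length = pos (fun i => (R i).length) (k, (R k).length) := by
  rw [length_halfList, pos, ← Finset.sum_subset (Finset.subset_univ (Finset.Iic k))]
  · rw [← Finset.Iio_insert, Finset.sum_insert (by simp), add_comm]
  · intro i _ hi
    rw [hk i (by simpa using hi), List.length_nil]

theorem snoc_eq_insertRest (R : Fin p → List V) (k : Fin p) (v : V) :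
    snoc R k v = insertRest R (k, (R k).length) v := by
  simp [snoc, insertRest]

namespace Conf

theorem cuts_snoc {R : Fin p → List V} {k : Fin p} (hk : ∀ i, k < i → R i = []) (v : V)
    (φ : Conf p q V → M) :
    cuts (halfList (snoc R k v)) φ = cuts (halfList R) (cutAt (k, (R k).length) v φ) := by
  rw [halfList_snoc R k v hk, cuts_append, cuts_cons, cuts_nil]

theorem cutAt_congr_good [Finite V] {F : GlueFrame p q V} {R : Fin p → List V} {s : Seg p}
    (hs : s.2 ≤ (R s.1).length) {v : V} {φ φ' : Conf p q V → M}
    (h : ∀ c, c.Good F (insertRest R s v) → φ c = φ' c) {c : Conf p q V} (hc : c.Good F R) :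
    cutAt s v φ c = cutAt s v φ' c :=
  cut_congr_toWord fun _ _ _ e => by rw [h _ (hc.insert hs v e).2]

/-- Only good configurations arise from gluing, so the values of a function on all others are
immaterial. -/
theorem cuts_congr_good [Finite V] {F : GlueFrame p q V} {R : Fin p → List V}
    {φ φ' : Conf p q V → M} (h : ∀ c, c.Good F R → φ c = φ' c) {c : Conf p q V}
    (hc : c.Good F fun _ => []) : cuts (halfList R) φ c = cuts (halfList R) φ' c := by
  induction R using snoc_induction generalizing φ φ' with
  | nil =>
    have e : halfList (fun _ : Fin p => ([] : List V)) = [] := by simp [halfList]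
    rw [e, cuts_nil, cuts_nil]
    exact h c hc
  | snoc R k v hk ih =>
    rw [cuts_snoc hk, cuts_snoc hk]
    refine ih fun c hc => cutAt_congr_good (s := (k, (R k).length)) le_rfl (fun c hc => h c ?_) hc
    rwa [snoc_eq_insertRest]

theorem map_cutList {N : Type*} [AddCommGroup N] (f : M →+ N) (w : List (Letter q))
    (g : Seg q → Words q → Words q → M) :
    f (cutList w g) = cutList w fun s a b => f (g s a b) := by
  induction w generalizing g with
  | nil => simp [cutList]
  | cons l w ih => simp [cutList, ih]

theorem map_cuts {N : Type*} [AddCommGroup N] (f : M →+ N) (L : List (Seg p × V))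
    (φ : Conf p q V → M) (c : Conf p q V) : f (cuts L φ c) = cuts L (fun c => f (φ c)) c := by
  induction L generalizing c with
  | nil => rfl
  | cons e L ih =>
    rw [cuts_cons, cuts_cons, cutAt, cutAt, ← FreeGroup.mk_toWord (x := c.track e.1), cut_mk,
      cut_mk, map_cutList]
    congr 1
    funext t a b
    rw [map_zsmul, ih]

/-- Gluing commutes with additive maps; in the quotient by `N` the function may be replaced by zero.
-/
theorem cuts_mem_good [Finite V] {F : GlueFrame p q V} {R : Fin p → List V}
    {φ : Conf p q V → M} (N : AddSubgroup M) (h : ∀ c, c.Good F R → φ c ∈ N) {c : Conf p q V}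
    (hc : c.Good F fun _ => []) : cuts (halfList R) φ c ∈ N := by
  rw [← QuotientAddGroup.eq_zero_iff]
  change QuotientAddGroup.mk' N _ = 0
  rw [map_cuts, cuts_congr_good (φ' := 0) (fun c hc => ?_) hc, map_zero]
  · rfl
  · exact (QuotientAddGroup.eq_zero_iff _).2 (h c hc)

/-! ### The differential of a gluing -/

/-- The function of configurations that corresponds to a face of the source. -/
def faceFun (base : Fin p → V) (R : Fin p → List V) (f : Seg p) (φ : Conf p q V → M)
    (c : Conf p q V) : M :=
  φ { c with
    edges := s(slotOf base R f, slotOf base R (up f)) ::ₘ c.edges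
    track := fun u => FreeGroup.lift c.track (coll f (FreeGroup.of u)) }

/-- Attaching uses the words, the lengths and the indices, but not the vertices at which the other
half-edges end. -/
theorem SlideInv.cutAt {φ : Conf p q V → M} (hφ : SlideInv φ) (s : Seg p) (v : V) :
    SlideInv (cutAt s v φ) := by
  intro E X X' len rest rest' track hX hrest
  refine congrArg (cut (track s)) (funext fun t => funext fun a => funext fun b => ?_)
  refine congrArg _ (hφ E X X' _ _ _ _ hX fun k => ?_)
  change List.Forall₂ _ (insertRest rest t v k) (insertRest rest' t v k)
  by_cases hk : k = t.1
  · subst hk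
    simp only [insertRest, Function.update_self]
    have h := hrest t.1
    generalize rest t.1 = l at h
    generalize rest' t.1 = l' at h
    generalize t.2 = j
    induction h generalizing j with
    | nil => cases j with
      | zero => exact List.Forall₂.cons (.refl v) .nil
      | succ j => exact .nil
    | @cons x y l l' hxy h ih => cases j with
      | zero => exact List.Forall₂.cons (.refl v) (.cons hxy h)
      | succ j => exact List.Forall₂.cons hxy (ih j)
  · simp only [insertRest, Function.update_of_ne hk]
    exact hrest k

/-- A face of the source in front of the last half-edge commutes with attaching it. The word of `s`
is not affected by the collapse of `f`, and `s` is only renamed to `old f s`. -/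
theorem faceFun_cutAt (base : Fin p → V) (R R' : Fin p → List V) {s f : Seg p}
    (hsf : f ≠ s) (hf : f.1 = s.1 → f.2 < s.2) (v : V) (φ : Conf p q V → M)
    (h1 : slotOf base R f = slotOf base R' f)
    (h2 : slotOf base R (up f) = slotOf base R' (up f)) :
    faceFun base R f (cutAt s v φ) = cutAt (old f s) v (faceFun base R' f φ) := by
  funext c
  have e1 : FreeGroup.lift c.track (coll f (FreeGroup.of s)) = c.track (old f s) := by
    rw [coll_ne hsf.symm, FreeGroup.lift_apply_of]
  simp only [faceFun, cutAt, e1]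
  refine congrArg (cut _) (funext fun t => funext fun a => funext fun b => congrArg _ ?_)
  rw [← h1, ← h2]
  refine congrArg φ (Conf.ext rfl rfl rfl (funext fun u => ?_))
  simp only [insert, insTrack]
  have key : f ≠ up s ∧ (u = f ∨ u = s ∨ u = up s ∧ old f u = up (old f s) ∨
      u ≠ s ∧ u ≠ up s ∧ old f u ≠ old f s ∧ old f u ≠ up (old f s) ∧ old s u ≠ f ∧
        old f (old s u) = old (old f s) (old f u)) ∧ old s f = f := by
    rcases s with ⟨k, j⟩; rcases f with ⟨k', j'⟩; rcases u with ⟨k'', j''⟩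
    simp only at hf
    grind (splits := 40) [old, up]
  obtain ⟨k1, h | h | ⟨h, h'⟩ | ⟨h1, h2, h3, h4, h5, h6⟩, k2⟩ := key
  · subst h
    simp [hsf, k1, k2, coll_self]
  · subst h
    simp [coll_ne hsf.symm, insTrack_self]
  · subst h
    simp only [coll_ne k1.symm, h', FreeGroup.lift_apply_of, insTrack_up, if_neg (up_ne s),
      if_true]
  · by_cases hu : u = f
    · subst hu
      simp [hsf, k1, k2, coll_self]
    · simp [coll_ne hu, h1, h2, insTrack, h3, h4, coll_ne h5, h6]

/-- The end term of the homotopy formula is the face of the source at the segment behind the new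
half-edge; `faceFun_insertRest_self` identifies the term at the start of the path with the face in
front of it. -/
theorem faceFun_insertRest_up (base : Fin p → V) {R : Fin p → List V} {s : Seg p}
    (hs : s.2 ≤ (R s.1).length) (v : V) (φ : Conf p q V → M) (c : Conf p q V) :
    faceFun base (insertRest R s v) (up s) φ c =
      φ (c.cutTrack s s(v, slotOf base R (up s)) (c.track s) 1) := by
  have h3 : slotOf base (insertRest R s v) (up (up s)) = slotOf base R (up s) :=
    slotOf_insertRest_of_lt hs v (Nat.lt_succ_self _) (Nat.succ_le_succ hs)
  refine congrArg φ (Conf.ext ?_ rfl rfl (funext fun u => ?_))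
  · simp only [cutTrack]
    rw [slotOf_insertRest_up hs, h3]
  · simp only [cutTrack]
    by_cases h1 : u = up s
    · simp [h1, up_ne, coll_self]
    · by_cases h2 : u = s
      · simp [h2, coll_ne (ne_up s), old_up_self]
      · have : old (up s) u = old s u := by
          rcases s with ⟨k, j⟩; rcases u with ⟨k', j'⟩
          clear h3
          grind [old, up]
        simp [h1, h2, coll_ne h1, this]

theorem faceFun_insertRest_self (base : Fin p → V) {R : Fin p → List V} {s : Seg p}
    (hs : s.2 ≤ (R s.1).length) (v : V) (φ : Conf p q V → M) (c : Conf p q V) :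
    faceFun base (insertRest R s v) s φ c =
      φ (c.cutTrack s s(v, slotOf base R s) 1 (c.track s)) := by
  have h3 : slotOf base (insertRest R s v) s = slotOf base R s :=
    slotOf_insertRest_of_le hs v le_rfl
  refine congrArg φ (Conf.ext ?_ rfl rfl (funext fun u => ?_))
  · simp only [cutTrack]
    rw [slotOf_insertRest_up hs, h3, Sym2.eq_swap]
  · simp only [cutTrack]
    by_cases h2 : u = s
    · simp [h2, coll_self]
    · by_cases h1 : u = up s
      · simp [h1, up_ne, coll_ne (up_ne s), old_up]
      · simp [h1, h2, coll_ne h2]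

/-- The chain map property for configurations, by induction on the half-edges of the source. The
homotopy formula moves the differential past the last half-edge at the cost of a sign and of the two
faces of the source next to it; the remaining faces of the source come from the induction
hypothesis. -/
theorem cuts_dOp [Finite V] (F : GlueFrame p q V) (R : Fin p → List V) {φ : Conf p q V → M}
    (hφ : SlideInv φ) {c : Conf p q V} (hc : c.Good F fun _ => []) :
    cuts (halfList R) (dOp F.start φ) c =
      (-1 : ℤ) ^ (halfList R).length • dOp F.start (cuts (halfList R) φ) c +
      ∑ k, if R k = [] then 0 else ∑ j ∈ Finset.range ((R k).length + 1),
        (-1 : ℤ) ^ ((halfList R).length + pos (fun k => (R k).length) (k, j)) •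
          cuts (halfList (faceRest R (k, j))) (faceFun F.base R (k, j) φ) c := by
  induction R using snoc_induction generalizing φ with
  | nil =>
    have e : halfList (fun _ : Fin p => ([] : List V)) = [] := by simp [halfList]
    simp [e, cuts_nil]
  | snoc R k v hk ih =>
    set s : Seg p := (k, (R k).length) with hs
    set n := (halfList R).length with hn
    have hns : pos (fun i => (R i).length) s = n := (length_halfList_eq_pos hk).symm
    have hlen' : (halfList (snoc R k v)).length = n + 1 := by
      rw [halfList_snoc R k v hk]; simp [hn]
    have hR' : snoc R k v = insertRest R s v := snoc_eq_insertRest R k v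
    have hsv : s.2 ≤ (R s.1).length := le_rfl
    have hlk : (snoc R k v k).length = (R k).length + 1 := by simp [snoc]
    have hposn : ∀ f : Seg p, f.1 ≤ k →
        pos (fun i => (snoc R k v i).length) f = pos (fun i => (R i).length) f := by
      intro f hf
      unfold pos
      congr 1
      refine Finset.sum_congr rfl fun i hi => ?_
      have : i ≠ k := ((Finset.mem_Iio.1 hi).trans_le hf).ne
      simp [snoc, this]
    rw [cuts_snoc hk, cuts_congr_good (φ' := -dOp F.start (cutAt s v φ) +
      (faceFun F.base (snoc R k v) (up s) φ - faceFun F.base (snoc R k v) s φ)) ?_ hc]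
    · rw [map_add, map_sub, map_neg]
      simp only [Pi.add_apply, Pi.sub_apply, Pi.neg_apply]
      rw [ih (hφ.cutAt s v), hlen', ← cuts_snoc hk]
      -- The faces of the enlarged family are the faces of `R` with the last half-edge attached
      -- afterwards, with reversed sign, and the two faces that involve this half-edge.
      have hmain : ∀ i, (if snoc R k v i = [] then 0 else
          ∑ j ∈ Finset.range ((snoc R k v i).length + 1),
            (-1 : ℤ) ^ (n + 1 + pos (fun k_1 => (snoc R k v k_1).length) (i, j)) •
              cuts (halfList (faceRest (snoc R k v) (i, j)))
                (faceFun F.base (snoc R k v) (i, j) φ) c) =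
          -(if R i = [] then 0 else ∑ j ∈ Finset.range ((R i).length + 1),
            (-1 : ℤ) ^ (n + pos (fun k => (R k).length) (i, j)) •
              cuts (halfList (faceRest R (i, j))) (faceFun F.base R (i, j) (cutAt s v φ)) c) +
          if i = k then
            cuts (halfList R) (faceFun F.base (snoc R k v) (up s) φ) c -
              cuts (halfList R) (faceFun F.base (snoc R k v) s φ) c else 0 := by
        intro i
        have hface : ∀ f : Seg p, f.2 ≤ (R f.1).length → f.1 ≤ k → R f.1 ≠ [] → f ≠ s →
            (-1 : ℤ) ^ (n + 1 + pos (fun k_1 => (snoc R k v k_1).length) f) •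
              cuts (halfList (faceRest (snoc R k v) f))
                (faceFun F.base (snoc R k v) f φ) c =
            -((-1 : ℤ) ^ (n + pos (fun k => (R k).length) f) •
              cuts (halfList (faceRest R f)) (faceFun F.base R f (cutAt s v φ)) c) := by
          intro f hf hfk hne hfs
          have hfl : f.1 = s.1 → f.2 < s.2 := by
            intro h
            refine lt_of_le_of_ne ?_ fun h' => hfs (Prod.ext h h')
            rw [show s.2 = (R s.1).length from rfl, ← h]
            exact hf
          have h1 : shift s f = f := by
            rw [shift, if_neg]
            rintro ⟨h, h'⟩
            have := hfl h.symm
            omega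
          have h2 := faceRest_insertRest_shift hsv v hf hfs
          have h3 := slotOf_insertRest_shift (start := F.base) hsv v hf hfs
          rw [h1, ← hR'] at h2 h3
          have h4 : (old f s).1 = k ∧ (old f s).2 = (faceRest R f k).length := by
            rw [faceRest_eq_eraseIdx]
            by_cases hkf : f.1 = k
            · have := hfl hkf
              rw [← hkf, Function.update_self, List.length_eraseIdx]
              have : (R f.1).length ≠ 0 := fun h => hne (List.length_eq_zero_iff.1 h)
              have hmin : min f.2 ((R f.1).length - 1) < (R f.1).length := by omega
              rw [if_pos hmin]
              simp only [old, hs]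
              rw [if_pos ⟨hkf, hfl hkf⟩, hkf]
              simp
            · rw [Function.update_of_ne (Ne.symm hkf)]
              simp only [old, hs, hkf, false_and, if_false, true_and]
          have h5 : insertRest (faceRest R f) (old f s) v = snoc (faceRest R f) k v := by
            rw [snoc_eq_insertRest, ← h4.2, ← h4.1]
          have h6 : ∀ i, k < i → faceRest R f i = [] := by
            intro i hi
            rw [faceRest, Function.update_of_ne (hfk.trans_lt hi).ne', hk i hi]
          rw [hposn f hfk, h2, h5, cuts_snoc h6, faceFun_cutAt F.base R (snoc R k v) hfs hfl v φ
            h3.1.symm h3.2.symm, show (k, (faceRest R f k).length) = old f s by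
              rw [← h4.2, ← h4.1], ← neg_smul]
          congr 1
          rw [pow_add, pow_add, pow_succ]
          ring
        rcases lt_trichotomy i k with hik | hik | hik
        · have e1 : snoc R k v i = R i := by simp [snoc, hik.ne]
          rw [e1, if_neg hik.ne, add_zero]
          split_ifs with hne
          · simp
          · rw [← Finset.sum_neg_distrib]
            refine Finset.sum_congr rfl fun j hj => ?_
            exact hface (i, j) (by simpa [Nat.lt_succ_iff] using hj) hik.le hne
              fun h => hik.ne (congrArg Prod.fst h)
        · subst hik
          have hne' : snoc R i v i ≠ [] := by simp [snoc]
          have e1 : faceRest (snoc R i v) s = R := by rw [hR', faceRest_insertRest_self hsv]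
          have e2 : faceRest (snoc R i v) (up s) = R := by
            rw [hR', faceRest_insertRest_up hsv]
            simp [hs, List.set_eq_of_length_le]
          rw [if_neg hne', if_pos rfl, hlk, Finset.sum_range_succ, Finset.sum_range_succ,
            show (i, (R i).length + 1) = up s from rfl, ← hs, e1, e2, hposn s le_rfl,
            hposn (up s) le_rfl, show pos (fun i => (R i).length) (up s) = n + 1 by
              rw [← hns]; rfl, hns, Even.neg_one_pow ⟨n + 1, rfl⟩,
            Odd.neg_one_pow (n := n + 1 + n) ⟨n, by ring⟩, one_smul, neg_one_smul]
          have e3 : ∑ j ∈ Finset.range (R i).length,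
              (-1 : ℤ) ^ (n + 1 + pos (fun k_1 => (snoc R i v k_1).length) (i, j)) •
                cuts (halfList (faceRest (snoc R i v) (i, j)))
                  (faceFun F.base (snoc R i v) (i, j) φ) c =
              -(if R i = [] then 0 else ∑ j ∈ Finset.range ((R i).length + 1),
            (-1 : ℤ) ^ (n + pos (fun k => (R k).length) (i, j)) •
              cuts (halfList (faceRest R (i, j))) (faceFun F.base R (i, j) (cutAt s v φ)) c) := by
            split_ifs with hne
            · simp [hne]
            -- The induction hypothesis contains one face too many, the one at `s` itself. It makes
            -- the word of `s` trivial, so nothing can be attached there afterwards.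
            · have e4 : faceFun F.base R (i, (R i).length) (cutAt s v φ) = 0 := by
                funext c
                simp [faceFun, cutAt, ← hs, coll_self, cut_one]
              rw [Finset.sum_range_succ, e4, map_zero, Pi.zero_apply, smul_zero, add_zero,
                ← Finset.sum_neg_distrib]
              refine Finset.sum_congr rfl fun j hj => ?_
              rw [Finset.mem_range] at hj
              exact hface (i, j) hj.le le_rfl hne fun h => hj.ne (congrArg Prod.snd h)
          rw [e3]
          abel
        · have e1 : snoc R k v i = R i := by simp [snoc, hik.ne']
          rw [e1, if_neg hik.ne', add_zero, hk i hik]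
          simp
      rw [Finset.sum_congr rfl fun i _ => hmain i, Finset.sum_add_distrib, Finset.sum_neg_distrib,
        Finset.sum_ite_eq' Finset.univ k, if_pos (Finset.mem_univ _), pow_succ, mul_neg_one,
        neg_smul]
      abel
    · intro c hc
      have h := cutAt_dOp_add hφ hc.len_eq s v _ _ (hc.path s le_rfl)
      rw [eq_sub_of_add_eq h]
      have e1 := faceFun_insertRest_up F.base hsv v φ c
      have e2 := faceFun_insertRest_self F.base hsv v φ c
      rw [← hR'] at e1 e2
      simp only [Pi.add_apply, Pi.sub_apply, Pi.neg_apply]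
      rw [e1, e2]
      abel

end Conf

end

section

variable {p q : ℕ} {V A : Type} {M : Type*} [AddCommGroup M]

/-! ### Composition in terms of configurations -/

/-- The recursion is unrolled into a sum over positions in the word, the form in which `glueEdge`
enumerates the attachments. -/
theorem cutList_eq_sum (w : List (Letter q)) (g : Seg q → Words q → Words q → M) :
    cutList w g = ((List.finRange w.length).map fun i =>
      letterSign (w.get i) • g (w.get i).1
        (split (w.get i).1 (FreeGroup.mk (w.take i)) * leftPart (w.get i))
        (rightPart (w.get i) * split (w.get i).1 (FreeGroup.mk (w.drop (i + 1))))).sum := by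
  induction w generalizing g with
  | nil => rfl
  | cons l w ih =>
    rw [cutList, ih]
    simp only [List.length_cons, List.finRange_succ, List.map_cons, List.sum_cons, List.map_map]
    congr 1
    · simp only [List.get_cons_zero, Fin.val_zero, List.take_zero, zero_add, List.drop_succ_cons,
        List.drop_zero]
      rw [← FreeGroup.one_eq_mk, map_one, one_mul]
    · refine congrArg List.sum (List.map_congr_left fun i _ => ?_)
      simp only [Function.comp_apply, Fin.val_succ, List.take_succ_cons,
        List.drop_succ_cons]
      rw [mk_cons l (w.take i), map_mul, mul_assoc]
      rfl

/-- Splitting on the level of words represents the homomorphism `split`, so the words of a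
`GlueState` need only be followed as elements of the free group. -/
theorem mk_splitWord (s : Seg q) (w : List (Letter q)) :
    FreeGroup.mk (Diagram.splitWord s.1 s.2 w) = split s (FreeGroup.mk w) := by
  induction w with
  | nil => rfl
  | cons l w ih =>
    rw [mk_cons, map_mul, ← ih, Diagram.splitWord, List.flatMap_cons, mk_append]
    congr 1
    rcases s with ⟨k, j⟩; rcases l with ⟨⟨k', j'⟩, o⟩
    by_cases h : (k', j') = (k, j)
    · obtain ⟨rfl, rfl⟩ := Prod.mk.inj h
      cases o
      · have : (FreeGroup.mk [((k', j'), false)] : Words q) = (FreeGroup.of (k', j'))⁻¹ := rfl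
        rw [this, map_inv, split_of_self]
        simp only [Diagram.splitLetter, if_true, Bool.false_eq_true, if_false, mul_inv_rev]
        rfl
      · have : (FreeGroup.mk [((k', j'), true)] : Words q) = FreeGroup.of (k', j') := rfl
        rw [this, split_of_self]
        simp only [Diagram.splitLetter, if_true]
        rfl
    · have e : Diagram.splitLetter k j ((k', j'), o) = [(shift (k, j) (k', j'), o)] := by
        simp only [Diagram.splitLetter, shift, up]
        grind
      rw [e]
      cases o
      · have : (FreeGroup.mk [((k', j'), false)] : Words q) = (FreeGroup.of (k', j'))⁻¹ := rfl
        rw [this, map_inv, split_of_ne h]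
        rfl
      · have : (FreeGroup.mk [((k', j'), true)] : Words q) = FreeGroup.of (k', j') := rfl
        rw [this, split_of_ne h]
        rfl

theorem mk_splitLetter_take (l : Letter q) :
    FreeGroup.mk ((Diagram.splitLetter l.1.1 l.1.2 l).take 1) = leftPart l := by
  rcases l with ⟨⟨k, j⟩, _ | _⟩ <;> simp [Diagram.splitLetter, leftPart, up, FreeGroup.of,
    FreeGroup.inv_mk, FreeGroup.invRev]

theorem mk_splitLetter_drop (l : Letter q) :
    FreeGroup.mk ((Diagram.splitLetter l.1.1 l.1.2 l).drop 1) = rightPart l := by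
  rcases l with ⟨⟨k, j⟩, _ | _⟩ <;> simp [Diagram.splitLetter, rightPart, up, FreeGroup.of,
    FreeGroup.inv_mk, FreeGroup.invRev]

/-- The letters are segments of circles with the given half-edges. -/
def ValidLetters (rest : Fin q → List V) (w : List (Letter q)) : Prop :=
  ∀ l ∈ w, l.1.2 ≤ (rest l.1.1).length

theorem ValidLetters.splitWord {rest : Fin q → List V} {w : List (Letter q)}
    (hw : ValidLetters rest w) {s : Seg q} (hs : s.2 ≤ (rest s.1).length) (v : V) :
    ValidLetters (insertRest rest s v) (Diagram.splitWord s.1 s.2 w) := by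
  intro l hl
  rw [Diagram.splitWord, List.mem_flatMap] at hl
  obtain ⟨l', hl', hl⟩ := hl
  have h := hw l' hl'
  rw [length_insertRest hs]
  rcases s with ⟨k, j⟩; rcases l' with ⟨⟨k', j'⟩, o'⟩; rcases l with ⟨⟨k'', j''⟩, o⟩
  simp only [Diagram.splitLetter] at *
  grind

/-- The configuration of a stage of gluing at which the first `N i` half-edges of the circle `i`
have been glued. -/
def stateConf (E : Multiset (Sym2 V)) (N : Fin p → ℕ) (st : Diagram.GlueState p q V) :
    Conf p q V where
  edges := E
  len k := (st.rest k).length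
  rest := st.rest
  track s := if s.2 < N s.1 then FreeGroup.mk (st.seg s) else
    if s.2 = N s.1 then FreeGroup.mk (st.word s.1) else 1

/-- One stage of the gluing is `cutAt`, up to the sign `(-1) ^ m` for the half-edges glued before.
The word of a state need not be reduced, since `cut` can be computed from any representative. -/
theorem sum_map_glueEdge (E : Multiset (Sym2 V)) (N : Fin p → ℕ) (m : ℕ) (i : Fin p) (v : V)
    (st : Diagram.GlueState p q V) (hst : ∀ i, ValidLetters st.rest (st.word i))
    (φ : Conf p q V → M) :
    ((Diagram.glueEdge m i (N i) v st).map fun st' =>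
      st'.sign • φ (stateConf E (Function.update N i (N i + 1)) st')).sum =
      (st.sign * (-1) ^ m) • Conf.cutAt (i, N i) v φ (stateConf E N st) := by
  have e : (stateConf E N st).track (i, N i) = FreeGroup.mk (st.word i) := by
    simp [stateConf]
  rw [Conf.cutAt, e, cut_mk, cutList_eq_sum, Diagram.glueEdge, List.map_map, List.smul_sum,
    List.map_map]
  refine congrArg List.sum (List.map_congr_left fun ℓ _ => ?_)
  simp only [Function.comp_apply]
  set l := (st.word i).get ℓ with hl
  have hv : l.1.2 ≤ (st.rest l.1.1).length := hst i l (List.get_mem _ _)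
  rw [smul_smul, smul_smul]
  congr 1
  · simp only [pos, letterSign, stateConf]
    rw [pow_add _ _ m]
    ring
  · refine congrArg φ (Conf.ext rfl ?_ rfl ?_)
    · funext k
      have := length_insertRest hv v k
      simp only [stateConf, Conf.insert]
      rw [show Function.update st.rest l.1.1 ((st.rest l.1.1).insertIdx l.1.2 v) =
        insertRest st.rest l.1 v from rfl, this]
      by_cases hk : k = l.1.1
      · subst hk; simp
      · simp [hk]
    · funext u
      simp only [stateConf, Conf.insert, insTrack]
      by_cases h1 : u = (i, N i)
      · subst h1
        simp only [Function.update_self, Nat.lt_succ_self, if_true, mk_append]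
        rw [mk_splitLetter_take, ← mk_splitWord]
      · rw [if_neg h1]
        by_cases h2 : u = up (i, N i)
        · subst h2
          simp only [up, Function.update_self, lt_irrefl, if_true, if_false, mk_append]
          rw [mk_splitLetter_drop, ← mk_splitWord]
        · rw [if_neg h2]
          rcases u with ⟨i', t⟩
          by_cases hi : i' = i
          · subst hi
            have h3 : t ≠ N i' := fun h => h1 (by rw [h])
            have h4 : t ≠ N i' + 1 := fun h => h2 (by rw [h]; rfl)
            simp only [Function.update_self]
            by_cases h5 : t < N i'
            · have h6 : old (i', N i') (i', t) = (i', t) := by simp [old]; omega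
              rw [h6, if_pos (by omega), if_pos h5, Function.update_of_ne h1, mk_splitWord]
            · have h6 : old (i', N i') (i', t) = (i', t - 1) := by simp [old]; omega
              rw [h6, if_neg (by omega), if_neg (by omega), if_neg (by simp only; omega),
                if_neg (by simp only; omega), map_one]
          · have h6 : old (i, N i) (i', t) = (i', t) := by simp [old, Ne.symm hi]
            rw [h6]
            simp only [Function.update_of_ne hi, Function.update_of_ne h1]
            split_ifs
            · rw [mk_splitWord]
            · rw [mk_splitWord]
            · rw [map_one]

theorem validLetters_glueEdge {m : ℕ} {i : Fin p} {t : ℕ} {v : V}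
    {st : Diagram.GlueState p q V} (hst : ∀ i, ValidLetters st.rest (st.word i))
    {st' : Diagram.GlueState p q V} (h : st' ∈ Diagram.glueEdge m i t v st) (i' : Fin p) :
    ValidLetters st'.rest (st'.word i') := by
  rw [Diagram.glueEdge, List.mem_map] at h
  obtain ⟨ℓ, _, rfl⟩ := h
  set l := (st.word i).get ℓ with hl
  have hv : l.1.2 ≤ (st.rest l.1.1).length := hst i l (List.get_mem _ _)
  simp only
  change ValidLetters (insertRest st.rest l.1 v) _
  by_cases hi : i' = i
  · subst hi
    rw [Function.update_self]
    intro l' hl'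
    rcases List.mem_append.1 hl' with h | h
    · refine ValidLetters.splitWord (w := [l]) (fun l₁ h₁ => ?_) hv v l' ?_
      · rwa [List.mem_singleton.1 h₁]
      · rw [Diagram.splitWord, List.flatMap_singleton]
        exact List.mem_of_mem_drop h
    · exact ValidLetters.splitWord (fun l h => hst i' l (List.mem_of_mem_drop h)) hv v l' h
  · rw [Function.update_of_ne hi]
    exact (hst i').splitWord hv v

/-- The half-edges in the list are the next ones to be glued. -/
def InOrder : (Fin p → ℕ) → List (Fin p × ℕ × A) → (Fin p → ℕ) → Prop
  | N, [], N' => N' = N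
  | N, e :: L, N' => e.2.1 = N e.1 ∧ InOrder (Function.update N e.1 (N e.1 + 1)) L N'

theorem InOrder.append {N N' N'' : Fin p → ℕ} {L L' : List (Fin p × ℕ × A)} (h : InOrder N L N')
    (h' : InOrder N' L' N'') : InOrder N (L ++ L') N'' := by
  induction L generalizing N with
  | nil => exact (show N' = N from h) ▸ h'
  | cons e L ih => exact ⟨h.1, ih h.2⟩

theorem inOrder_zipIdx (i : Fin p) (l : List A) (N : Fin p → ℕ) :
    InOrder N ((l.zipIdx (N i)).map fun vt => (i, vt.2, vt.1))
      (Function.update N i (N i + l.length)) := by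
  induction l generalizing N with
  | nil => simp [InOrder]
  | cons x l ih =>
    rw [List.zipIdx_cons, List.map_cons]
    refine ⟨rfl, ?_⟩
    have := ih (Function.update N i (N i + 1))
    rw [Function.update_self, Function.update_idem] at this
    convert this using 2
    simp only [List.length_cons]
    omega

theorem inOrder_flatMap (R : Fin p → List A) (L : List (Fin p)) (hL : L.Nodup) (N : Fin p → ℕ)
    (hN : ∀ i ∈ L, N i = 0) :
    InOrder N (L.flatMap fun i => (R i).zipIdx.map fun vt => (i, vt.2, vt.1))
      (fun i => if i ∈ L then (R i).length else N i) := by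
  induction L generalizing N with
  | nil => simp [InOrder]
  | cons i L ih =>
    rw [List.flatMap_cons]
    rw [List.nodup_cons] at hL
    have h0 := hN i (by simp)
    have h1 := inOrder_zipIdx i (R i) N
    rw [h0] at h1
    have h2 := ih hL.2 (Function.update N i (0 + (R i).length)) fun i' hi' => by
      rw [Function.update_of_ne (fun h : i' = i => hL.1 (h ▸ hi'))]
      exact hN i' (by simp [hi'])
    convert h1.append h2 using 1
    funext i'
    by_cases hi : i' = i
    · subst hi
      simp [hL.1]
    · simp [hi]

/-- The stages are iterated, and the signs counting the earlier half-edges are collected in front.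
For `m = 0` their exponents add up to `tri L.length`. -/
theorem sum_map_foldl_glueEdge (E : Multiset (Sym2 V)) (g : A → V) {N N' : Fin p → ℕ}
    {L : List (Fin p × ℕ × A)} (hL : InOrder N L N') (m : ℕ)
    (sts : List (Diagram.GlueState p q V))
    (hst : ∀ st ∈ sts, ∀ i, ValidLetters st.rest (st.word i)) (φ : Conf p q V → M) :
    (((L.zipIdx m).foldl (fun sts e => sts.flatMap
        (Diagram.glueEdge e.2 e.1.1 e.1.2.1 (g e.1.2.2))) sts).map fun st =>
      st.sign • φ (stateConf E N' st)).sum =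
    (sts.map fun st => (st.sign * (-1) ^ ∑ i ∈ Finset.range L.length, (m + i)) •
      Conf.cuts (L.map fun e => ((e.1, e.2.1), g e.2.2)) φ (stateConf E N st)).sum := by
  induction L generalizing N m sts with
  | nil =>
    obtain rfl : N' = N := hL
    simp [Conf.cuts_nil]
  | cons e L ih =>
    obtain ⟨h1, h2⟩ := hL
    rw [List.zipIdx_cons, List.foldl_cons, ih h2]
    · rw [List.map_flatMap, List.flatMap, List.sum_flatten, List.map_map]
      refine congrArg List.sum (List.map_congr_left fun st hs => ?_)
      rw [Function.comp_apply, List.map_cons, Conf.cuts_cons, List.length_cons,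
        Finset.sum_range_succ', h1]
      have := sum_map_glueEdge E N m e.1 (g e.2.2) st (hst st hs) ((-1 : ℤ) ^ (∑ i ∈
        Finset.range L.length, (m + (i + 1))) •
          Conf.cuts (L.map fun e => ((e.1, e.2.1), g e.2.2)) φ)
      rw [Conf.cutAt_zsmul] at this
      simp only [Pi.smul_apply, smul_smul] at this
      have h3 : ∀ i, m + 1 + i = m + (i + 1) := fun i => by omega
      simp only [h3]
      rw [this]
      congr 1
      rw [add_zero, pow_add]
      ring
    · intro st hs
      obtain ⟨st₀, h3, h4⟩ := List.mem_flatMap.1 hs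
      exact validLetters_glueEdge (hst st₀ h3) h4

end

/-- The number of pairs of half-edges among `n` half-edges. -/
def tri (n : ℕ) : ℕ := ∑ i ∈ Finset.range n, i

theorem tri_succ (n : ℕ) : tri (n + 1) = tri n + n := Finset.sum_range_succ _ _

namespace Diagram

variable {a b c : ℕ × ℕ} {M : Type*} [AddCommGroup M]

/-- The edges of the diagrams that occur in a composition. -/
def glueEdges (X : Diagram a b) (Y : Diagram b c) : Multiset (Sym2 (X.V ⊕ Y.V)) :=
  X.edges.map (Sym2.map Sum.inl) + Y.edges.map (Sym2.map Sum.inr) +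
    (Finset.univ.val.map fun i => s(Sum.inl (X.start i), Sum.inr (Y.loopLeaf i))) +
    (Finset.univ.val.map fun i => s(Sum.inl (X.outLeaf i), Sum.inr (Y.inLeaf i)))

/-- The diagram `Y` before the half-edges of `X` are glued. -/
def initialConf (X : Diagram a b) (Y : Diagram b c) : Conf b.1 c.1 (X.V ⊕ Y.V) where
  edges := X.glueEdges Y
  len k := (Y.rest k).length
  rest k := (Y.rest k).map Sum.inr
  track s := if s.2 = 0 then Y.loop s.1 else 1

/-- The diagram given by a configuration after the half-edges of `X` have been glued. -/
def confDiag (X : Diagram a b) (Y : Diagram b c) (C : Conf b.1 c.1 (X.V ⊕ Y.V)) :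
    Diagram a c where
  V := X.V ⊕ Y.V
  finite := by
    have := X.finite
    have := Y.finite
    infer_instance
  edges := C.edges
  start k := Sum.inr (Y.start k)
  rest := C.rest
  loopLeaf i := Sum.inl (X.loopLeaf i)
  inLeaf i := Sum.inl (X.inLeaf i)
  outLeaf i := Sum.inr (Y.outLeaf i)
  loop i := FreeGroup.lift C.track (X.loop i)

/-- The half-edges of `X` that are glued in a composition. -/
def leftRest (X : Diagram a b) (Y : Diagram b c) (i : Fin b.1) : List (X.V ⊕ Y.V) :=
  (X.rest i).map Sum.inl

theorem lift_congr {α : Type*} [DecidableEq α] {G : Type*} [Group G] {f g : α → G} {x : FreeGroup α}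
    (h : ∀ l ∈ x.toWord, f l.1 = g l.1) : FreeGroup.lift f x = FreeGroup.lift g x := by
  rw [← FreeGroup.mk_toWord (x := x), FreeGroup.lift_mk, FreeGroup.lift_mk]
  refine congrArg List.prod (List.map_congr_left fun l hl => ?_)
  rw [h l hl]

theorem IsPath.validLetters {D : Diagram a b} {u v : D.V} {w : List (Letter b.1)}
    (h : D.IsPath u w v) : ValidLetters D.rest w := by
  induction w generalizing u with
  | nil => exact fun l hl => absurd hl (by simp)
  | cons l w ih =>
    intro l' hl'
    rcases List.mem_cons.1 hl' with rfl | hl'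
    · exact h.1
    · exact ih h.2.2 l' hl'

theorem halfEdges_map (X : Diagram a b) (Y : Diagram b c) :
    (X.halfEdges.map fun e => (((e.1, e.2.1) : Seg b.1), (Sum.inl e.2.2 : X.V ⊕ Y.V))) =
      halfList (X.leftRest Y) := by
  simp only [halfEdges, halfList, List.map_flatMap, List.map_map, leftRest, List.zipIdx_map]
  rfl

/-- The bridge from the definition of composition to configurations. The additive map `f` is kept
arbitrary, so that the formula can be followed by a projection, by the differential or by a further
composition. -/
theorem map_compose (X : Diagram a b) (Y : Diagram b c) (hX : X.IsLooped) (hY : Y.IsLooped)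
    (f : Chains a c →+ M) :
    f (X.compose Y) = (-1 : ℤ) ^ tri X.degree •
      Conf.cuts (halfList (X.leftRest Y)) (fun C => f (Finsupp.single (X.confDiag Y C) 1))
        (X.initialConf Y) := by
  have h1 := inOrder_flatMap X.rest (List.finRange b.1) (List.nodup_finRange _) (fun _ => 0)
    (fun _ _ => rfl)
  have h2 := sum_map_foldl_glueEdge (X.glueEdges Y) (Sum.inl : X.V → X.V ⊕ Y.V) h1 0
    [{ sign := 1
       rest := fun k => (Y.rest k).map Sum.inr
       word := fun i => (Y.loop i).toWord
       seg := fun _ => [] }] (fun st hs i => ?_)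
    (fun C => f (Finsupp.single (X.confDiag Y C) 1))
  · rw [List.map_singleton, List.sum_singleton] at h2
    have e1 : stateConf (X.glueEdges Y) (fun _ => 0)
        ({ sign := 1
           rest := fun k => (Y.rest k).map Sum.inr
           word := fun i => (Y.loop i).toWord
           seg := fun _ => [] } : GlueState b.1 c.1 (X.V ⊕ Y.V)) = X.initialConf Y := by
      refine Conf.ext rfl ?_ rfl ?_
      · funext k
        simp [stateConf, initialConf]
      · funext s
        simp [stateConf, initialConf, FreeGroup.mk_toWord]
    rw [e1] at h2
    have e2 := halfEdges_map X Y
    rw [halfEdges] at e2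
    rw [e2] at h2
    have e3 : (halfList (X.leftRest Y)).length = X.degree := by
      rw [length_halfList]; simp [leftRest, degree]
    have e4 : ((List.finRange b.1).flatMap fun i => (X.rest i).zipIdx.map
        fun vt => (i, vt.2, vt.1)).length = X.degree := by
      rw [← e3, ← e2, List.length_map]
    rw [e4] at h2
    simp only [zero_add, one_mul] at h2
    refine Eq.trans ?_ h2
    rw [compose, map_list_sum, List.map_map]
    refine congrArg List.sum (List.map_congr_left fun st _ => ?_)
    simp only [Function.comp_apply]
    rw [← map_zsmul, Finsupp.smul_single, smul_eq_mul, mul_one]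
    congr 2
    -- `glue` and `stateConf` only differ at indices beyond the last segment of a circle, and these
    -- do not occur in the loops of `X`.
    have e5 : (fun i => FreeGroup.lift (fun s => FreeGroup.mk
        (if s.2 < (X.rest s.1).length then st.seg s else st.word s.1)) (X.loop i)) =
        fun i => FreeGroup.lift (stateConf (X.glueEdges Y)
          (fun i => if i ∈ List.finRange b.1 then (X.rest i).length else 0) st).track (X.loop i) := by
      funext i
      refine lift_congr fun l hl => ?_
      have := (hX i).validLetters l hl
      simp only [stateConf, List.mem_finRange, if_true]
      split_ifs
      · rfl
      · rfl
      · omega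
    rw [glue, e5]
    rfl
  · rw [List.mem_singleton.1 hs]
    intro l hl
    simp only [List.length_map]
    exact (hY i).validLetters l hl

end Diagram

section

variable {p q : ℕ} {V W : Type}

/-! ### Slots and half-edges -/

theorem slotOf_map (f : V → W) (start : Fin q → V) (rest : Fin q → List V) (s : Seg q) :
    slotOf (fun k => f (start k)) (fun k => (rest k).map f) s = f (slotOf start rest s) := by
  rw [slotOf, slotOf, ← List.map_cons, List.length_map, List.getD_map]

theorem slotOf_mem (start : Fin q → V) (rest : Fin q → List V) (s : Seg q) :
    slotOf start rest s ∈ start s.1 :: rest s.1 := by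
  have h : s.2 % ((rest s.1).length + 1) < (start s.1 :: rest s.1).length :=
    Nat.mod_lt _ (Nat.succ_pos _)
  rw [slotOf, List.getD_eq_getElem _ _ h]
  exact List.getElem_mem h

theorem exists_slotOf_eq {start : Fin q → V} {rest : Fin q → List V} {k : Fin q} {u : V}
    (h : u ∈ start k :: rest k) : ∃ j ≤ (rest k).length, u = slotOf start rest (k, j) := by
  rcases List.mem_cons.1 h with rfl | h
  · exact ⟨0, Nat.zero_le _, (slotOf_zero ..).symm⟩
  · obtain ⟨j, hj, rfl⟩ := List.mem_iff_getElem.1 h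
    exact ⟨j + 1, hj, (slotOf_succ start rest k hj).symm⟩

/-- The half-edge that disappears when the ends of a segment are joined. -/
theorem exists_eq_insertRest {rest : Fin q → List V} {s : Seg q} (h : rest s.1 ≠ [])
    (hs : s.2 ≤ (rest s.1).length) :
    ∃ (R : Fin q → List V) (t : Seg q) (v : V), t.2 ≤ (R t.1).length ∧ rest = insertRest R t v ∧
      faceRest rest s = R ∧ (s = t ∨ s = up t ∧ t.2 = (R t.1).length) := by
  obtain ⟨k, j⟩ := s
  have h0 : (rest k).length ≠ 0 := fun h' => h (List.length_eq_zero_iff.1 h')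
  simp only at hs
  have key : ∀ i (hi : i < (rest k).length), i ≤ ((faceRest rest (k, i)) k).length ∧
      rest = insertRest (faceRest rest (k, i)) (k, i) (rest k)[i] := by
    intro i hi
    have e : faceRest rest (k, i) = Function.update rest k ((rest k).eraseIdx i) := by
      rw [faceRest, if_pos hi]
    rw [e]
    constructor
    · rw [Function.update_self, List.length_eraseIdx_of_lt hi]
      omega
    · rw [insertRest, Function.update_self, Function.update_idem,
        List.insertIdx_eraseIdx_getElem hi, Function.update_eq_self]
  by_cases hj : j < (rest k).length
  · exact ⟨_, (k, j), (rest k)[j], (key j hj).1, (key j hj).2, rfl, Or.inl rfl⟩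
  -- At the last segment the half-edge that disappears is the one at its beginning, which is also
  -- the end of the segment before.
  · have e : faceRest rest (k, j) = faceRest rest (k, (rest k).length - 1) := by
      rw [faceRest_eq_eraseIdx, faceRest_eq_eraseIdx]
      simp only
      congr 2
      omega
    have h1 := key ((rest k).length - 1) (by omega)
    refine ⟨_, (k, (rest k).length - 1), _, h1.1, h1.2, e, Or.inr ⟨?_, ?_⟩⟩
    · simp only [up, Prod.mk.injEq, true_and]
      omega
    · simp only
      rw [faceRest_eq_eraseIdx]
      simp only [Function.update_self]
      rw [List.length_eraseIdx_of_lt (by omega)]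

end

namespace Diagram

variable {a b c a' b' : ℕ × ℕ}

/-! ### The classes are closed under the differential and the composition -/

theorem SameComponent.refl {D : Diagram a b} (x : D.V) : D.SameComponent x x :=
  Relation.EqvGen.refl x

theorem SameComponent.symm {D : Diagram a b} {x y : D.V} (h : D.SameComponent x y) :
    D.SameComponent y x := Relation.EqvGen.symm _ _ h

theorem SameComponent.trans {D : Diagram a b} {x y z : D.V} (h : D.SameComponent x y)
    (h' : D.SameComponent y z) : D.SameComponent x z := Relation.EqvGen.trans _ _ _ h h'

theorem SameComponent.of_mem {D : Diagram a b} {x y : D.V} (h : s(x, y) ∈ D.edges) :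
    D.SameComponent x y := Relation.EqvGen.rel _ _ (Or.inl h)

theorem SameComponent.of_rest {D : Diagram a b} {k : Fin b.1} {x y : D.V}
    (h : x ∈ D.start k :: D.rest k) (h' : y ∈ D.start k :: D.rest k) : D.SameComponent x y :=
  Relation.EqvGen.rel _ _ (Or.inr ⟨k, h, h'⟩)

theorem SameComponent.map {D : Diagram a b} {D' : Diagram a' b'} {f : D.V → D'.V}
    (hf : ∀ x y, s(x, y) ∈ D.edges → D'.SameComponent (f x) (f y))
    (hk : ∀ k, ∀ x ∈ D.rest k, D'.SameComponent (f (D.start k)) (f x)) {x y : D.V}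
    (h : D.SameComponent x y) : D'.SameComponent (f x) (f y) := by
  have hk' : ∀ k, ∀ x ∈ D.start k :: D.rest k, D'.SameComponent (f (D.start k)) (f x) := by
    intro k x hx
    rcases List.mem_cons.1 hx with rfl | hx
    · exact .refl _
    · exact hk k x hx
  induction h with
  | rel x y h =>
    rcases h with h | ⟨k, h, h'⟩
    · exact hf x y h
    · exact (hk' k x h).symm.trans (hk' k y h')
  | refl x => exact .refl _
  | symm x y _ ih => exact ih.symm
  | trans x y z _ _ ih ih' => exact ih.trans ih'

theorem SameArc.sameComponent {D : Diagram a b} {x y : D.V} (h : D.SameArc x y) :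
    D.SameComponent x y := Relation.EqvGen.mono (fun _ _ h => Or.inl h) _ _ h

theorem IsPath.sameComponent {D : Diagram a b} {x y : D.V} {w : List (Letter b.1)}
    (h : D.IsPath x w y) : D.SameComponent x y := by
  induction w generalizing x with
  | nil => exact SameArc.sameComponent h
  | cons l w ih =>
    refine (SameArc.sameComponent h.2.1).trans (SameComponent.trans ?_ (ih h.2.2))
    refine .of_rest (k := l.1.1) ?_ ?_
    · unfold source
      split_ifs
      · exact slotOf_mem D.start D.rest l.1
      · exact slotOf_mem D.start D.rest (l.1.1, l.1.2 + 1)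
    · unfold target
      split_ifs
      · exact slotOf_mem D.start D.rest (l.1.1, l.1.2 + 1)
      · exact slotOf_mem D.start D.rest l.1

/-- The frame in which the half-edges of `X` are glued along the loops of `Y`. -/
def glueFrame (X : Diagram a b) (Y : Diagram b c) : GlueFrame b.1 c.1 (X.V ⊕ Y.V) where
  edges := X.glueEdges Y
  start k := Sum.inr (Y.start k)
  rest k := (Y.rest k).map Sum.inr
  base k := Sum.inl (X.start k)
  positive := Y.IsPositive

instance (X : Diagram a b) (Y : Diagram b c) : Finite (X.V ⊕ Y.V) := by
  have := X.finite
  have := Y.finite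
  infer_instance

theorem inl_mem_glueEdges (X : Diagram a b) (Y : Diagram b c) {x y : X.V}
    (h : s(x, y) ∈ X.edges) : s(Sum.inl x, Sum.inl y) ∈ X.glueEdges Y := by
  simp only [glueEdges, Multiset.mem_add]
  exact Or.inl (Or.inl (Or.inl (Multiset.mem_map.2 ⟨_, h, rfl⟩)))

theorem inr_mem_glueEdges (X : Diagram a b) (Y : Diagram b c) {x y : Y.V}
    (h : s(x, y) ∈ Y.edges) : s(Sum.inr x, Sum.inr y) ∈ X.glueEdges Y := by
  simp only [glueEdges, Multiset.mem_add]
  exact Or.inl (Or.inl (Or.inr (Multiset.mem_map.2 ⟨_, h, rfl⟩)))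

theorem start_mem_glueEdges (X : Diagram a b) (Y : Diagram b c) (i : Fin b.1) :
    s(Sum.inl (X.start i), Sum.inr (Y.loopLeaf i)) ∈ X.glueEdges Y := by
  simp only [glueEdges, Multiset.mem_add]
  exact Or.inl (Or.inr (Multiset.mem_map.2 ⟨i, by simp, rfl⟩))

theorem outLeaf_mem_glueEdges (X : Diagram a b) (Y : Diagram b c) (i : Fin b.2) :
    s(Sum.inl (X.outLeaf i), Sum.inr (Y.inLeaf i)) ∈ X.glueEdges Y := by
  simp only [glueEdges, Multiset.mem_add]
  exact Or.inr (Multiset.mem_map.2 ⟨i, by simp, rfl⟩)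

theorem IsPositive.posWord {D : Diagram a b} (h : D.IsPositive) (i : Fin a.1) :
    PosWord (D.loop i) := posWord_iff.2 (h i)

/-- Before anything is glued, each circle of the source has one segment, from the start half-edge to
itself. Its path crosses the edge to the leaf of `Y`, follows the loop there, and returns. -/
theorem initialConf_good (X : Diagram a b) {Y : Diagram b c} (hY : Y.IsLooped) :
    (X.initialConf Y).Good (X.glueFrame Y) fun _ => [] where
  edges_eq := rfl
  len_eq := by funext k; simp [initialConf]
  subset k := fun _ h => h
  total := by simp [initialConf, glueFrame]
  path := by
    rintro ⟨k, j⟩ hs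
    obtain rfl : j = 0 := by simpa using hs
    have e1 : slotOf (X.glueFrame Y).base (fun _ => []) (k, 0) = Sum.inl (X.start k) :=
      slotOf_zero ..
    have e2 : slotOf (X.glueFrame Y).base (fun _ => []) (up (k, 0)) = Sum.inl (X.start k) :=
      slotOf_end ..
    rw [e1, e2]
    have h : ((X.initialConf Y).diag (X.glueFrame Y).start).PathTo (Sum.inr (Y.loopLeaf k))
        (Y.loop k) (Sum.inr (Y.loopLeaf k)) := by
      refine PathTo.map (D := Y) (D' := (X.initialConf Y).diag (X.glueFrame Y).start) Sum.inr
        (MonoidHom.id _) (fun x y h => Joined.map (fun x y h => ?_) h) (fun s hs => ?_) (hY k)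
      · exact .of_mem (X.inr_mem_glueEdges Y h)
      · have := pathTo_of ((X.initialConf Y).diag (X.glueFrame Y).start) s
          (by simpa [Conf.diag, initialConf] using hs)
        have e : ∀ j, ((X.initialConf Y).diag (X.glueFrame Y).start).slot s.1 j =
          Sum.inr (Y.slot s.1 j) := fun j => slotOf_map Sum.inr Y.start Y.rest (s.1, j)
        rw [e, e] at this
        exact this
    exact h.congr (Joined.of_mem (X.start_mem_glueEdges Y k)) (Joined.of_mem (X.start_mem_glueEdges Y k)).symm
  pos h := by
    rintro ⟨k, j⟩ hs
    obtain rfl : j = 0 := by simpa using hs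
    exact IsPositive.posWord h k

section

variable {X : Diagram a b} {Y : Diagram b c} {C : Conf b.1 c.1 (X.V ⊕ Y.V)}

theorem pathTo_confDiag (hC : C.Good (X.glueFrame Y) (X.leftRest Y))
    (s : Seg b.1) (hs : s.2 ≤ (X.rest s.1).length) :
    (X.confDiag Y C).PathTo (Sum.inl (X.slot s.1 s.2)) (C.track s)
      (Sum.inl (X.slot s.1 (s.2 + 1))) := by
  have h := hC.path s (by simpa [leftRest] using hs)
  have e : ∀ j, slotOf (X.glueFrame Y).base (X.leftRest Y) (s.1, j) = Sum.inl (X.slot s.1 j) :=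
    fun j => slotOf_map Sum.inl X.start X.rest (s.1, j)
  rw [show slotOf _ _ s = _ from e s.2, show slotOf _ _ (up s) = _ from e (s.2 + 1)] at h
  exact PathTo.map (D := C.diag (X.glueFrame Y).start) (D' := X.confDiag Y C) id (MonoidHom.id _) (fun _ _ h => h)
    (fun u hu => pathTo_of (X.confDiag Y C) u hu) h

theorem confDiag_isLooped (hC : C.Good (X.glueFrame Y) (X.leftRest Y))
    (hX : X.IsLooped) : (X.confDiag Y C).IsLooped := by
  intro i
  refine PathTo.map (D := X) (D' := X.confDiag Y C) Sum.inl (FreeGroup.lift C.track)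
    (fun x y h => Joined.map (fun x y h => ?_) h) (fun s hs => ?_) (hX i)
  · refine .of_mem ?_
    change _ ∈ C.edges
    rw [hC.edges_eq]
    exact X.inl_mem_glueEdges Y h
  · rw [FreeGroup.lift_apply_of]
    exact pathTo_confDiag hC s hs

theorem confDiag_isPositive (hC : C.Good (X.glueFrame Y) (X.leftRest Y))
    (hX : X.IsLooped) (hX' : X.IsPositive) (hY : Y.IsPositive) :
    (X.confDiag Y C).IsPositive := by
  intro i
  rw [← posWord_iff]
  -- Positivity is only known for the words of actual segments. The others do not occur in the loop
  -- and are replaced by `1`, so that the substitution becomes positive on all generators.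
  have h1 : (X.confDiag Y C).loop i = FreeGroup.lift
      (fun s => if s.2 ≤ (X.rest s.1).length then C.track s else 1) (X.loop i) :=
    lift_congr fun l hl => by
      rw [if_pos ((hX i).validLetters l hl)]
  rw [h1]
  refine PosWord.map (fun s => ?_) (hX'.posWord i)
  rw [FreeGroup.lift_apply_of]
  split_ifs with h
  · exact hC.pos hY s (by simpa [leftRest] using h)
  · exact Submonoid.one_mem _

/-- The white vertices of `X` disappear, but the half-edges they connected remain connected, since
the words of the segments between them are paths in the glued diagram. -/
theorem confDiag_sameComponent_inl (hC : C.Good (X.glueFrame Y) (X.leftRest Y))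
    {x y : X.V} (h : X.SameComponent x y) :
    (X.confDiag Y C).SameComponent (Sum.inl x) (Sum.inl y) := by
  refine SameComponent.map (D' := X.confDiag Y C) (f := Sum.inl) (fun x y h => .of_mem ?_)
    (fun k x hx => ?_) h
  · change _ ∈ C.edges
    rw [hC.edges_eq]
    exact X.inl_mem_glueEdges Y h
  · obtain ⟨j, hj, rfl⟩ := exists_slotOf_eq (start := X.start) (List.mem_cons_of_mem _ hx)
    clear hx
    induction j with
    | zero => rw [slotOf_zero]; exact .refl _
    | succ j ih =>
      exact (ih (by omega)).trans
        (pathTo_confDiag hC (k, j) (by simp only; omega)).sameComponent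

theorem confDiag_sameComponent_inr (hC : C.Good (X.glueFrame Y) (X.leftRest Y))
    {x y : Y.V} (h : Y.SameComponent x y) :
    (X.confDiag Y C).SameComponent (Sum.inr x) (Sum.inr y) := by
  refine SameComponent.map (D' := X.confDiag Y C) (f := Sum.inr) (fun x y h => .of_mem ?_)
    (fun k x hx => ?_) h
  · change _ ∈ C.edges
    rw [hC.edges_eq]
    exact X.inr_mem_glueEdges Y h
  · refine .of_rest (k := k) (List.mem_cons_self ..) (List.mem_cons_of_mem _ (hC.subset k ?_))
    exact List.mem_map.2 ⟨x, hx, rfl⟩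

/-- A component of `X` contains a start half-edge or an outgoing leaf. Either is joined to a leaf of
`Y`, whose component satisfies the condition. -/
theorem confDiag_hasPositiveBoundary (hC : C.Good (X.glueFrame Y) (X.leftRest Y))
    (hX : X.HasPositiveBoundary) (hY : Y.HasPositiveBoundary) :
    (X.confDiag Y C).HasPositiveBoundary := by
  have hinr : ∀ y, ∃ w, (X.confDiag Y C).SameComponent (Sum.inr y) w ∧
      ((∃ k, w = (X.confDiag Y C).start k) ∨ ∃ t, w = (X.confDiag Y C).outLeaf t) := by
    intro y
    obtain ⟨w, h, ⟨k, rfl⟩ | ⟨t, rfl⟩⟩ := hY y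
    · exact ⟨_, confDiag_sameComponent_inr hC h, Or.inl ⟨k, rfl⟩⟩
    · exact ⟨_, confDiag_sameComponent_inr hC h, Or.inr ⟨t, rfl⟩⟩
  have hedge : ∀ {x y}, s(x, y) ∈ X.glueEdges Y → (X.confDiag Y C).SameComponent x y := by
    intro x y h
    refine .of_mem ?_
    change _ ∈ C.edges
    rwa [hC.edges_eq]
  rintro (x | y)
  · obtain ⟨w, h, ⟨k, rfl⟩ | ⟨t, rfl⟩⟩ := hX x
    · obtain ⟨w, h', h''⟩ := hinr (Y.loopLeaf k)
      exact ⟨w, ((confDiag_sameComponent_inl hC h).trans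
        (hedge (X.start_mem_glueEdges Y k))).trans h', h''⟩
    · obtain ⟨w, h', h''⟩ := hinr (Y.inLeaf t)
      exact ⟨w, ((confDiag_sameComponent_inl hC h).trans
        (hedge (X.outLeaf_mem_glueEdges Y t))).trans h', h''⟩
  · exact hinr y

theorem degree_confDiag (hC : C.Good (X.glueFrame Y) (X.leftRest Y))
    : (X.confDiag Y C).degree = X.degree + Y.degree := by
  have := congrArg Multiset.card hC.total
  simp only [Multiset.card_add, Multiset.card_sum, Multiset.coe_card] at this
  simp only [degree, confDiag, this, glueFrame, leftRest, List.length_map]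
  exact add_comm _ _

end

/-! Closure under faces -/

section

variable {D : Diagram a b} {k : Fin b.1} {j : ℕ}

/-- The collapsed segment is replaced by the new edge, hence by the trivial path. Any other segment
keeps its ends, up to moving one of them along that edge. -/
theorem face_pathTo (hk : D.rest k ≠ []) (hj : j ≤ (D.rest k).length) (s : Seg b.1)
    (hs : s.2 ≤ (D.rest s.1).length) :
    (D.face k j).PathTo (D.slot s.1 s.2) (coll (k, j) (FreeGroup.of s))
      (D.slot s.1 (s.2 + 1)) := by
  have hedge : (D.face k j).SameArc (D.slot k j) (D.slot k (j + 1)) :=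
    Joined.of_mem (Multiset.mem_cons_self ..)
  by_cases hsf : s = (k, j)
  · subst hsf
    rw [coll_self]
    exact pathTo_one hedge
  rw [coll_ne hsf]
  obtain ⟨R, t, v, ht, hR, hF, h⟩ := exists_eq_insertRest (s := (k, j)) hk hj
  have hslot : ∀ u, D.slot u.1 u.2 = slotOf (V := D.V) D.start (insertRest R t v) u := by
    intro u; rw [← hR]; rfl
  have hslot' : ∀ u : Seg b.1, (D.face k j).slot u.1 u.2 = slotOf (V := D.V) D.start R u := by
    intro u; rw [← hF]; rfl
  have hof : ∀ u : Seg b.1, u.2 ≤ (R u.1).length → (D.face k j).PathTo (slotOf (V := D.V) D.start R u)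
      (FreeGroup.of u) (slotOf (V := D.V) D.start R (up u)) := by
    intro u hu
    rw [← hslot' u, ← hslot' (up u)]
    refine pathTo_of (D.face k j) u ?_
    rw [← hF] at hu
    exact hu
  have h1 : slotOf (V := D.V) D.start (insertRest R t v) t = slotOf (V := D.V) D.start R t :=
    slotOf_insertRest_of_le ht v le_rfl
  have h2 : slotOf (V := D.V) D.start (insertRest R t v) (up t) = v := slotOf_insertRest_up ht v
  have h3 : slotOf (V := D.V) D.start (insertRest R t v) (up (up t)) = slotOf (V := D.V) D.start R (up t) :=
    slotOf_insertRest_of_lt ht v (Nat.lt_succ_self _) (Nat.succ_le_succ ht)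
  rw [hR] at hs
  rw [show D.slot s.1 (s.2 + 1) = D.slot (up s).1 (up s).2 from rfl, hslot, hslot]
  have hshift : s ≠ t → s ≠ up t → (D.face k j).PathTo (slotOf (V := D.V) D.start (insertRest R t v) s)
      (FreeGroup.of (old t s)) (slotOf (V := D.V) D.start (insertRest R t v) (up s)) := by
    intro h4 h5
    obtain ⟨h6, h7, h8⟩ := exists_shift_of_insertRest ht hs h4 h5
    have h9 := slotOf_insertRest_shift (start := D.start) ht v h7 h6
    rw [h8] at h9
    rw [h9.1, h9.2]
    exact hof _ h7
  rcases h with rfl | ⟨h, h'⟩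
  · rw [show D.slot k j = _ from hslot (k, j), show D.slot k (j + 1) = _ from hslot (up (k, j)),
      h1, h2] at hedge
    by_cases h4 : s = up (k, j)
    · subst h4
      rw [h2, h3, old_up]
      exact (hof _ ht).congr hedge.symm (.refl _)
    · exact hshift hsf h4
  · rw [h] at hsf
    rw [show D.slot k j = _ from hslot (k, j), show D.slot k (j + 1) = _ from hslot (up (k, j)),
      h, h2, h3] at hedge
    rw [h]
    by_cases h4 : s = t
    · subst h4
      rw [h1, h2, old_up_self]
      exact (hof _ ht).congr (.refl _) hedge.symm
    · have e : old (up t) s = old t s := by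
        rcases t with ⟨k', j'⟩; rcases s with ⟨k'', j''⟩
        clear hslot hslot' hof hshift hedge h1 h2 h3 hF hR
        grind [old, up]
      rw [e]
      exact hshift h4 hsf

theorem face_isLooped (hk : D.rest k ≠ []) (hj : j ≤ (D.rest k).length) (hD : D.IsLooped) :
    (D.face k j).IsLooped := fun i =>
  PathTo.map (D := D) (D' := D.face k j) id (coll (k, j))
    (fun _ _ h => Joined.mono (Multiset.le_cons_self _ _) h) (face_pathTo hk hj) (hD i)

theorem face_isPositive (hD : D.IsPositive) : (D.face k j).IsPositive := by
  intro i
  rw [← posWord_iff]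
  refine PosWord.map (h := coll (k, j)) (fun s => ?_) (hD.posWord i)
  by_cases h : s = (k, j)
  · rw [h, coll_self]; exact Submonoid.one_mem _
  · rw [coll_ne h]; exact posWord_of _

theorem face_hasPositiveBoundary (hk : D.rest k ≠ []) (hj : j ≤ (D.rest k).length)
    (hD : D.HasPositiveBoundary) : (D.face k j).HasPositiveBoundary := by
  intro x
  obtain ⟨w, h, hw⟩ := hD x
  refine ⟨w, SameComponent.map (D := D) (D' := D.face k j) (f := id) (fun x y h => ?_)
    (fun k' x hx => ?_) h, hw⟩
  · exact .of_mem (Multiset.mem_cons_of_mem h)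
  · obtain ⟨i, hi, rfl⟩ := exists_slotOf_eq (start := D.start) (List.mem_cons_of_mem _ hx)
    clear hx
    induction i with
    | zero => rw [slotOf_zero]; exact .refl _
    | succ i ih =>
      exact (ih (by omega)).trans
        (face_pathTo hk hj (k', i) (by simp only; omega)).sameComponent

theorem degree_face (hk : D.rest k ≠ []) (hj : j ≤ (D.rest k).length) :
    (D.face k j).degree + 1 = D.degree := by
  obtain ⟨R, t, v, ht, hR, hF, h⟩ := exists_eq_insertRest (s := (k, j)) hk hj
  have := congrArg Multiset.card (sum_insertRest R t ht v)
  simp only [Multiset.card_sum, Multiset.coe_card, Multiset.card_cons] at this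
  rw [← hR] at this
  rw [degree, degree, this, ← hF]
  rfl

end

end Diagram

/-! ### Naturality of gluing in the black vertices -/

namespace Conf

variable {p q : ℕ} {V W : Type} {M : Type*} [AddCommGroup M]

/-- Gluing commutes with maps of configurations that are compatible with insertions. -/
theorem cuts_natural (g : V → W) (m : Conf p q V → Conf p q W)
    (htrack : ∀ c, (m c).track = c.track) (hlen : ∀ c, (m c).len = c.len)
    (hins : ∀ c s t v a b, m (c.insert s t v a b) = (m c).insert s t (g v) a b)
    (L : List (Seg p × V)) (φ : Conf p q W → M) (c : Conf p q V) :
    cuts (L.map fun e => (e.1, g e.2)) φ (m c) = cuts L (fun c => φ (m c)) c := by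
  induction L generalizing c with
  | nil => rfl
  | cons e L ih =>
    rw [List.map_cons, cuts_cons, cuts_cons, cutAt, cutAt, htrack]
    refine congrArg (cut _) (funext fun t => funext fun a => funext fun b => ?_)
    rw [hlen, ← hins, ih]

/-- Transport along a map of vertices. -/
def map (g : V → W) (E : Multiset (Sym2 W)) (c : Conf p q V) : Conf p q W where
  edges := E
  len := c.len
  rest k := (c.rest k).map g
  track := c.track

theorem map_insertIdx {α β : Type*} (g : α → β) (l : List α) (j : ℕ) (x : α) :
    (l.insertIdx j x).map g = (l.map g).insertIdx j (g x) := by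
  induction l generalizing j with
  | nil => cases j <;> simp
  | cons y l ih => cases j <;> simp [ih]

theorem map_insert (g : V → W) (E : Multiset (Sym2 W)) (c : Conf p q V) (s : Seg p) (t : Seg q)
    (v : V) (a b : Words q) :
    (c.insert s t v a b).map g E = (c.map g E).insert s t (g v) a b := by
  refine Conf.ext rfl rfl (funext fun k => ?_) rfl
  simp only [map, insert]
  by_cases hk : k = t.1
  · subst hk
    simp [map_insertIdx]
  · simp [hk]

theorem _root_.LoopedDiagrams.halfList_map (g : V → W) (R : Fin p → List V) :
    halfList (fun i => (R i).map g) = (halfList R).map fun e => (e.1, g e.2) := by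
  simp only [halfList, List.map_flatMap, List.map_map, List.zipIdx_map]
  rfl

theorem cuts_map (g : V → W) (E : Multiset (Sym2 W)) (R : Fin p → List V) (φ : Conf p q W → M)
    (c : Conf p q V) :
    cuts (halfList fun i => (R i).map g) φ (c.map g E) =
      cuts (halfList R) (fun c => φ (c.map g E)) c := by
  rw [halfList_map]
  exact cuts_natural g (map g E) (fun _ => rfl) (fun _ => rfl) (map_insert g E) _ φ c

end Conf

/-! ### Classes of linear combinations -/

section

variable {a b c : ℕ × ℕ}

/-- The class of a linear combination up to moves and degenerate diagrams. -/
noncomputable def toQuo (a b : ℕ × ℕ) : Chains a b →ₗ[ℤ] Quo a b := Submodule.mkQ _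

theorem toQuo_single (D : Diagram a b) (n : ℤ) : toQuo a b (Finsupp.single D n) = n • cls D := by
  rw [show Finsupp.single D n = n • Finsupp.single D (1 : ℤ) by simp, map_zsmul]
  rfl

theorem differential_single (D : Diagram a b) (n : ℤ) :
    differential a b (Finsupp.single D n) = n • D.boundary := by
  rw [differential, Finsupp.linearCombination_single]

theorem composition_single (X : Diagram a b) (Y : Diagram b c) (m n : ℤ) :
    composition a b c (Finsupp.single X m) (Finsupp.single Y n) = m • n • X.compose Y := by
  rw [composition, Finsupp.linearCombination_single, LinearMap.smul_apply,
    Finsupp.linearCombination_single]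

namespace Diagram

theorem toQuo_boundary (D : Diagram a b) : toQuo a b D.boundary =
    ∑ k, if D.rest k = [] then 0 else ∑ j ∈ Finset.range ((D.rest k).length + 1),
      (-1 : ℤ) ^ (1 + pos (fun k => (D.rest k).length) (k, j)) • cls (D.face k j) := by
  rw [boundary, map_sum]
  refine Finset.sum_congr rfl fun k _ => ?_
  split_ifs
  · exact map_zero _
  · rw [map_sum]
    refine Finset.sum_congr rfl fun j _ => ?_
    rw [toQuo_single, pos, add_assoc]

/-- The class of the diagram given by a configuration. -/
noncomputable def confCls (X : Diagram a b) (Y : Diagram b c) (C : Conf b.1 c.1 (X.V ⊕ Y.V)) :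
    Quo a c := cls (X.confDiag Y C)

theorem toQuo_compose (X : Diagram a b) (Y : Diagram b c) (hX : X.IsLooped) (hY : Y.IsLooped) :
    toQuo a c (X.compose Y) = (-1 : ℤ) ^ tri X.degree •
      Conf.cuts (halfList (X.leftRest Y)) (X.confCls Y) (X.initialConf Y) :=
  map_compose X Y hX hY (toQuo a c).toAddMonoidHom

theorem slideInv_confCls (X : Diagram a b) (Y : Diagram b c) : Conf.SlideInv (X.confCls Y) :=
  fun E E₁ E₂ _ _ _ _ hE hrest => cls_slide _ E E₁ E₂ _ _ _ _ _ _ _ _ _ _ _ hE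
    (fun _ => .refl _) hrest (fun _ => .refl _) (fun _ => .refl _) fun _ => .refl _

theorem lift_coll {p q : ℕ} (s : Seg q) (f : Seg p → Words q) (x : Words p) :
    FreeGroup.lift (fun u => coll s (f u)) x = coll s (FreeGroup.lift f x) := by
  have : FreeGroup.lift (fun u => coll s (f u)) = (coll s).comp (FreeGroup.lift f) := by
    ext u; simp
  exact DFunLike.congr_fun this x

theorem lift_lift {p q : ℕ} (s : Seg p) (f : Seg p → Words q) (x : Words p) :
    FreeGroup.lift (fun u => FreeGroup.lift f (coll s (FreeGroup.of u))) x =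
      FreeGroup.lift f (coll s x) := by
  have : FreeGroup.lift (fun u => FreeGroup.lift f (coll s (FreeGroup.of u))) =
      (FreeGroup.lift f).comp (coll s) := by
    ext u; simp
  exact DFunLike.congr_fun this x

theorem confDiag_face (X : Diagram a b) (Y : Diagram b c) (C : Conf b.1 c.1 (X.V ⊕ Y.V))
    (s : Seg c.1) : X.confDiag Y (C.face (X.glueFrame Y).start s) =
      (X.confDiag Y C).face s.1 s.2 := by
  have e : (fun i => FreeGroup.lift (fun u => coll s (C.track u)) (X.loop i)) =
      fun i => coll s (FreeGroup.lift C.track (X.loop i)) :=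
    funext fun i => lift_coll s C.track (X.loop i)
  unfold confDiag Conf.face
  simp only
  rw [e]
  rfl

theorem dOp_confCls (X : Diagram a b) (Y : Diagram b c) (C : Conf b.1 c.1 (X.V ⊕ Y.V)) :
    Conf.dOp (X.glueFrame Y).start (X.confCls Y) C = toQuo a c (X.confDiag Y C).boundary := by
  rw [toQuo_boundary, Conf.dOp]
  refine Finset.sum_congr rfl fun k _ => ?_
  change (if C.rest k = [] then 0 else _) = if C.rest k = [] then 0 else _
  split_ifs
  · rfl
  · refine Finset.sum_congr rfl fun j _ => ?_
    rw [confCls, confDiag_face]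
    rfl

theorem glueEdges_face_right (X : Diagram a b) (Y : Diagram b c) (s : Seg c.1) :
    X.glueEdges (Y.face s.1 s.2) =
      (s(Sum.inr (Y.slot s.1 s.2), Sum.inr (Y.slot s.1 (s.2 + 1))) ::ₘ X.glueEdges Y :
        Multiset (Sym2 (X.V ⊕ Y.V))) := by
  have h : ∀ (A C D : Multiset (Sym2 (X.V ⊕ Y.V))) e,
      A + (e ::ₘ Y.edges).map (Sym2.map Sum.inr) + C + D =
        e.map Sum.inr ::ₘ (A + Y.edges.map (Sym2.map Sum.inr) + C + D) := fun A C D e => by simp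
  exact h _ _ _ _

theorem glueEdges_face_left (X : Diagram a b) (Y : Diagram b c) (s : Seg b.1) :
    (X.face s.1 s.2).glueEdges Y =
      (s(Sum.inl (X.slot s.1 s.2), Sum.inl (X.slot s.1 (s.2 + 1))) ::ₘ X.glueEdges Y :
        Multiset (Sym2 (X.V ⊕ Y.V))) := by
  have h : ∀ (B C D : Multiset (Sym2 (X.V ⊕ Y.V))) e,
      (e ::ₘ X.edges).map (Sym2.map Sum.inl) + B + C + D =
        e.map Sum.inl ::ₘ (X.edges.map (Sym2.map Sum.inl) + B + C + D) := fun B C D e => by simp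
  exact h _ _ _ _

theorem initialConf_face (X : Diagram a b) (Y : Diagram b c) (s : Seg c.1) :
    (X.initialConf Y).face (X.glueFrame Y).start s = X.initialConf (Y.face s.1 s.2) := by
  have e : ∀ j, slotOf (X.glueFrame Y).start (X.initialConf Y).rest (s.1, j) =
    Sum.inr (Y.slot s.1 j) := fun j => slotOf_map Sum.inr Y.start Y.rest (s.1, j)
  refine Conf.ext ?_ (funext fun k => ?_) (funext fun k => ?_) (funext fun u => ?_)
  · simp only [Conf.face]
    rw [show slotOf _ _ s = _ from e s.2, show slotOf _ _ (up s) = _ from e (s.2 + 1)]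
    exact (glueEdges_face_right X Y s).symm
  · simp only [Conf.face, initialConf, face]
    by_cases hk : k = s.1
    · subst hk
      simp only [Function.update_self]
      split_ifs with h
      · rw [List.length_eraseIdx_of_lt h]
      · rw [List.length_dropLast]
    · simp only [Function.update_of_ne hk]
  · simp only [Conf.face, initialConf, face, faceRest]
    by_cases hk : k = s.1
    · subst hk
      simp only [Function.update_self, List.length_map]
      split_ifs
      · rw [List.eraseIdx_map]
      · rw [List.map_dropLast]
    · simp only [Function.update_of_ne hk]
  · simp only [Conf.face, initialConf, face]
    split_ifs
    · rfl
    · exact map_one _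

theorem leftRest_face (X : Diagram a b) (Y : Diagram b c) (s : Seg b.1) :
    (X.face s.1 s.2).leftRest Y = faceRest (X.leftRest Y) s := by
  funext k
  simp only [leftRest, face, faceRest]
  by_cases hk : k = s.1
  · subst hk
    simp only [Function.update_self, List.length_map]
    split_ifs
    · rw [List.eraseIdx_map]
    · rw [List.map_dropLast]
  · simp only [Function.update_of_ne hk]
    rfl

/-- It makes no difference whether the edge created by a face of `X` is present during the gluing or
added afterwards, and the collapse of loops of `X` may be absorbed in the substituted words. -/
theorem cuts_faceFun (X : Diagram a b) (Y : Diagram b c) (s : Seg b.1)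
    (L : List (Seg b.1 × (X.V ⊕ Y.V))) :
    Conf.cuts L (Conf.faceFun (X.glueFrame Y).base (X.leftRest Y) s (X.confCls Y))
      (X.initialConf Y) =
    Conf.cuts L ((X.face s.1 s.2).confCls Y) ((X.face s.1 s.2).initialConf Y) := by
  have e : ∀ j, slotOf (X.glueFrame Y).base (X.leftRest Y) (s.1, j) = Sum.inl (X.slot s.1 j) :=
    fun j => slotOf_map Sum.inl X.start X.rest (s.1, j)
  have h1 : (X.face s.1 s.2).initialConf Y =
      { X.initialConf Y with
        edges := s(slotOf (X.glueFrame Y).base (X.leftRest Y) s,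
          slotOf (X.glueFrame Y).base (X.leftRest Y) (up s)) ::ₘ (X.initialConf Y).edges } := by
    refine Conf.ext ?_ rfl rfl rfl
    refine (glueEdges_face_left X Y s).trans ?_
    rw [← e s.2, ← e (s.2 + 1)]
    rfl
  have h2 := Conf.cuts_natural (id : X.V ⊕ Y.V → X.V ⊕ Y.V) (fun C : Conf b.1 c.1 (X.V ⊕ Y.V) =>
    { C with edges := s(slotOf (X.glueFrame Y).base (X.leftRest Y) s,
          slotOf (X.glueFrame Y).base (X.leftRest Y) (up s)) ::ₘ C.edges })
    (fun _ => rfl) (fun _ => rfl) (fun _ _ _ _ _ _ => rfl) L ((X.face s.1 s.2).confCls Y)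
    (X.initialConf Y)
  rw [h1]
  simp only [id_eq, Prod.mk.eta, List.map_id_fun'] at h2
  refine Eq.trans ?_ h2.symm
  refine congrArg (fun φ => Conf.cuts L φ (X.initialConf Y)) (funext fun C => ?_)
  have h3 : (fun i => FreeGroup.lift
      (fun u => FreeGroup.lift C.track (coll s (FreeGroup.of u))) (X.loop i)) =
      fun i => FreeGroup.lift C.track (coll s (X.loop i)) :=
    funext fun i => lift_lift s C.track (X.loop i)
  unfold Conf.faceFun confCls confDiag
  simp only
  rw [h3]
  rfl

/-- Composition is a chain map. -/
theorem toQuo_differential_compose (X : Diagram a b) (Y : Diagram b c) (hX : X.IsLooped)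
    (hY : Y.IsLooped) :
    toQuo a c (differential a c (X.compose Y)) =
      toQuo a c (composition a b c X.boundary (Finsupp.single Y 1)) +
        (-1 : ℤ) ^ X.degree • toQuo a c (composition a b c (Finsupp.single X 1) Y.boundary) := by
  have hn : (halfList (X.leftRest Y)).length = X.degree := by
    rw [length_halfList]; simp [leftRest, degree]
  have h1 := map_compose X Y hX hY ((toQuo a c).comp (differential a c)).toAddMonoidHom
  have h2 : (fun C => ((toQuo a c).comp (differential a c)).toAddMonoidHom
      (Finsupp.single (X.confDiag Y C) 1)) =
      Conf.dOp (X.glueFrame Y).start (X.confCls Y) := by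
    funext C
    rw [dOp_confCls]
    change toQuo a c (differential a c (Finsupp.single (X.confDiag Y C) 1)) = _
    rw [differential_single, one_smul]
  rw [h2, Conf.cuts_dOp (X.glueFrame Y) (X.leftRest Y) (slideInv_confCls X Y)
    (initialConf_good X hY), hn, smul_add] at h1
  refine Eq.trans h1 ?_
  rw [add_comm]
  congr 1
  · rw [boundary, map_sum, LinearMap.sum_apply, map_sum, Finset.smul_sum]
    refine Finset.sum_congr rfl fun k _ => ?_
    by_cases hk : X.rest k = []
    · have : X.leftRest Y k = [] := by simp [leftRest, hk]
      rw [if_pos hk, if_pos this]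
      simp
    · have : X.leftRest Y k ≠ [] := by simp [leftRest, hk]
      rw [if_neg hk, if_neg this, map_sum, LinearMap.sum_apply, map_sum, Finset.smul_sum]
      have hl : ∀ k, (X.leftRest Y k).length = (X.rest k).length := by simp [leftRest]
      rw [hl]
      refine Finset.sum_congr rfl fun j hj => ?_
      have hj' : j ≤ (X.rest k).length := by simpa [Nat.lt_succ_iff] using hj
      -- The face of `X` has one half-edge less; `tri (n + 1) = tri n + n` accounts for the change
      -- of the global sign.
      rw [composition_single, one_smul, map_zsmul,
        toQuo_compose _ _ (face_isLooped hk hj' hX) hY, cuts_faceFun, leftRest_face X Y (k, j),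
        smul_smul, smul_smul, ← degree_face hk hj', tri_succ]
      congr 1
      simp only [hl, pos]
      rw [← pow_add, ← pow_add]
      apply neg_one_pow_congr
      simp only [Nat.even_iff]
      omega
  · rw [boundary, map_sum, map_sum, Conf.dOp, Finset.smul_sum, Finset.smul_sum, Finset.smul_sum]
    refine Finset.sum_congr rfl fun k _ => ?_
    by_cases hk : Y.rest k = []
    · have : (X.initialConf Y).rest k = [] := by simp [initialConf, hk]
      rw [if_pos hk, if_pos this]
      simp
    · have : (X.initialConf Y).rest k ≠ [] := by simp [initialConf, hk]
      have hl : ∀ k, ((X.initialConf Y).rest k).length = (Y.rest k).length := by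
        simp [initialConf]
      rw [if_neg hk, if_neg this, map_sum, map_sum, Finset.smul_sum, Finset.smul_sum,
        Finset.smul_sum, hl]
      refine Finset.sum_congr rfl fun j hj => ?_
      have hj' : j ≤ (Y.rest k).length := by simpa [Nat.lt_succ_iff] using hj
      rw [composition_single, one_smul, map_zsmul,
        toQuo_compose _ _ hX (face_isLooped hk hj' hY), initialConf_face]
      simp only [hl, smul_smul]
      congr 1
      simp only [pos]
      ring

end Diagram

end

namespace Diagram

variable {a b c : ℕ × ℕ}

/-! ### Composition and moves -/

/-- A map of black vertices transports the gluings of one pair of diagrams to those of another, so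
it suffices to compare the results of single gluings. -/
theorem toQuo_compose_congr {X X' : Diagram a b} {Y Y' : Diagram b c} (hX : X.IsLooped)
    (hX' : X'.IsLooped) (hY : Y.IsLooped) (hY' : Y'.IsLooped) (g : X.V ⊕ Y.V → X'.V ⊕ Y'.V)
    (hdeg : X.degree = X'.degree) (h1 : X'.leftRest Y' = fun i => (X.leftRest Y i).map g)
    (h2 : X'.initialConf Y' = (X.initialConf Y).map g (X'.glueEdges Y'))
    (h3 : ∀ C, C.edges = X.glueEdges Y →
      X.confCls Y C = X'.confCls Y' (C.map g (X'.glueEdges Y'))) :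
    toQuo a c (X.compose Y) = toQuo a c (X'.compose Y') := by
  rw [toQuo_compose X Y hX hY, toQuo_compose X' Y' hX' hY', hdeg, h1, h2, Conf.cuts_map]
  congr 1
  exact Conf.cuts_congr_good (fun C hC => h3 C hC.edges_eq) (initialConf_good X hY)

/-- The edges of a gluing when the edges of one of the two diagrams are replaced. -/
def glueEdgesWith (X : Diagram a b) (Y : Diagram b c) (E : Multiset (Sym2 X.V))
    (E' : Multiset (Sym2 Y.V)) : Multiset (Sym2 (X.V ⊕ Y.V)) :=
  E.map (Sym2.map Sum.inl) + E'.map (Sym2.map Sum.inr) +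
    (Finset.univ.val.map fun i => s(Sum.inl (X.start i), Sum.inr (Y.loopLeaf i))) +
    (Finset.univ.val.map fun i => s(Sum.inl (X.outLeaf i), Sum.inr (Y.inLeaf i)))

theorem glueEdges_push_left (X : Diagram a b) (Y : Diagram b c) (W : Type) (hW : Finite W)
    (f : X.V → W) (E : Multiset (Sym2 X.V)) :
    (X.push W hW f E).glueEdges Y =
      (X.glueEdgesWith Y E Y.edges).map (Sym2.map (Sum.map f id)) := by
  simp only [glueEdgesWith, Multiset.map_add, Multiset.map_map, Function.comp_apply,
    Sym2.map_map, Sym2.map_mk, Sum.map_inl, Sum.map_inr, id]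
  change (E.map (Sym2.map f)).map (Sym2.map Sum.inl) + _ + _ + _ = _
  rw [Multiset.map_map]
  simp only [Function.comp_def, Sym2.map_map, Sum.map_inl, Sum.map_inr, id]
  rfl

theorem glueEdges_push_right (X : Diagram a b) (Y : Diagram b c) (W : Type) (hW : Finite W)
    (f : Y.V → W) (E : Multiset (Sym2 Y.V)) :
    X.glueEdges (Y.push W hW f E) =
      (X.glueEdgesWith Y X.edges E).map (Sym2.map (Sum.map id f)) := by
  simp only [glueEdgesWith, Multiset.map_add, Multiset.map_map, Function.comp_apply,
    Sym2.map_map, Sym2.map_mk, Sum.map_inl, Sum.map_inr, id]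
  change _ + (E.map (Sym2.map f)).map (Sym2.map Sum.inr) + _ + _ = _
  rw [Multiset.map_map]
  simp only [Function.comp_def, Sym2.map_map, Sum.map_inl, Sum.map_inr, id]
  rfl

theorem degree_push (D : Diagram a b) (W : Type) (hW : Finite W) (f : D.V → W)
    (E : Multiset (Sym2 D.V)) : (D.push W hW f E).degree = D.degree := by
  simp [degree, push]

theorem confDiag_push_left (X : Diagram a b) (Y : Diagram b c) (W : Type) (hW : Finite W)
    (f : X.V → W) (E : Multiset (Sym2 X.V)) (C : Conf b.1 c.1 (X.V ⊕ Y.V)) :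
    (X.push W hW f E).confDiag Y (C.map (Sum.map f id) ((X.push W hW f E).glueEdges Y)) =
      (X.confDiag Y C).push (W ⊕ Y.V) (((X.push W hW f E).confDiag Y
        (C.map (Sum.map f id) 0)).finite) (Sum.map f id) (X.glueEdgesWith Y E Y.edges) := by
  rw [glueEdges_push_left]
  rfl

theorem confDiag_push_right (X : Diagram a b) (Y : Diagram b c) (W : Type) (hW : Finite W)
    (f : Y.V → W) (E : Multiset (Sym2 Y.V)) (C : Conf b.1 c.1 (X.V ⊕ Y.V)) :
    X.confDiag (Y.push W hW f E) (C.map (Sum.map id f) (X.glueEdges (Y.push W hW f E))) =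
      (X.confDiag Y C).push (X.V ⊕ W) ((X.confDiag (Y.push W hW f E)
        (C.map (Sum.map id f) 0)).finite) (Sum.map id f) (X.glueEdgesWith Y X.edges E) := by
  rw [glueEdges_push_right]
  rfl

theorem sumMap_id_eq_iff {A B W : Type} {f : A → W} {u v : A}
    (hf : ∀ x y, f x = f y ↔ x = y ∨ s(x, y) = s(u, v)) (x y : A ⊕ B) :
    Sum.map f id x = Sum.map f id y ↔ x = y ∨ s(x, y) = s(Sum.inl u, Sum.inl v) := by
  rcases x with x | x <;> rcases y with y | y <;> simp [hf]

theorem id_sumMap_eq_iff {A B W : Type} {f : A → W} {u v : A}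
    (hf : ∀ x y, f x = f y ↔ x = y ∨ s(x, y) = s(u, v)) (x y : B ⊕ A) :
    Sum.map id f x = Sum.map id f y ↔ x = y ∨ s(x, y) = s(Sum.inr u, Sum.inr v) := by
  rcases x with x | x <;> rcases y with y | y <;> simp [hf]

theorem glueEdges_cons_left (X : Diagram a b) (Y : Diagram b c) {u v : X.V}
    {E : Multiset (Sym2 X.V)} (hE : X.edges = s(u, v) ::ₘ E) :
    X.glueEdges Y = s(Sum.inl u, Sum.inl v) ::ₘ X.glueEdgesWith Y E Y.edges := by
  rw [glueEdges, hE, glueEdgesWith]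
  simp

theorem glueEdges_cons_right (X : Diagram a b) (Y : Diagram b c) {u v : Y.V}
    {E : Multiset (Sym2 Y.V)} (hE : Y.edges = s(u, v) ::ₘ E) :
    X.glueEdges Y = s(Sum.inr u, Sum.inr v) ::ₘ X.glueEdgesWith Y X.edges E := by
  rw [glueEdges, hE, glueEdgesWith]
  simp

/-- A move of a factor induces a move of the same kind on every diagram in the composite, as the
gluing keeps the edges of both factors. -/
theorem toQuo_compose_move_left {X X' : Diagram a b} (h : X.Move X') (hX : X.IsLooped)
    (hX' : X'.IsLooped) {Y : Diagram b c} (hY : Y.IsLooped) :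
    toQuo a c (X.compose Y) = toQuo a c (X'.compose Y) := by
  cases h with
  | relabel W hW e =>
    refine toQuo_compose_congr hX hX' hY hY (Sum.map e id) (degree_push ..).symm ?_ ?_ ?_
    · funext i; simp [leftRest, push]
    · refine Conf.ext rfl ?_ ?_ ?_ <;> funext k <;> simp [initialConf, Conf.map, push]
    · intro C hC
      rw [confCls, confCls, confDiag_push_left]
      have h := Move.relabel (X.confDiag Y C) (W ⊕ Y.V) (((X.push W hW e X.edges).confDiag Y
        (C.map (Sum.map e id) 0)).finite) (e.sumCongr (Equiv.refl Y.V))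
      have h' : (X.confDiag Y C).edges = X.glueEdgesWith Y X.edges Y.edges := hC
      rw [h'] at h
      exact cls_move h
  | contract u v huv E hE W hW f hf hfuv =>
    refine toQuo_compose_congr hX hX' hY hY (Sum.map f id) (degree_push ..).symm ?_ ?_ ?_
    · funext i; simp [leftRest, push]
    · refine Conf.ext rfl ?_ ?_ ?_ <;> funext k <;> simp [initialConf, Conf.map, push]
    · intro C hC
      rw [confCls, confCls, confDiag_push_left]
      exact cls_move (Move.contract (X.confDiag Y C) (Sum.inl u) (Sum.inl v)
        (fun h => huv (Sum.inl_injective h)) _ (hC.trans (glueEdges_cons_left X Y hE)) _ _ _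
        (hf.sumMap Function.surjective_id) (sumMap_id_eq_iff hfuv))

theorem toQuo_compose_move_right {X : Diagram a b} (hX : X.IsLooped) {Y Y' : Diagram b c}
    (h : Y.Move Y') (hY : Y.IsLooped) (hY' : Y'.IsLooped) :
    toQuo a c (X.compose Y) = toQuo a c (X.compose Y') := by
  cases h with
  | relabel W hW e =>
    refine toQuo_compose_congr hX hX hY hY' (Sum.map id e) rfl ?_ ?_ ?_
    · funext i
      exact (List.map_map (f := Sum.inl) (g := Sum.map id _) (l := X.rest i)).symm
    · refine Conf.ext rfl ?_ ?_ ?_ <;> funext k <;> simp [initialConf, Conf.map, push]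
    · intro C hC
      rw [confCls, confCls, confDiag_push_right]
      have h := Move.relabel (X.confDiag Y C) (X.V ⊕ W) ((X.confDiag (Y.push W hW e Y.edges)
        (C.map (Sum.map id e) 0)).finite) ((Equiv.refl X.V).sumCongr e)
      have h' : (X.confDiag Y C).edges = X.glueEdgesWith Y X.edges Y.edges := hC
      rw [h'] at h
      exact cls_move h
  | contract u v huv E hE W hW f hf hfuv =>
    refine toQuo_compose_congr hX hX hY hY' (Sum.map id f) rfl ?_ ?_ ?_
    · funext i
      exact (List.map_map (f := Sum.inl) (g := Sum.map id _) (l := X.rest i)).symm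
    · refine Conf.ext rfl ?_ ?_ ?_ <;> funext k <;> simp [initialConf, Conf.map, push]
    · intro C hC
      rw [confCls, confCls, confDiag_push_right]
      exact cls_move (Move.contract (X.confDiag Y C) (Sum.inr u) (Sum.inr v)
        (fun h => huv (Sum.inr_injective h)) _ (hC.trans (glueEdges_cons_right X Y hE)) _ _ _
        (Function.surjective_id.sumMap hf) (id_sumMap_eq_iff hfuv))

/-! ### Composition and degenerate diagrams -/

/-- Nothing but half-edges that are not start half-edges ends at the vertex `x`. -/
structure Bare (D : Diagram a b) (x : D.V) : Prop where
  edges : ∀ e ∈ D.edges, x ∉ e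
  start : ∀ k, D.start k ≠ x
  loopLeaf : ∀ i, D.loopLeaf i ≠ x
  inLeaf : ∀ i, D.inLeaf i ≠ x
  outLeaf : ∀ i, D.outLeaf i ≠ x

-- Degeneracy depends only on the multiset of all non-start half-edges, not on their positions. This
-- is the part of a configuration that `Conf.Good.total` controls.
open Classical in
theorem degenerate_iff_count (D : Diagram a b) : D.Degenerate ↔
    ∃ x, D.Bare x ∧ Multiset.count x (∑ k, (D.rest k : Multiset D.V)) = 1 := by
  have hcount : ∀ x, Multiset.count x (∑ k, (D.rest k : Multiset D.V)) =
      ∑ k, (D.rest k).count x := fun x => by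
    rw [Multiset.count_sum']
    simp only [Multiset.coe_count]
  constructor
  · rintro ⟨k, t, ht, h1, h2, h3, h4, h5, h6⟩
    refine ⟨_, ⟨h1, h2, h4, h5, h6⟩, ?_⟩
    rw [hcount, Finset.sum_eq_single k]
    · refine le_antisymm ?_ (List.one_le_count_iff.2 (List.getElem_mem ht))
      by_contra h
      obtain ⟨n, m, hnm, e1, e2⟩ := List.duplicate_iff_exists_distinct_get.1
        (List.duplicate_iff_two_le_count.2 (Nat.lt_of_not_le h))
      have e3 := (h3 k n n.2 e1.symm).2
      have e4 := (h3 k m m.2 e2.symm).2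
      exact absurd hnm (by rw [Fin.lt_def]; omega)
    · intro k' _ hk
      rw [List.count_eq_zero]
      intro h
      obtain ⟨t', ht', e⟩ := List.mem_iff_getElem.1 h
      exact hk (h3 k' t' ht' e).1
    · simp
  · rintro ⟨x, hx, h⟩
    rw [hcount] at h
    obtain ⟨k, hk, hk'⟩ : ∃ k, (D.rest k).count x = 1 ∧ ∀ k', k' ≠ k → (D.rest k').count x = 0 := by
      obtain ⟨k, _, hk⟩ := Finset.exists_ne_zero_of_sum_ne_zero (h.trans_ne one_ne_zero)
      have := Finset.add_sum_erase Finset.univ (fun k => (D.rest k).count x) (Finset.mem_univ k)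
      refine ⟨k, by omega, fun k' hk' => ?_⟩
      have h0 : ∑ i ∈ Finset.univ.erase k, (D.rest i).count x = 0 := by omega
      exact Finset.sum_eq_zero_iff.1 h0 k' (Finset.mem_erase.2 ⟨hk', Finset.mem_univ _⟩)
    obtain ⟨t, ht, rfl⟩ := List.mem_iff_getElem.1 (List.one_le_count_iff.1 hk.ge)
    refine ⟨k, t, ht, hx.edges, hx.start, fun k' t' ht' e => ?_, hx.loopLeaf, hx.inLeaf,
      hx.outLeaf⟩
    obtain rfl : k' = k := by
      by_contra h
      exact List.count_eq_zero.1 (hk' k' h) (e ▸ List.getElem_mem ht')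
    refine ⟨rfl, ?_⟩
    by_contra hne
    have : List.Duplicate (D.rest k')[t] (D.rest k') := by
      rw [List.duplicate_iff_exists_distinct_get]
      rcases Nat.lt_or_gt_of_ne hne with h | h
      · exact ⟨⟨t', ht'⟩, ⟨t, ht⟩, h, e.symm, rfl⟩
      · exact ⟨⟨t, ht⟩, ⟨t', ht'⟩, h, rfl, e.symm⟩
    have := List.duplicate_iff_two_le_count.1 this
    omega

theorem inl_notMem_glueEdges {X : Diagram a b} {x : X.V} (hx : X.Bare x) (Y : Diagram b c) :
    ∀ e ∈ X.glueEdges Y, (Sum.inl x : X.V ⊕ Y.V) ∉ e := by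
  simp only [glueEdges, Multiset.mem_add, Multiset.mem_map]
  rintro e (((⟨e, he, rfl⟩ | ⟨e, he, rfl⟩) | ⟨i, _, rfl⟩) | ⟨i, _, rfl⟩)
  · simpa [Sym2.mem_map] using hx.edges e he
  · simp [Sym2.mem_map]
  · simpa using (hx.start i).symm
  · simpa using (hx.outLeaf i).symm

theorem inr_notMem_glueEdges (X : Diagram a b) {Y : Diagram b c} {y : Y.V} (hy : Y.Bare y) :
    ∀ e ∈ X.glueEdges Y, (Sum.inr y : X.V ⊕ Y.V) ∉ e := by
  simp only [glueEdges, Multiset.mem_add, Multiset.mem_map]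
  rintro e (((⟨e, he, rfl⟩ | ⟨e, he, rfl⟩) | ⟨i, _, rfl⟩) | ⟨i, _, rfl⟩)
  · simp [Sym2.mem_map]
  · simpa [Sym2.mem_map] using hy.edges e he
  · simpa using (hy.loopLeaf i).symm
  · simpa using (hy.inLeaf i).symm

theorem degenerate_iff (D : Diagram a b) : D.Degenerate ↔
    ∃ x S, D.Bare x ∧ ∑ k, (D.rest k : Multiset D.V) = x ::ₘ S ∧ x ∉ S := by
  classical
  rw [degenerate_iff_count]
  constructor
  · rintro ⟨x, hx, h⟩
    refine ⟨x, _, hx, (Multiset.cons_erase (Multiset.one_le_count_iff_mem.1 h.ge)).symm, ?_⟩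
    rw [← Multiset.count_eq_zero, Multiset.count_erase_self, h]
  · rintro ⟨x, S, hx, h, hS⟩
    exact ⟨x, hx, by rw [h, Multiset.count_cons_self, Multiset.count_eq_zero_of_notMem hS]⟩

theorem sum_coe_map {A B ι : Type*} [Fintype ι] (f : A → B) (R : ι → List A) :
    ∑ i, ((R i).map f : Multiset B) = (∑ i, (R i : Multiset A)).map f :=
  (map_sum (Multiset.mapAddMonoidHom f) (fun i => (R i : Multiset A)) Finset.univ).symm

/-- Gluing moves the half-edges of `X` to other white vertices without adding an end at the black
vertex `x`, so every term is again degenerate. -/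
theorem toQuo_compose_degenerate_left {X : Diagram a b} (h : X.Degenerate) (hX : X.IsLooped)
    {Y : Diagram b c} (hY : Y.IsLooped) : toQuo a c (X.compose Y) = 0 := by
  obtain ⟨x, S, hx, hS, hxS⟩ := X.degenerate_iff.1 h
  rw [toQuo_compose X Y hX hY, Conf.cuts_congr_good (φ' := 0) (fun C hC => ?_)
    (initialConf_good X hY)]
  · rw [map_zero, Pi.zero_apply, smul_zero]
  · refine cls_degenerate ((degenerate_iff _).2 ⟨Sum.inl x, (∑ k, (Y.rest k : Multiset Y.V)).map
      Sum.inr + S.map Sum.inl, ⟨fun e he => ?_, fun k h => ?_, fun k h => ?_, fun k h => ?_,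
      fun k h => ?_⟩, ?_, ?_⟩)
    · exact inl_notMem_glueEdges hx Y e (by
        have h : e ∈ C.edges := he
        rwa [hC.edges_eq] at h)
    · exact Sum.inr_ne_inl h
    · exact hx.loopLeaf k (Sum.inl_injective h)
    · exact hx.inLeaf k (Sum.inl_injective h)
    · exact Sum.inr_ne_inl h
    · refine hC.total.trans ?_
      simp only [glueFrame, leftRest, sum_coe_map, hS, Multiset.map_cons, Multiset.add_cons]
      rfl
    · intro h
      rcases Multiset.mem_add.1 h with h | h
      · obtain ⟨y, _, hy⟩ := Multiset.mem_map.1 h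
        exact Sum.inr_ne_inl hy
      · obtain ⟨y, h, hy⟩ := Multiset.mem_map.1 h
        exact hxS (Sum.inl_injective hy ▸ h)

theorem toQuo_compose_degenerate_right {X : Diagram a b} (hX : X.IsLooped)
    {Y : Diagram b c} (h : Y.Degenerate) (hY : Y.IsLooped) : toQuo a c (X.compose Y) = 0 := by
  obtain ⟨x, S, hx, hS, hxS⟩ := Y.degenerate_iff.1 h
  rw [toQuo_compose X Y hX hY, Conf.cuts_congr_good (φ' := 0) (fun C hC => ?_)
    (initialConf_good X hY)]
  · rw [map_zero, Pi.zero_apply, smul_zero]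
  · refine cls_degenerate ((degenerate_iff _).2 ⟨Sum.inr x, S.map Sum.inr +
      (∑ k, (X.rest k : Multiset X.V)).map Sum.inl, ⟨fun e he => ?_, fun k h => ?_, fun k h => ?_,
      fun k h => ?_, fun k h => ?_⟩, ?_, ?_⟩)
    · exact inr_notMem_glueEdges X hx e (by
        have h : e ∈ C.edges := he
        rwa [hC.edges_eq] at h)
    · exact hx.start k (Sum.inr_injective h)
    · exact Sum.inl_ne_inr h
    · exact Sum.inl_ne_inr h
    · exact hx.outLeaf k (Sum.inr_injective h)
    · refine hC.total.trans ?_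
      simp only [glueFrame, leftRest, sum_coe_map, hS, Multiset.map_cons, Multiset.cons_add]
      rfl
    · intro h
      rcases Multiset.mem_add.1 h with h | h
      · obtain ⟨y, h, hy⟩ := Multiset.mem_map.1 h
        exact hxS (Sum.inr_injective hy ▸ h)
      · obtain ⟨y, _, hy⟩ := Multiset.mem_map.1 h
        exact Sum.inl_ne_inr hy

end Diagram

namespace Diagram

variable {a b c : ℕ × ℕ}

/-! ### The differential and moves -/

theorem face_push (D : Diagram a b) (W : Type) (hW : Finite W) (f : D.V → W)
    (E : Multiset (Sym2 D.V)) (k : Fin b.1) (j : ℕ) :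
    (D.push W hW f E).face k j =
      (D.face k j).push W hW f (s(D.slot k j, D.slot k (j + 1)) ::ₘ E) := by
  have e : ∀ i, (D.push W hW f E).slot k i = f (D.slot k i) := fun i =>
    slotOf_map f D.start D.rest (k, i)
  have h1 : (s((D.push W hW f E).slot k j, (D.push W hW f E).slot k (j + 1)) ::ₘ
      E.map (Sym2.map f) : Multiset (Sym2 W)) =
      (s(D.slot k j, D.slot k (j + 1)) ::ₘ E).map (Sym2.map f) := by
    rw [e, e]
    simp
  have h2 : Function.update (fun i => (D.rest i).map f) k
      (if j < ((D.rest k).map f).length then ((D.rest k).map f).eraseIdx j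
        else ((D.rest k).map f).dropLast) =
      fun i => (Function.update D.rest k (if j < (D.rest k).length then (D.rest k).eraseIdx j
        else (D.rest k).dropLast) i).map f := by
    funext i
    by_cases hi : i = k
    · subst hi
      simp only [Function.update_self, List.length_map]
      split_ifs
      · rw [List.eraseIdx_map]
      · rw [List.map_dropLast]
    · simp only [Function.update_of_ne hi]
  exact (Diagram.mk.injEq ..).mpr ⟨rfl, h1 ▸ HEq.rfl, HEq.rfl, h2 ▸ HEq.rfl, HEq.rfl, HEq.rfl,
    HEq.rfl, rfl⟩

theorem toQuo_boundary_congr {D D' : Diagram a b}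
    (h : ∀ k, (D'.rest k).length = (D.rest k).length)
    (h' : ∀ k j, cls (D.face k j) = cls (D'.face k j)) :
    toQuo a b D.boundary = toQuo a b D'.boundary := by
  rw [toQuo_boundary, toQuo_boundary]
  refine Finset.sum_congr rfl fun k _ => ?_
  have e : D'.rest k = [] ↔ D.rest k = [] := by
    rw [← List.length_eq_zero_iff, ← List.length_eq_zero_iff, h]
  simp only [h, h', e]

theorem toQuo_boundary_move {D D' : Diagram a b} (h : D.Move D') :
    toQuo a b D.boundary = toQuo a b D'.boundary := by
  cases h with
  | relabel W hW e =>
    refine toQuo_boundary_congr (fun k => by simp [push]) fun k j => ?_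
    rw [face_push]
    exact cls_move (Move.relabel (D.face k j) W hW e)
  | contract u v huv E hE W hW f hf hfuv =>
    refine toQuo_boundary_congr (fun k => by simp [push]) fun k j => ?_
    rw [face_push]
    refine cls_move (Move.contract (D.face k j) u v huv _ ?_ W hW f hf hfuv)
    simp only [face, hE]
    exact Multiset.cons_swap ..

/-! ### The square of the differential -/

theorem eraseIdx_eraseIdx {α : Type*} (l : List α) {i j : ℕ} (h : i ≤ j) :
    (l.eraseIdx i).eraseIdx j = (l.eraseIdx (j + 1)).eraseIdx i := by
  induction l generalizing i j with
  | nil => simp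
  | cons x l ih =>
    cases i with
    | zero => simp
    | succ i =>
      obtain ⟨j, rfl⟩ := Nat.exists_eq_succ_of_ne_zero (by omega : j ≠ 0)
      simp [ih (by omega : i ≤ j)]

theorem faceRest_faceRest {q : ℕ} {V : Type} (rest : Fin q → List V) {s t : Seg q} (h : s ≠ t)
    (hs : s.2 ≤ (rest s.1).length) (ht : t.2 ≤ (rest t.1).length)
    (hst : s.1 = t.1 → 2 ≤ (rest s.1).length) :
    faceRest (faceRest rest s) (old s t) = faceRest (faceRest rest t) (old t s) := by
  -- By symmetry `s` comes first if both lie on the same circle; then collapsing `t` does not rename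
  -- `s`.
  wlog hlt : s.1 = t.1 → s.2 < t.2 generalizing s t
  · refine (this h.symm ht hs (fun e => e ▸ hst e.symm) fun e => ?_).symm
    by_contra h'
    exact hlt fun e' => lt_of_le_of_ne (not_lt.1 h') fun e'' => h (Prod.ext e' e'')
  have e1 : old t s = s := by
    rcases s with ⟨k, j⟩; rcases t with ⟨k', j'⟩
    simp only at hlt
    grind [old]
  rw [e1]
  rcases s with ⟨k, i⟩; rcases t with ⟨k', j⟩
  simp only at hs ht hst hlt
  by_cases hk : k = k'
  · subst hk
    have hij := hlt rfl
    have hl := hst rfl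
    have e2 : old (k, i) (k, j) = (k, j - 1) := by simp [old, hij]
    rw [e2]
    simp only [faceRest_eq_eraseIdx, Function.update_self, Function.update_idem]
    rw [List.length_eraseIdx_of_lt (by omega), List.length_eraseIdx_of_lt (by omega)]
    congr 1
    have h3 : min j ((rest k).length - 1) = min (j - 1) ((rest k).length - 2) + 1 := by omega
    rw [h3, Nat.sub_sub]
    by_cases hi : i ≤ (rest k).length - 2
    · rw [min_eq_left (by omega : i ≤ (rest k).length - 1), min_eq_left hi]
      exact eraseIdx_eraseIdx _ (by omega)
    · rw [min_eq_right (by omega : (rest k).length - 1 ≤ i), min_eq_right (by omega),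
        min_eq_right (by omega), show (rest k).length - 2 + 1 = (rest k).length - 1 by omega]
  · have e2 : old (k, i) (k', j) = (k', j) := by simp [old, hk]
    rw [e2]
    simp only [faceRest_eq_eraseIdx, Function.update_of_ne hk, Function.update_of_ne (Ne.symm hk)]
    rw [Function.update_comm hk]

theorem old_comm {q : ℕ} {s t u : Seg q} (hs : u ≠ s) (ht : u ≠ t) (h : s ≠ t) :
    old (old s t) (old s u) = old (old t s) (old t u) ∧ old s u ≠ old s t := by
  rcases s with ⟨k, j⟩; rcases t with ⟨k', j'⟩; rcases u with ⟨k'', j''⟩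
  grind (splits := 40) [old]

theorem coll_coll {q : ℕ} {s t : Seg q} (h : s ≠ t) (x : Words q) :
    coll (old s t) (coll s x) = coll (old t s) (coll t x) := by
  suffices h : (coll (old s t)).comp (coll s) = (coll (old t s)).comp (coll t) from
    DFunLike.congr_fun h x
  ext u
  simp only [MonoidHom.comp_apply]
  by_cases h1 : u = s
  · subst h1
    rw [coll_self, map_one, coll_ne h, coll_self]
  · by_cases h2 : u = t
    · subst h2
      rw [coll_self, map_one, coll_ne h1, coll_self]
    · have h3 := old_comm h1 h2 h
      have h4 := old_comm h2 h1 h.symm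
      rw [coll_ne h1, coll_ne h2, coll_ne h3.2, coll_ne h4.2, h3.1]

/-- The edge that is added when the ends of a segment are joined. -/
def joinEdge (D : Diagram a b) (s : Seg b.1) : Sym2 D.V := s(D.slot s.1 s.2, D.slot s.1 (s.2 + 1))

/-- The ends of `t` in the face differ from its original ends only along the edge that was added, by
`face_pathTo` for a single letter. -/
theorem joinedEdges_face {D : Diagram a b} {s t : Seg b.1} (hs : s.2 ≤ (D.rest s.1).length)
    (ht : t.2 ≤ (D.rest t.1).length) (hk : D.rest s.1 ≠ []) (h : t ≠ s) :
    JoinedEdges (D.joinEdge s ::ₘ D.edges) ((D.face s.1 s.2).joinEdge (old s t))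
      (D.joinEdge t) := by
  have h1 := face_pathTo (k := s.1) (j := s.2) hk hs t ht
  rw [show ((s.1, s.2) : Seg b.1) = s from rfl, coll_ne h] at h1
  unfold PathTo at h1
  rw [FreeGroup.toWord_of] at h1
  obtain ⟨_, h2, h3⟩ := h1
  exact ⟨_, _, _, _, rfl, rfl, Joined.symm h2, h3⟩

/-- In either order, the second edge can be slid along the first to join the original ends of its
segment. After this both diagrams carry the edges of `s` and `t`. -/
theorem cls_face_face {D : Diagram a b} {s t : Seg b.1} (hs : s.2 ≤ (D.rest s.1).length)
    (ht : t.2 ≤ (D.rest t.1).length) (hk : D.rest s.1 ≠ []) (hk' : D.rest t.1 ≠ []) (h : s ≠ t)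
    (hst : s.1 = t.1 → 2 ≤ (D.rest s.1).length) :
    cls ((D.face s.1 s.2).face (old s t).1 (old s t).2) =
      cls ((D.face t.1 t.2).face (old t s).1 (old t s).2) := by
  have key : ∀ {s t : Seg b.1}, s.2 ≤ (D.rest s.1).length → t.2 ≤ (D.rest t.1).length →
      D.rest s.1 ≠ [] → t ≠ s →
      cls ((D.face s.1 s.2).face (old s t).1 (old s t).2) =
        cls (⟨D.V, D.finite, D.joinEdge t ::ₘ D.joinEdge s ::ₘ D.edges, D.start,
          faceRest (faceRest D.rest s) (old s t), D.loopLeaf, D.inLeaf, D.outLeaf,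
          fun i => coll (old s t) (coll s (D.loop i))⟩ : Diagram a b) := by
    intro s t hs ht hk h
    refine cls_slide D.finite (D.joinEdge s ::ₘ D.edges)
      {(D.face s.1 s.2).joinEdge (old s t)} {D.joinEdge t} _ _ _ _ _ _ _ _ _ _ _ ?_
      (fun _ => .refl _) (fun _ => List.forall₂_same.2 fun x _ => .refl x)
      (fun _ => .refl _) (fun _ => .refl _) (fun _ => .refl _)
    exact Multiset.Rel.cons (joinedEdges_face hs ht hk h) Multiset.Rel.zero
  rw [key hs ht hk h.symm, key ht hs hk' h, Multiset.cons_swap, faceRest_faceRest _ h hs ht hst]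
  congr 2
  funext i
  exact coll_coll h _

/-- The segments at which the white vertices can be blown up. -/
def faceSegs {q : ℕ} {V : Type} (rest : Fin q → List V) : Finset (Seg q) :=
  Finset.univ.biUnion fun k =>
    if (rest k).length = 0 then ∅ else (Finset.range ((rest k).length + 1)).image fun j => (k, j)

theorem mem_faceSegs {q : ℕ} {V : Type} {rest : Fin q → List V} {s : Seg q} :
    s ∈ faceSegs rest ↔ (rest s.1).length ≠ 0 ∧ s.2 ≤ (rest s.1).length := by
  rcases s with ⟨k, j⟩
  simp only [faceSegs, Finset.mem_biUnion, Finset.mem_univ, true_and]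
  constructor
  · rintro ⟨k', h⟩
    split_ifs at h with h'
    · simp at h
    · obtain ⟨j', hj, e⟩ := Finset.mem_image.1 h
      obtain ⟨rfl, rfl⟩ := Prod.mk.inj e
      exact ⟨h', Nat.lt_succ_iff.1 (Finset.mem_range.1 hj)⟩
  · rintro ⟨h, h'⟩
    refine ⟨k, ?_⟩
    rw [if_neg h]
    exact Finset.mem_image.2 ⟨j, Finset.mem_range.2 (Nat.lt_succ_iff.2 h'), rfl⟩

theorem boundary_eq_sum (D : Diagram a b) : D.boundary =
    ∑ s ∈ faceSegs D.rest,
      (-1 : ℤ) ^ (1 + pos (fun k => (D.rest k).length) s) •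
        Finsupp.single (D.face s.1 s.2) 1 := by
  rw [boundary, faceSegs, Finset.sum_biUnion]
  · refine Finset.sum_congr rfl fun k _ => ?_
    by_cases h : D.rest k = []
    · simp [h]
    · have h' : (D.rest k).length ≠ 0 := fun h' => h (List.length_eq_zero_iff.1 h')
      rw [if_neg h, if_neg h', Finset.sum_image fun _ _ _ _ e => (Prod.mk.inj e).2]
      refine Finset.sum_congr rfl fun j _ => ?_
      rw [Finsupp.smul_single, smul_eq_mul, mul_one, pos, add_assoc]
  · intro k _ k' _ hk
    rw [Function.onFun, Finset.disjoint_left]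
    intro s h h'
    have e : ∀ k, (s ∈ if (D.rest k).length = 0 then ∅ else
        (Finset.range ((D.rest k).length + 1)).image fun j => (k, j)) → s.1 = k := by
      intro k h
      split_ifs at h
      · simp at h
      · obtain ⟨j, _, rfl⟩ := Finset.mem_image.1 h
        rfl
    exact hk ((e k h).symm.trans (e k' h'))

theorem toQuo_boundary_eq_sum (D : Diagram a b) : toQuo a b D.boundary =
    ∑ s ∈ faceSegs D.rest,
      (-1 : ℤ) ^ (1 + pos (fun k => (D.rest k).length) s) • cls (D.face s.1 s.2) := by
  rw [boundary_eq_sum, map_sum]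
  refine Finset.sum_congr rfl fun s _ => ?_
  rw [map_zsmul, toQuo_single, one_smul]

/-- The counterpart of `pos_swap` for deletions: the left face lowers the position of the right one
exactly when it is taken first. -/
theorem pos_old_swap {q : ℕ} {len : Fin q → ℕ} {s t : Seg q} (hs : len s.1 ≠ 0) (ht : len t.1 ≠ 0)
    (h : s ≠ t) :
    (-1 : ℤ) ^ (pos len s + pos (Function.update len s.1 (len s.1 - 1)) (old s t)) =
      -(-1) ^ (pos len t + pos (Function.update len t.1 (len t.1 - 1)) (old t s)) := by
  have h1 := Conf.pos_pred hs (old s t)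
  have h2 := Conf.pos_pred ht (old t s)
  rw [show ∀ n : ℕ, -(-1 : ℤ) ^ n = (-1) ^ (n + 1) from fun n => by rw [pow_succ]; ring]
  apply neg_one_pow_congr
  rcases s with ⟨k, j⟩; rcases t with ⟨k', j'⟩
  rcases lt_trichotomy k k' with hk | hk | hk
  · simp only [old, hk.ne, hk.ne', false_and, if_false, hk, if_true, not_lt_of_gt hk] at h1 h2 ⊢
    simp only [Nat.even_iff]; omega
  · subst hk
    have hj : j ≠ j' := fun h' => h (by rw [h'])
    simp only [pos] at h1 h2 ⊢
    by_cases h3 : j < j'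
    · simp only [old, h3, true_and, if_true, not_lt_of_gt h3, if_false, lt_irrefl] at h1 h2 ⊢
      simp only [Nat.even_iff]; omega
    · have h4 : j' < j := by omega
      simp only [old, h3, h4, true_and, if_true, if_false, lt_irrefl] at h1 h2 ⊢
      simp only [Nat.even_iff]; omega
  · simp only [old, hk.ne, hk.ne', false_and, if_false, hk, if_true, not_lt_of_gt hk] at h1 h2 ⊢
    simp only [Nat.even_iff]; omega

theorem length_face (D : Diagram a b) (s : Seg b.1) :
    (fun k => ((D.face s.1 s.2).rest k).length) =
      Function.update (fun k => (D.rest k).length) s.1 ((D.rest s.1).length - 1) := by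
  funext k
  simp only [face]
  by_cases hk : k = s.1
  · subst hk
    simp only [Function.update_self]
    split_ifs with h
    · rw [List.length_eraseIdx_of_lt h]
    · rw [List.length_dropLast]
  · simp only [Function.update_of_ne hk]

/-- The pairs of segments at which the white vertices can be blown up one after the other. -/
def facePairs {q : ℕ} {V : Type} (rest : Fin q → List V) : Finset (Seg q × Seg q) :=
  (faceSegs rest ×ˢ faceSegs rest).filter fun st =>
    st.1 ≠ st.2 ∧ (st.1.1 = st.2.1 → 2 ≤ (rest st.1.1).length)

/-- The terms are indexed by ordered pairs of distinct segments of `D`. Exchanging the two segments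
has no fixed points, preserves the class and reverses the sign. -/
theorem toQuo_differential_boundary (D : Diagram a b) :
    toQuo a b (differential a b D.boundary) = 0 := by
  have h1 : toQuo a b (differential a b D.boundary) = ∑ s ∈ faceSegs D.rest,
      (-1 : ℤ) ^ (1 + pos (fun k => (D.rest k).length) s) •
        toQuo a b (D.face s.1 s.2).boundary := by
    rw [boundary_eq_sum, map_sum, map_sum]
    refine Finset.sum_congr rfl fun s _ => ?_
    rw [map_zsmul, map_zsmul, differential_single, one_smul]
  have h2 : ∀ s ∈ faceSegs D.rest, toQuo a b (D.face s.1 s.2).boundary =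
      ∑ t ∈ (faceSegs D.rest).filter fun t => s ≠ t ∧ (s.1 = t.1 → 2 ≤ (D.rest s.1).length),
        (-1 : ℤ) ^ (1 + pos (Function.update (fun k => (D.rest k).length) s.1
          ((D.rest s.1).length - 1)) (old s t)) •
            cls ((D.face s.1 s.2).face (old s t).1 (old s t).2) := by
    intro s hs
    obtain ⟨hs1, hs2⟩ := mem_faceSegs.1 hs
    have hl : ∀ k, ((D.face s.1 s.2).rest k).length =
        if k = s.1 then (D.rest s.1).length - 1 else (D.rest k).length := fun k => by
      rw [show ((D.face s.1 s.2).rest k).length = _ from congrFun (length_face D s) k]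
      rw [Function.update_apply]
    rw [toQuo_boundary_eq_sum, length_face]
    -- Segments of the face are named by the segments of `D` other than `s`. On a segment different
    -- from `s`, `new · s` undoes the renaming `old s ·`.
    refine Finset.sum_bij' (fun t _ => new t s) (fun t _ => old s t) ?_ ?_ ?_ ?_ ?_
    · intro t ht
      rw [mem_faceSegs, hl] at ht
      rw [Finset.mem_filter, mem_faceSegs]
      rcases s with ⟨k, j⟩; rcases t with ⟨k', j'⟩
      clear h1
      simp only [new, up] at *
      grind
    · intro t ht
      rw [Finset.mem_filter, mem_faceSegs] at ht
      rw [mem_faceSegs, hl]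
      rcases s with ⟨k, j⟩; rcases t with ⟨k', j'⟩
      clear h1
      simp only [old] at *
      grind
    · intro t ht
      rcases s with ⟨k, j⟩; rcases t with ⟨k', j'⟩
      grind [old, new, up]
    · intro t ht
      rw [Finset.mem_filter] at ht
      rcases s with ⟨k, j⟩; rcases t with ⟨k', j'⟩
      grind [old, new, up]
    · intro t ht
      have : old s (new t s) = t := by
        rcases s with ⟨k, j⟩; rcases t with ⟨k', j'⟩
        grind [old, new, up]
      rw [this]
  have h3 : toQuo a b (differential a b D.boundary) = ∑ st ∈ facePairs D.rest,
      ((-1 : ℤ) ^ (1 + pos (fun k => (D.rest k).length) st.1) *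
        (-1 : ℤ) ^ (1 + pos (Function.update (fun k => (D.rest k).length) st.1.1
          ((D.rest st.1.1).length - 1)) (old st.1 st.2))) •
            cls ((D.face st.1.1 st.1.2).face (old st.1 st.2).1 (old st.1 st.2).2) := by
    rw [h1, facePairs, Finset.sum_filter, Finset.sum_product]
    refine Finset.sum_congr rfl fun s hs => ?_
    rw [h2 s hs, Finset.sum_filter, Finset.smul_sum]
    refine Finset.sum_congr rfl fun t _ => ?_
    split_ifs
    · rw [smul_smul]
    · rw [smul_zero]
  rw [h3]
  refine Finset.sum_involution (fun st _ => st.swap) ?_ ?_ ?_ ?_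
  · rintro ⟨s, t⟩ h
    simp only [facePairs, Finset.mem_filter, Finset.mem_product, mem_faceSegs] at h
    obtain ⟨⟨⟨h1, h2⟩, h3, h4⟩, h5, h6⟩ := h
    have e1 : D.rest s.1 ≠ [] := fun h => h1 (by rw [h]; rfl)
    have e2 : D.rest t.1 ≠ [] := fun h => h3 (by rw [h]; rfl)
    simp only [Prod.swap]
    rw [cls_face_face h2 h4 e1 e2 h5 h6, ← add_smul]
    have e3 := pos_old_swap (len := fun k => (D.rest k).length) h1 h3 h5
    have e4 : ∀ m n : ℕ, (-1 : ℤ) ^ (1 + m) * (-1) ^ (1 + n) = (-1) ^ (m + n) := fun m n => by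
      rw [← pow_add]
      apply neg_one_pow_congr
      simp only [Nat.even_iff]; omega
    rw [e4, e4, e3, neg_add_cancel, zero_smul]
  · rintro ⟨s, t⟩ h _ e
    simp only [facePairs, Finset.mem_filter] at h
    exact h.2.1 (Prod.mk.inj e).2
  · rintro ⟨s, t⟩ h
    simp only [facePairs, Finset.mem_filter, Finset.mem_product, Prod.swap] at h ⊢
    exact ⟨⟨h.1.2, h.1.1⟩, h.2.1.symm, fun e => e ▸ h.2.2 e.symm⟩
  · rintro ⟨s, t⟩ _
    rfl

end Diagram

namespace Diagram

variable {a b c : ℕ × ℕ}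

/-! ### The differential and degenerate diagrams -/

/-- An edge to a vertex at which nothing else ends can be moved. -/
theorem cls_pendant_congr {V : Type} (hV : Finite V) {v x y : V} (hx : x ≠ v) (hy : y ≠ v)
    {E : Multiset (Sym2 V)} (hE : ∀ e ∈ E, v ∉ e) {start : Fin b.1 → V}
    (hstart : ∀ k, start k ≠ v) {rest : Fin b.1 → List V} (hrest : ∀ k, v ∉ rest k)
    {loopLeaf : Fin a.1 → V} (hloop : ∀ k, loopLeaf k ≠ v) {inLeaf : Fin a.2 → V}
    (hin : ∀ k, inLeaf k ≠ v) {outLeaf : Fin b.2 → V} (hout : ∀ k, outLeaf k ≠ v)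
    (loop : Fin a.1 → FreeGroup (Fin b.1 × ℕ)) :
    cls (⟨V, hV, s(x, v) ::ₘ E, start, rest, loopLeaf, inLeaf, outLeaf, loop⟩ : Diagram a b) =
      cls ⟨V, hV, s(y, v) ::ₘ E, start, rest, loopLeaf, inLeaf, outLeaf, loop⟩ := by
  classical
  let g : ∀ z : V, z ≠ v → V → {w : V // w ≠ v} := fun z hz w =>
    if h : w = v then ⟨z, hz⟩ else ⟨w, h⟩
  have gv : ∀ z hz, g z hz v = ⟨z, hz⟩ := fun z hz => dif_pos rfl
  have gne : ∀ z hz w (h : w ≠ v), g z hz w = ⟨w, h⟩ := fun z hz w h => dif_neg h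
  -- Contracting the edge removes `v`. As nothing else ends there, the result does not depend on
  -- `z`.
  have key : ∀ z (hz : z ≠ v), cls (⟨V, hV, s(z, v) ::ₘ E, start, rest, loopLeaf, inLeaf, outLeaf,
      loop⟩ : Diagram a b) = cls (⟨{w : V // w ≠ v}, inferInstance, E.map (Sym2.map (g z hz)),
        fun k => g z hz (start k), fun k => (rest k).map (g z hz), fun k => g z hz (loopLeaf k),
        fun k => g z hz (inLeaf k), fun k => g z hz (outLeaf k), loop⟩ : Diagram a b) := by
    intro z hz
    refine cls_move (Move.contract (⟨V, hV, s(z, v) ::ₘ E, start, rest, loopLeaf, inLeaf, outLeaf,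
      loop⟩ : Diagram a b) z v hz E rfl {w : V // w ≠ v} inferInstance (g z hz)
      (fun w => ⟨w.1, gne z hz w.1 w.2⟩) fun p q => ?_)
    simp only [Sym2.eq_iff]
    by_cases hp : p = v <;> by_cases hq : q = v
    · rw [hp, hq]; simp
    · rw [hp, gv, gne _ _ _ hq, Subtype.mk.injEq]
      constructor
      · exact fun h => Or.inr (Or.inr ⟨rfl, h.symm⟩)
      · rintro (h | ⟨h, _⟩ | ⟨_, h⟩)
        · exact absurd h.symm hq
        · exact absurd h.symm hz
        · exact h.symm
    · rw [hq, gv, gne _ _ _ hp, Subtype.mk.injEq]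
      constructor
      · exact fun h => Or.inr (Or.inl ⟨h, rfl⟩)
      · rintro (h | ⟨h, _⟩ | ⟨h, _⟩)
        · exact absurd h hp
        · exact h
        · exact absurd h hp
    · rw [gne _ _ _ hp, gne _ _ _ hq, Subtype.mk.injEq]
      constructor
      · exact Or.inl
      · rintro (h | ⟨_, h⟩ | ⟨h, _⟩)
        · exact h
        · exact absurd h hq
        · exact absurd h hp
  have hg : ∀ w, w ≠ v → g x hx w = g y hy w := fun w hw => by rw [gne _ _ _ hw, gne _ _ _ hw]
  have e1 : E.map (Sym2.map (g x hx)) = E.map (Sym2.map (g y hy)) := by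
    refine Multiset.map_congr rfl fun e he => Sym2.map_congr fun w hw => hg w ?_
    rintro rfl
    exact hE e he hw
  have e2 : (fun k => (rest k).map (g x hx)) = fun k => (rest k).map (g y hy) := by
    funext k
    refine List.map_congr_left fun w hw => hg w ?_
    rintro rfl
    exact hrest k hw
  rw [key x hx, key y hy, e1, e2]
  simp only [hg _ (hstart _), hg _ (hloop _), hg _ (hin _), hg _ (hout _)]

theorem Degenerate.exists_insertRest {D : Diagram a b} (h : D.Degenerate) :
    ∃ (R : Fin b.1 → List D.V) (s : Seg b.1) (v : D.V), D.Bare v ∧ s.2 ≤ (R s.1).length ∧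
      D.rest = insertRest R s v ∧ ∀ k, v ∉ R k := by
  obtain ⟨v, S, hv, hS, hvS⟩ := D.degenerate_iff.1 h
  have hmem : v ∈ ∑ k, (D.rest k : Multiset D.V) := hS ▸ Multiset.mem_cons_self _ _
  obtain ⟨k, _, hk⟩ := Multiset.mem_sum.1 hmem
  obtain ⟨l₁, l₂, hl⟩ := List.append_of_mem (Multiset.mem_coe.1 hk)
  have h1 : (Function.update D.rest k (l₁ ++ l₂)) k = l₁ ++ l₂ := Function.update_self ..
  have h2 : l₁.length ≤ ((Function.update D.rest k (l₁ ++ l₂)) k).length := by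
    rw [h1, List.length_append]; omega
  have h3 : D.rest = insertRest (Function.update D.rest k (l₁ ++ l₂)) (k, l₁.length) v := by
    rw [insertRest, Function.update_idem, h1, insertIdx_eq_take_append v (by simp)]
    simp [← hl]
  refine ⟨Function.update D.rest k (l₁ ++ l₂), (k, l₁.length), v, hv, h2, h3, fun k' hk' => hvS ?_⟩
  have h4 := sum_insertRest (Function.update D.rest k (l₁ ++ l₂)) (k, l₁.length) h2 v
  rw [← h3, hS] at h4
  rw [(Multiset.cons_inj_right _).1 h4]
  exact Multiset.mem_sum.2 ⟨k', Finset.mem_univ _, hk'⟩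

theorem Bare.joined {D : Diagram a b} {v x y : D.V} (hv : D.Bare v) (h : D.SameArc x y) :
    x = v ↔ y = v := by
  induction h with
  | rel x y h =>
    refine iff_of_false ?_ ?_
    · rintro rfl; exact hv.edges _ h (Sym2.mem_mk_left _ _)
    · rintro rfl; exact hv.edges _ h (Sym2.mem_mk_right _ _)
  | refl x => rfl
  | symm x y _ ih => exact ih.symm
  | trans x y z _ _ ih ih' => exact ih.trans ih'

section

variable {D : Diagram a b} {R : Fin b.1 → List D.V} {s : Seg b.1} {v : D.V}

-- A path can only enter and leave the isolated vertex `v` along the two segments `s` and `up s`.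
-- Collapsing either of them therefore has the same effect, except for the part of a path that
-- starts or ends at `v`; the outer factors correct this.
open Classical in
theorem IsPath.coll_up (hv : D.Bare v) (hs : s.2 ≤ (R s.1).length)
    (hR : D.rest = insertRest R s v) (hvR : ∀ k, v ∉ R k) {x y : D.V} {w : List (Letter b.1)}
    (h : D.IsPath x w y) :
    coll (up s) (FreeGroup.mk w) = (if x = v then FreeGroup.of s else 1)⁻¹ *
      coll s (FreeGroup.mk w) * (if y = v then FreeGroup.of s else 1) := by
  have hne : ∀ u, slotOf (V := D.V) D.start R u ≠ v := by
    rintro u rfl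
    rcases List.mem_cons.1 (slotOf_mem D.start R u) with h | h
    · exact hv.start u.1 h.symm
    · exact hvR _ h
  have hof : ∀ u : Seg b.1, u.2 ≤ (D.rest u.1).length → coll (up s) (FreeGroup.of u) =
      (if D.slot u.1 u.2 = v then FreeGroup.of s else 1)⁻¹ *
        coll s (FreeGroup.of u) * (if D.slot u.1 (u.2 + 1) = v then FreeGroup.of s else 1) := by
    intro u hu
    have h1 : ∀ u : Seg b.1, D.slot u.1 u.2 = slotOf (V := D.V) D.start (insertRest R s v) u := by
      intro u; rw [← hR]; rfl
    rw [h1 u, show D.slot u.1 (u.2 + 1) = _ from h1 (up u)]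
    rw [hR] at hu
    by_cases h2 : u = s
    · have e1 : slotOf (V := D.V) D.start (insertRest R s v) s ≠ v := by
        rw [show slotOf (V := D.V) D.start (insertRest R s v) s = _ from
          slotOf_insertRest_of_le hs v le_rfl]
        exact hne _
      have e2 : slotOf (V := D.V) D.start (insertRest R s v) (up s) = v :=
        slotOf_insertRest_up hs v
      rw [h2, if_neg e1, if_pos e2, coll_self, coll_ne (ne_up s), old_up_self]
      simp
    · by_cases h3 : u = up s
      · have e1 : slotOf (V := D.V) D.start (insertRest R s v) (up (up s)) ≠ v := by
          rw [show slotOf (V := D.V) D.start (insertRest R s v) (up (up s)) = _ from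
            slotOf_insertRest_of_lt hs v (Nat.lt_succ_self _) (Nat.succ_le_succ hs)]
          exact hne _
        have e2 : slotOf (V := D.V) D.start (insertRest R s v) (up s) = v :=
          slotOf_insertRest_up hs v
        rw [h3, if_neg e1, if_pos e2, coll_self, coll_ne (up_ne s), old_up]
        simp
      · obtain ⟨h4, h5, h6⟩ := exists_shift_of_insertRest hs hu h2 h3
        have h7 := slotOf_insertRest_shift (start := D.start) hs v h5 h4
        rw [h6] at h7
        have h8 : old (up s) u = old s u := by
          rcases s with ⟨k, j⟩; rcases u with ⟨k', j'⟩
          clear hR hs h1 h7 h6 h5 hu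
          grind [old, up]
        rw [coll_ne h2, coll_ne h3, h8, h7.1, h7.2, if_neg (hne _), if_neg (hne _)]
        simp
  induction w generalizing x with
  | nil =>
    rw [← FreeGroup.one_eq_mk, map_one, map_one]
    simp only [hv.joined h]
    split_ifs <;> simp
  | cons l w ih =>
    obtain ⟨h1, h2, h3⟩ := h
    rw [mk_cons, map_mul, map_mul, ih h3]
    simp only [hv.joined h2]
    have h4 := hof l.1 h1
    rcases l with ⟨u, _ | _⟩
    · have e : FreeGroup.mk [(u, false)] = (FreeGroup.of u)⁻¹ := rfl
      rw [e, map_inv, map_inv, h4]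
      change _ = (if D.slot u.1 (u.2 + 1) = v then _ else _)⁻¹ * _ * _
      change _ * ((if D.slot u.1 u.2 = v then _ else _)⁻¹ * _ * _) = _
      group
    · have e : FreeGroup.mk [(u, true)] = FreeGroup.of u := rfl
      rw [e, h4]
      change _ = (if D.slot u.1 u.2 = v then _ else _)⁻¹ * _ * _
      change _ * ((if D.slot u.1 (u.2 + 1) = v then _ else _)⁻¹ * _ * _) = _
      group

end

theorem old_le_length_faceRest {q : ℕ} {V : Type} {R : Fin q → List V} {s t : Seg q}
    (hs : s.2 ≤ (R s.1).length) (ht : t.2 ≤ (R t.1).length) (h : t ≠ s) :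
    (old t s).2 ≤ (faceRest R t (old t s).1).length := by
  rcases s with ⟨k, i⟩; rcases t with ⟨k', j⟩
  rw [faceRest_eq_eraseIdx]
  by_cases hk : k' = k
  · subst hk
    have h0 : j ≠ i := fun e => h (by rw [e])
    have h1 : (old (k', j) (k', i)).1 = k' := by
      simp only [old]
      split_ifs <;> rfl
    simp only at hs ht
    rw [h1]
    simp only [Function.update_self]
    rw [List.length_eraseIdx_of_lt (by omega)]
    simp only [old, true_and]
    split_ifs with h2
    · simp only; omega
    · simp only; omega
  · have h1 : old (k', j) (k, i) = (k, i) := by simp [old, hk]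
    rw [h1]
    simp only [Function.update_of_ne (Ne.symm hk)]
    exact hs

/-- Faces that do not touch the unlabelled leaf `v` are again degenerate. The two faces that touch
it represent the same diagram without the leaf, and their signs are opposite. -/
theorem toQuo_boundary_degenerate {D : Diagram a b} (h : D.Degenerate) (hD : D.IsLooped) :
    toQuo a b D.boundary = 0 := by
  classical
  obtain ⟨R, s, v, hv, hs, hR, hvR⟩ := h.exists_insertRest
  have hne : ∀ u, slotOf (V := D.V) D.start R u ≠ v := by
    rintro u rfl
    rcases List.mem_cons.1 (slotOf_mem D.start R u) with h | h
    · exact hv.start u.1 h.symm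
    · exact hvR _ h
  have hslot : ∀ u : Seg b.1, D.slot u.1 u.2 = slotOf (V := D.V) D.start (insertRest R s v) u := by
    intro u; rw [← hR]; rfl
  have hls : (D.rest s.1).length = (R s.1).length + 1 := by
    rw [hR, length_insertRest hs, if_pos rfl]
  have hm : s ∈ faceSegs D.rest := mem_faceSegs.2 ⟨by omega, by omega⟩
  have hm' : up s ∈ (faceSegs D.rest).erase s :=
    Finset.mem_erase.2 ⟨up_ne s, mem_faceSegs.2 ⟨by simp only [up]; omega, by simp only [up]; omega⟩⟩
  have hother : ∀ f ∈ faceSegs D.rest, f ≠ s → f ≠ up s → cls (D.face f.1 f.2) = 0 := by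
    intro f hf h1 h2
    obtain ⟨hf1, hf2⟩ := mem_faceSegs.1 hf
    rw [hR] at hf2
    obtain ⟨h3, h4, h5⟩ := exists_shift_of_insertRest hs hf2 h1 h2
    have h6 := slotOf_insertRest_shift (start := D.start) hs v h4 h3
    have h7 := faceRest_insertRest_shift hs v h4 h3
    rw [h5] at h6 h7
    have hlen := old_le_length_faceRest hs h4 h3
    have h8 : v ∉ (s(slotOf (V := D.V) D.start R (old s f),
        slotOf (V := D.V) D.start R (up (old s f))) : Sym2 D.V) := by
      rw [Sym2.mem_iff]
      rintro (h | h)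
      · exact hne _ h.symm
      · exact hne _ h.symm
    have h9 : ∑ k, (faceRest D.rest f k : Multiset D.V) =
        v ::ₘ ∑ k, (faceRest R (old s f) k : Multiset D.V) := by
      rw [← sum_insertRest _ _ hlen, ← h7, ← hR]
    have h10 : v ∉ ∑ k, (faceRest R (old s f) k : Multiset D.V) := by
      intro h
      obtain ⟨k, _, hk⟩ := Multiset.mem_sum.1 h
      rw [Multiset.mem_coe, faceRest_eq_eraseIdx] at hk
      by_cases hkf : k = (old s f).1
      · subst hkf
        rw [Function.update_self] at hk
        exact hvR _ (List.mem_of_mem_eraseIdx hk)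
      · rw [Function.update_of_ne hkf] at hk
        exact hvR _ hk
    refine cls_degenerate ((degenerate_iff _).2 ⟨v, _,
      ⟨?_, hv.start, hv.loopLeaf, hv.inLeaf, hv.outLeaf⟩, h9, h10⟩)
    intro e he
    rcases Multiset.mem_cons.1 he with rfl | he
    · rw [hslot f, show D.slot f.1 (f.2 + 1) = _ from hslot (up f), h6.1, h6.2]
      exact h8
    · exact hv.edges e he
  have hmain : cls (D.face s.1 s.2) = cls (D.face (up s).1 (up s).2) := by
    have e1 : slotOf (V := D.V) D.start (insertRest R s v) s = slotOf (V := D.V) D.start R s :=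
      slotOf_insertRest_of_le hs v le_rfl
    have e2 : slotOf (V := D.V) D.start (insertRest R s v) (up s) = v := slotOf_insertRest_up hs v
    have e3 : slotOf (V := D.V) D.start (insertRest R s v) (up (up s)) =
        slotOf (V := D.V) D.start R (up s) :=
      slotOf_insertRest_of_lt hs v (Nat.lt_succ_self _) (Nat.succ_le_succ hs)
    have h1 : D.face s.1 s.2 = ⟨D.V, D.finite, s(slotOf (V := D.V) D.start R s, v) ::ₘ D.edges,
        D.start, R, D.loopLeaf, D.inLeaf, D.outLeaf, fun i => coll s (D.loop i)⟩ := by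
      have h2 := faceRest_insertRest_self hs v
      rw [← hR] at h2
      have h3 : (s(D.slot s.1 s.2, D.slot s.1 (s.2 + 1)) ::ₘ D.edges : Multiset (Sym2 D.V)) =
          s(slotOf (V := D.V) D.start R s, v) ::ₘ D.edges := by
        rw [hslot s, show D.slot s.1 (s.2 + 1) = _ from hslot (up s), e1, e2]
      exact (Diagram.mk.injEq ..).mpr ⟨rfl, heq_of_eq h3, HEq.rfl, heq_of_eq h2, HEq.rfl, HEq.rfl,
        HEq.rfl, rfl⟩
    have h2 : D.face (up s).1 (up s).2 = ⟨D.V, D.finite,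
        s(slotOf (V := D.V) D.start R (up s), v) ::ₘ D.edges,
        D.start, Function.update R s.1 ((R s.1).set s.2 v), D.loopLeaf, D.inLeaf, D.outLeaf,
        fun i => coll s (D.loop i)⟩ := by
      have h2 := faceRest_insertRest_up hs v
      rw [← hR] at h2
      have h3 : (s(D.slot (up s).1 (up s).2, D.slot (up s).1 ((up s).2 + 1)) ::ₘ D.edges :
          Multiset (Sym2 D.V)) = s(slotOf (V := D.V) D.start R (up s), v) ::ₘ D.edges := by
        rw [hslot (up s), show D.slot (up s).1 ((up s).2 + 1) = _ from hslot (up (up s)), e2, e3,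
          Sym2.eq_swap]
      -- The loops start and end at labelled leaves, which do not lie at `v`, so no correction
      -- occurs.
      have h4 : (fun i => coll (up s) (D.loop i)) = fun i => coll s (D.loop i) := by
        funext i
        have h5 := IsPath.coll_up hv hs hR hvR (hD i)
        rw [if_neg (hv.loopLeaf i), FreeGroup.mk_toWord] at h5
        simpa using h5
      exact (Diagram.mk.injEq ..).mpr ⟨rfl, heq_of_eq h3, HEq.rfl, heq_of_eq h2, HEq.rfl, HEq.rfl,
        HEq.rfl, h4⟩
    -- In the first diagram the pendant edge at `v` is moved to the other neighbour. Then the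
    -- following half-edge, if it is not the start half-edge, is slid along that edge to `v`.
    rw [h1, h2, cls_pendant_congr D.finite (hne s) (hne (up s)) hv.edges hv.start hvR hv.loopLeaf
      hv.inLeaf hv.outLeaf]
    have h3 := cls_slide D.finite (s(slotOf (V := D.V) D.start R (up s), v) ::ₘ D.edges) 0 0 D.start
      D.start R (Function.update R s.1 ((R s.1).set s.2 v)) D.loopLeaf D.loopLeaf D.inLeaf D.inLeaf
      D.outLeaf D.outLeaf (fun i => coll s (D.loop i)) Multiset.Rel.zero (fun _ => .refl _) ?_
      (fun _ => .refl _) (fun _ => .refl _) (fun _ => .refl _)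
    · simpa only [zero_add] using h3
    · intro k
      by_cases hk : k = s.1
      · subst hk
        rw [Function.update_self, List.forall₂_iff_get]
        refine ⟨by simp, fun i h1 h2 => ?_⟩
        simp only [List.get_eq_getElem, List.getElem_set]
        split_ifs with hi
        · subst hi
          refine .of_mem (Multiset.mem_cons.2 (Or.inl ?_))
          rw [show up s = (s.1, s.2 + 1) from rfl, slotOf_succ D.start R s.1 h1]
        · exact .refl _
      · rw [Function.update_of_ne hk]
        exact List.forall₂_same.2 fun x _ => .refl x
  rw [toQuo_boundary_eq_sum, ← Finset.add_sum_erase _ _ hm, ← Finset.add_sum_erase _ _ hm',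
    Finset.sum_eq_zero, hmain, add_zero, ← add_smul,
    show pos (fun k => (D.rest k).length) (up s) = pos (fun k => (D.rest k).length) s + 1 from rfl]
  · rw [show ∀ n : ℕ, (-1 : ℤ) ^ (1 + n) + (-1) ^ (1 + (n + 1)) = 0 from fun n => by ring, zero_smul]
  · intro f hf
    rw [Finset.mem_erase, Finset.mem_erase] at hf
    rw [hother f hf.2.2 hf.2.1 hf.1, smul_zero]

end Diagram

/-! ### Gluing twice -/

namespace Conf

variable {p q r : ℕ} {V : Type} {M : Type*} [AddCommGroup M]

/-- The configuration obtained by substituting the words of the second configuration in those of the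
first. -/
def join (c : Conf p q V) (z : Conf q r V) : Conf p r V where
  edges := z.edges
  len := z.len
  rest := z.rest
  track u := FreeGroup.lift z.track (c.track u)

/-- Gluing the half-edges of a configuration along the words of `z`. -/
def through (z : Conf q r V) (φ : Conf p r V → M) (c : Conf p q V) : M :=
  (-1 : ℤ) ^ tri (halfList c.rest).length •
    cuts (halfList c.rest) (fun z => φ (c.join z)) z

/-- A half-edge that is attached in the intermediate configuration, and then glued further along
`z`, has been attached to the composed configuration. -/
theorem join_insert (c : Conf p q V) (z : Conf q r V) (s : Seg p) (t : Seg q) (u : Seg r) (v : V)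
    (a b : Words q) (A B : Words r) (h : A * B = split u (z.track t)) :
    (c.insert s t v a b).join (z.insert t u v A B) =
      (c.join z).insert s u v (FreeGroup.lift (insTrack t u A B z.track) a)
        (FreeGroup.lift (insTrack t u A B z.track) b) := by
  refine Conf.ext rfl rfl rfl (funext fun w => ?_)
  simp only [join, insert]
  by_cases h1 : w = s
  · subst h1
    simp only [insTrack_self]
  by_cases h2 : w = up s
  · subst h2
    simp only [insTrack_up]
  · have e1 : ∀ (Q : Seg p → Words q) t x y, insTrack s t x y Q w = split t (Q (old s w)) :=
      fun Q t x y => by simp [insTrack, h1, h2]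
    have e2 : ∀ (Q : Seg p → Words r) t x y, insTrack s t x y Q w = split t (Q (old s w)) :=
      fun Q t x y => by simp [insTrack, h1, h2]
    rw [e1, e2, lift_insTrack_split h]

theorem cutList_cuts (L : List (Seg p × V)) (w : List (Letter r))
    (g : Seg r → Words r → Words r → Conf p q V → M) (c : Conf p q V) :
    cutList w (fun t a b => cuts L (g t a b) c) = cuts L (fun z => cutList w (g · · · z)) c := by
  induction w generalizing g with
  | nil =>
    simp only [cutList]
    exact (congrFun (map_zero (cuts L)) c).symm
  | cons l w ih =>
    simp only [cutList]
    rw [ih]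
    have h := congrFun (map_add (cuts L)
      (letterSign l • g l.1 (leftPart l) (rightPart l * split l.1 (FreeGroup.mk w)))
      (fun z => cutList w fun s a b => g s (split s (FreeGroup.mk [l]) * a) b z)) c
    rw [map_zsmul] at h
    exact h.symm

theorem cut_cuts (L : List (Seg p × V)) (x : Words r)
    (g : Seg r → Words r → Words r → Conf p q V → M) (c : Conf p q V) :
    cut x (fun t a b => cuts L (g t a b) c) = cuts L (fun z => cut x (g · · · z)) c := by
  induction x using Quot.inductionOn with | _ w
  exact cutList_cuts L w g c

/-- In the gluing along `z`, the new half-edge is moved behind all others by `cuts_halfList_insert`.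
Its attachment in two stages is then a single attachment along the substituted word, by `cut_lift`.
The signs match because `tri` grows by the number of the other half-edges. -/
theorem cutAt_through (z : Conf q r V) (φ : Conf p r V → M) (s : Seg p) (v : V) {c : Conf p q V}
    (hlen : c.len = fun k => (c.rest k).length)
    (hs : ∀ l ∈ (c.track s).toWord, l.1.2 ≤ (c.rest l.1.1).length) :
    cutAt s v (through z φ) c = through z (cutAt s v φ) c := by
  have h1 : cutAt s v (through z φ) c = cut (c.track s) fun t a b =>
      (-1 : ℤ) ^ tri (halfList c.rest).length •
        cuts (halfList c.rest) (cutAt t v fun z => φ ((c.insert s t v a b).join z)) z := by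
    refine cut_congr_toWord fun w₁ l w₂ e => ?_
    have hl := hs l (by rw [e]; simp)
    have hn : (halfList (c.insert s l.1 v (split l.1 (FreeGroup.mk w₁) * leftPart l)
        (rightPart l * split l.1 (FreeGroup.mk w₂))).rest).length = (halfList c.rest).length + 1 := by
      have := congrArg Multiset.card (sum_insertRest c.rest l.1 hl v)
      simp only [Multiset.card_sum, Multiset.coe_card, Multiset.card_cons] at this
      rw [length_halfList, length_halfList, ← this]
      rfl
    rw [through, hn]
    have h2 := cuts_halfList_insert c.rest l.1 hl v
      (fun z => φ ((c.insert s l.1 v (split l.1 (FreeGroup.mk w₁) * leftPart l)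
        (rightPart l * split l.1 (FreeGroup.mk w₂))).join z))
    have h3 := congrFun h2 z
    refine (congrArg (fun x => (-1 : ℤ) ^ pos c.len l.1 •
      (-1 : ℤ) ^ tri ((halfList c.rest).length + 1) • x) h3).trans ?_
    simp only [Pi.smul_apply]
    rw [smul_smul, smul_smul, tri_succ, hlen]
    congr 1
    rw [← pow_add, ← pow_add]
    apply neg_one_pow_congr
    simp only [Nat.even_iff]
    omega
  rw [h1, cut_zsmul, through, cut_cuts]
  refine congrArg _ (congrArg (fun φ => cuts (halfList c.rest) φ z) (funext fun z => ?_))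
  rw [cutAt, join, cut_lift]
  refine congrArg (cut _) (funext fun t => funext fun a => funext fun b => ?_)
  refine cut_congr fun u A B h => ?_
  exact congrArg (fun k => (-1 : ℤ) ^ pos z.len u • φ k) (join_insert c z s t u v a b A B h)

theorem Good.valid [Finite V] {F : GlueFrame p q V} {R : Fin p → List V} {c : Conf p q V}
    (hc : c.Good F R) {s : Seg p} (hs : s.2 ≤ (R s.1).length) :
    ∀ l ∈ (c.track s).toWord, l.1.2 ≤ (c.rest l.1.1).length :=
  Diagram.IsPath.validLetters (hc.path s hs)

theorem cuts_through [Finite V] {F : GlueFrame p q V} (R : Fin p → List V) (z : Conf q r V)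
    (φ : Conf p r V → M) {c : Conf p q V} (hc : c.Good F fun _ => []) :
    cuts (halfList R) (through z φ) c = through z (cuts (halfList R) φ) c := by
  induction R using snoc_induction generalizing φ with
  | nil =>
    have e : halfList (fun _ : Fin p => ([] : List V)) = [] := by simp [halfList]
    rw [e, cuts_nil, cuts_nil]
  | snoc R k v hk ih =>
    rw [cuts_snoc hk, cuts_snoc hk, ← ih]
    exact cuts_congr_good (fun c hc => cutAt_through z φ _ v hc.len_eq (hc.valid le_rfl)) hc

theorem Good.map [Finite V] {W : Type} [Finite W] {F : GlueFrame p q V} {R : Fin p → List V}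
    {c : Conf p q V} (hc : c.Good F R) (g : V → W) (E : Multiset (Sym2 W))
    (hE : c.edges.map (Sym2.map g) ≤ E) :
    (c.map g E).Good ⟨E, fun k => g (F.start k), fun k => (F.rest k).map g, fun k => g (F.base k),
      F.positive⟩ fun k => (R k).map g where
  edges_eq := rfl
  len_eq := by
    funext k
    have := congrFun hc.len_eq k
    simpa [Conf.map] using this
  subset k := List.map_subset g (hc.subset k)
  total := by
    have := congrArg (Multiset.map g) hc.total
    rw [Multiset.map_add, ← Diagram.sum_coe_map, ← Diagram.sum_coe_map, ← Diagram.sum_coe_map]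
      at this
    exact this
  path s hs := by
    have hs' : s.2 ≤ (R s.1).length := by simpa using hs
    have e : ∀ u, slotOf (fun k => g (F.base k)) (fun k => (R k).map g) u =
      g (slotOf (V := V) F.base R u) := slotOf_map g F.base R
    rw [e, e]
    refine Diagram.PathTo.map (D := c.diag F.start) (D' := (c.map g E).diag fun k => g (F.start k)) g
      (MonoidHom.id _) (fun x y h => Joined.map (fun x y h => ?_) h) (fun u hu => ?_) (hc.path s hs')
    · exact .of_mem (Multiset.mem_of_le hE (Multiset.mem_map.2 ⟨_, h, rfl⟩))
    · have := Diagram.pathTo_of ((c.map g E).diag fun k => g (F.start k)) u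
        (by simpa [Conf.diag, Conf.map] using hu)
      have e : ∀ j, ((c.map g E).diag fun k => g (F.start k)).slot u.1 j =
        g ((c.diag F.start).slot u.1 j) := fun j => slotOf_map g F.start c.rest (u.1, j)
      rw [e, e] at this
      exact this
  pos h s hs := hc.pos h s (by simpa using hs)

end Conf

namespace Diagram

variable {w a b c : ℕ × ℕ}

section

variable (X : Diagram w a) (Y : Diagram a b) (Z : Diagram b c)

/-- The edges of the diagrams that occur in a composition of three diagrams. -/
def glueEdges₃ : Multiset (Sym2 ((X.V ⊕ Y.V) ⊕ Z.V)) :=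
  (X.glueEdges Y).map (Sym2.map Sum.inl) + Z.edges.map (Sym2.map Sum.inr) +
    (Finset.univ.val.map fun i => s(Sum.inl (Sum.inr (Y.start i)), Sum.inr (Z.loopLeaf i))) +
    (Finset.univ.val.map fun i => s(Sum.inl (Sum.inr (Y.outLeaf i)), Sum.inr (Z.inLeaf i)))

theorem glueEdges₃_eq : (X.glueEdges₃ Y Z).map (Sym2.map (Equiv.sumAssoc X.V Y.V Z.V)) =
    X.edges.map (Sym2.map Sum.inl) + (Y.glueEdges Z).map (Sym2.map Sum.inr) +
    (Finset.univ.val.map fun i => s(Sum.inl (X.start i), Sum.inr (Sum.inl (Y.loopLeaf i)))) +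
    (Finset.univ.val.map fun i => s(Sum.inl (X.outLeaf i), Sum.inr (Sum.inl (Y.inLeaf i)))) := by
  simp only [glueEdges₃, glueEdges, Multiset.map_add, Multiset.map_map, Function.comp_def,
    Sym2.map_map, Sym2.map_mk, Equiv.sumAssoc_apply_inl_inl,
    Equiv.sumAssoc_apply_inl_inr, Equiv.sumAssoc_apply_inr]
  abel

/-- The configuration from which the gluings along `Z` in a composition of three diagrams start. -/
def initialConf₃ : Conf b.1 c.1 ((X.V ⊕ Y.V) ⊕ Z.V) where
  edges := X.glueEdges₃ Y Z
  len k := (Z.rest k).length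
  rest k := (Z.rest k).map Sum.inr
  track s := if s.2 = 0 then Z.loop s.1 else 1

instance : Finite ((X.V ⊕ Y.V) ⊕ Z.V) := by
  have := Z.finite
  infer_instance

/-- The diagram given by a configuration in a composition of three diagrams. -/
def confDiag₃ (C : Conf a.1 c.1 ((X.V ⊕ Y.V) ⊕ Z.V)) : Diagram w c where
  V := (X.V ⊕ Y.V) ⊕ Z.V
  finite := inferInstance
  edges := C.edges
  start k := Sum.inr (Z.start k)
  rest := C.rest
  loopLeaf i := Sum.inl (Sum.inl (X.loopLeaf i))
  inLeaf i := Sum.inl (Sum.inl (X.inLeaf i))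
  outLeaf i := Sum.inr (Z.outLeaf i)
  loop i := FreeGroup.lift C.track (X.loop i)

/-- The class of the diagram given by a configuration in a composition of three diagrams. -/
noncomputable def confCls₃ (C : Conf a.1 c.1 ((X.V ⊕ Y.V) ⊕ Z.V)) : Quo w c :=
  cls (X.confDiag₃ Y Z C)

/-- The half-edges of `Y`, before gluing, in a composition of three diagrams. -/
def middleConf : Conf a.1 b.1 ((X.V ⊕ Y.V) ⊕ Z.V) :=
  (X.initialConf Y).map Sum.inl ((X.glueEdges Y).map (Sym2.map Sum.inl))

theorem lift_lift_track {p q r : ℕ} (f : Seg q → Words r) (g : Seg p → Words q) (x : Words p) :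
    FreeGroup.lift (fun u => FreeGroup.lift f (g u)) x =
      FreeGroup.lift f (FreeGroup.lift g x) := by
  have : FreeGroup.lift (fun u => FreeGroup.lift f (g u)) =
      (FreeGroup.lift f).comp (FreeGroup.lift g) := by
    ext u; simp
  exact DFunLike.congr_fun this x

variable {X Y Z}

/-- The bracketing in which a gluing of `X` and `Y` is glued along `Z`, written over the common
vertex set; `toQuo_compose_confDiag_right` treats the other bracketing, which differs by the
reassociation of this set. -/
theorem toQuo_compose_confDiag_left {C : Conf a.1 b.1 (X.V ⊕ Y.V)}
    (hC : C.Good (X.glueFrame Y) (X.leftRest Y)) (hX : X.IsLooped) (hZ : Z.IsLooped) :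
    toQuo w c ((X.confDiag Y C).compose Z) =
      Conf.through (X.initialConf₃ Y Z) (X.confCls₃ Y Z)
        (C.map Sum.inl ((X.glueEdges Y).map (Sym2.map Sum.inl))) := by
  have h1 : (X.confDiag Y C).initialConf Z = X.initialConf₃ Y Z := by
    refine Conf.ext ?_ rfl rfl rfl
    have := hC.edges_eq
    change (C.edges).map _ + _ + _ + _ = _
    rw [this]
    rfl
  have h2 : (X.confDiag Y C).degree =
      (halfList fun k => (C.rest k).map (Sum.inl : X.V ⊕ Y.V → (X.V ⊕ Y.V) ⊕ Z.V)).length := by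
    rw [length_halfList]
    simp [degree, confDiag]
  rw [toQuo_compose _ _ (confDiag_isLooped hC hX) hZ, h1, h2, Conf.through]
  refine congrArg _ (congrArg (fun φ => Conf.cuts (halfList fun k => (C.rest k).map
    (Sum.inl : X.V ⊕ Y.V → (X.V ⊕ Y.V) ⊕ Z.V)) φ (X.initialConf₃ Y Z)) (funext fun z => ?_))
  refine congrArg cls ((Diagram.mk.injEq ..).mpr ⟨rfl, HEq.rfl, HEq.rfl, HEq.rfl, HEq.rfl, HEq.rfl,
    HEq.rfl, ?_⟩)
  funext i
  exact (lift_lift_track z.track C.track (X.loop i)).symm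

theorem toQuo_compose_confDiag_right {C : Conf b.1 c.1 (Y.V ⊕ Z.V)}
    (hC : C.Good (Y.glueFrame Z) (Y.leftRest Z)) (hX : X.IsLooped) (hY : Y.IsLooped) :
    toQuo w c (X.compose (Y.confDiag Z C)) = (-1 : ℤ) ^ tri X.degree •
      Conf.cuts (halfList fun i => (X.leftRest Y i).map Sum.inl) (X.confCls₃ Y Z)
        ((X.middleConf Y Z).join (C.map (Sum.map Sum.inr id) (X.glueEdges₃ Y Z))) := by
  have hD := confDiag_isLooped hC hY
  let e : X.V ⊕ Y.V ⊕ Z.V → (X.V ⊕ Y.V) ⊕ Z.V := (Equiv.sumAssoc X.V Y.V Z.V).symm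
  have h1 : (X.middleConf Y Z).join (C.map (Sum.map Sum.inr id) (X.glueEdges₃ Y Z)) =
      (X.initialConf (Y.confDiag Z C)).map e (X.glueEdges₃ Y Z) := by
    refine Conf.ext rfl ?_ ?_ ?_
    · exact hC.len_eq
    · funext k
      refine Eq.trans ?_ (List.map_map (l := C.rest k) (f := Sum.inr) (g := e)).symm
      refine List.map_congr_left fun x _ => ?_
      rcases x with x | x <;> rfl
    · funext s
      change FreeGroup.lift C.track (if s.2 = 0 then Y.loop s.1 else 1) =
        if s.2 = 0 then FreeGroup.lift C.track (Y.loop s.1) else 1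
      split_ifs
      · rfl
      · exact map_one _
  have h2 : (fun i => (X.leftRest Y i).map Sum.inl) =
      fun i => (X.leftRest (Y.confDiag Z C) i).map e := by
    funext i
    refine (List.map_map (l := X.rest i)).trans ?_
    exact (List.map_map (l := X.rest i) (f := Sum.inl) (g := e)).symm
  rw [h1, h2, toQuo_compose _ _ hX hD]
  refine congrArg _ ((Conf.cuts_congr_good (fun K hK => ?_) (initialConf_good X hD)).trans
    (Conf.cuts_map e (X.glueEdges₃ Y Z) (X.leftRest (Y.confDiag Z C)) (X.confCls₃ Y Z)
      (X.initialConf (Y.confDiag Z C))).symm)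
  refine Eq.trans ?_ (cls_move (Move.relabel (X.confDiag₃ Y Z (K.map e (X.glueEdges₃ Y Z)))
    (X.V ⊕ Y.V ⊕ Z.V) (X.confDiag (Y.confDiag Z C) K).finite (Equiv.sumAssoc X.V Y.V Z.V))).symm
  refine congrArg cls ((Diagram.mk.injEq ..).mpr ⟨rfl, heq_of_eq ?_, HEq.rfl, heq_of_eq ?_,
    HEq.rfl, HEq.rfl, HEq.rfl, rfl⟩)
  · refine hK.edges_eq.trans (Eq.trans ?_ (X.glueEdges₃_eq Y Z).symm)
    rw [← show C.edges = Y.glueEdges Z from hC.edges_eq]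
    rfl
  · funext k
    refine Eq.trans ?_ (List.map_map (l := K.rest k) (f := e) (g := Equiv.sumAssoc X.V Y.V Z.V)).symm
    have : Equiv.sumAssoc X.V Y.V Z.V ∘ e = id := funext fun x => Equiv.apply_symm_apply _ x
    rw [this]
    exact (List.map_id _).symm

end

/-- Composition is associative. -/
theorem toQuo_compose_assoc (X : Diagram w a) (Y : Diagram a b) (Z : Diagram b c)
    (hX : X.IsLooped) (hY : Y.IsLooped) (hZ : Z.IsLooped) :
    toQuo w c (composition w b c (X.compose Y) (Finsupp.single Z 1)) =
      toQuo w c (composition w a c (Finsupp.single X 1) (Y.compose Z)) := by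
  have h1 := map_compose X Y hX hY
    ((toQuo w c).comp ((composition w b c).flip (Finsupp.single Z 1))).toAddMonoidHom
  have h2 := map_compose Y Z hY hZ
    ((toQuo w c).comp (composition w a c (Finsupp.single X 1))).toAddMonoidHom
  refine h1.trans (Eq.trans ?_ h2.symm)
  -- Both composites become iterated attachments over the same vertices, and `Conf.cuts_through`
  -- exchanges the two iterations.
  rw [Conf.cuts_congr_good (φ' := fun C => Conf.through (X.initialConf₃ Y Z) (X.confCls₃ Y Z)
        (C.map Sum.inl ((X.glueEdges Y).map (Sym2.map Sum.inl)))) (fun C hC => ?_)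
      (initialConf_good X hY),
    Conf.cuts_congr_good (c := Y.initialConf Z) (φ' := fun C => (-1 : ℤ) ^ tri X.degree •
      Conf.cuts (halfList fun i => (X.leftRest Y i).map Sum.inl) (X.confCls₃ Y Z)
        ((X.middleConf Y Z).join (C.map (Sum.map Sum.inr id) (X.glueEdges₃ Y Z)))) (fun C hC => ?_)
      (initialConf_good Y hZ), ← Conf.cuts_map]
  · have hm := (initialConf_good X hY).map (Sum.inl : X.V ⊕ Y.V → (X.V ⊕ Y.V) ⊕ Z.V)
      ((X.glueEdges Y).map (Sym2.map Sum.inl)) le_rfl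
    rw [Conf.cuts_through _ _ _ hm]
    have e1 : (Y.initialConf Z).map (Sum.map Sum.inr id) (X.glueEdges₃ Y Z) =
        X.initialConf₃ Y Z := by
      refine Conf.ext rfl rfl (funext fun k => ?_) rfl
      exact List.map_map (l := Z.rest k)
    have e2 : (X.middleConf Y Z).rest =
        fun k => (Y.leftRest Z k).map (Sum.map Sum.inr id : Y.V ⊕ Z.V → (X.V ⊕ Y.V) ⊕ Z.V) := by
      funext k
      refine (List.map_map (l := Y.rest k)).trans ?_
      exact (List.map_map (l := Y.rest k) (f := Sum.inl)
        (g := (Sum.map Sum.inr id : Y.V ⊕ Z.V → (X.V ⊕ Y.V) ⊕ Z.V))).symm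
    have e3 : (halfList (X.middleConf Y Z).rest).length = Y.degree := by
      rw [length_halfList, e2]
      simp [leftRest, degree]
    have e4 := Conf.cuts_map (Sum.map Sum.inr id : Y.V ⊕ Z.V → (X.V ⊕ Y.V) ⊕ Z.V)
      (X.glueEdges₃ Y Z) (Y.leftRest Z) (fun C => Conf.cuts (halfList fun i =>
        (X.leftRest Y i).map Sum.inl) (X.confCls₃ Y Z) ((X.middleConf Y Z).join C))
      (Y.initialConf Z)
    rw [e1, ← e2] at e4
    have e5 := congrFun (map_zsmul (Conf.cuts (halfList (Y.leftRest Z))) ((-1 : ℤ) ^ tri X.degree)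
      fun C => Conf.cuts (halfList fun i => (X.leftRest Y i).map Sum.inl) (X.confCls₃ Y Z)
        ((X.middleConf Y Z).join (C.map (Sum.map Sum.inr id) (X.glueEdges₃ Y Z))))
      (Y.initialConf Z)
    refine Eq.trans ?_ (congrArg _ e5.symm)
    rw [Pi.smul_apply, ← e4, smul_comm, ← e3]
    rfl
  · rw [← toQuo_compose_confDiag_right hC hX hY]
    change toQuo w c (composition w a c (Finsupp.single X 1) (Finsupp.single _ 1)) = _
    rw [composition_single, one_smul, one_smul]
  · rw [← toQuo_compose_confDiag_left hC hX hZ]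
    change toQuo w c (composition w b c (Finsupp.single _ 1) (Finsupp.single Z 1)) = _
    rw [composition_single, one_smul, one_smul]

end Diagram

/-! ### Identities -/

namespace Conf

variable {p q : ℕ} {V : Type} {M : Type*} [AddCommGroup M]

/-- The configuration with half-edges `R` in which every segment is mapped to itself. -/
def diagonal (E : Multiset (Sym2 V)) (R : Fin p → List V) : Conf p p V where
  edges := E
  len k := (R k).length
  rest := R
  track s := if s.2 ≤ (R s.1).length then FreeGroup.of s else 1

theorem diagonal_insert (E : Multiset (Sym2 V)) (R : Fin p → List V) (k : Fin p) (v : V) :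
    (diagonal E R).insert (k, (R k).length) (k, (R k).length) v
      (FreeGroup.of (k, (R k).length)) (FreeGroup.of (up (k, (R k).length))) =
      diagonal E (snoc R k v) := by
  refine Conf.ext rfl (funext fun i => ?_) (funext fun i => ?_) (funext fun u => ?_)
  · by_cases hi : i = k
    · subst hi; simp [insert, diagonal, snoc]
    · simp [insert, diagonal, snoc, hi]
  · by_cases hi : i = k
    · subst hi; simp [insert, diagonal, snoc]
    · simp [insert, diagonal, snoc, hi]
  · obtain ⟨i, j⟩ := u
    simp only [insert, diagonal, insTrack]
    by_cases hi : i = k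
    · subst hi
      have hl : (snoc R i v i).length = (R i).length + 1 := by simp [snoc]
      rw [hl]
      rcases lt_trichotomy j (R i).length with h | h | h
      · have e : old (i, (R i).length) (i, j) = (i, j) := by
          simp only [old, true_and]
          rw [if_neg (by omega)]
        rw [if_neg (by simp; omega), if_neg (by simp [up]; omega), e, if_pos h.le,
          if_pos (by omega), split_of_ne (by simp; omega), shift, if_neg (by simp; omega)]
      · rw [if_pos (by rw [h]), if_pos (by omega), h]
      · by_cases h' : j = (R i).length + 1
        · rw [if_neg (by simp; omega), if_pos (by rw [h']; rfl), if_pos (by omega), h']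
          rfl
        · have e : old (i, (R i).length) (i, j) = (i, j - 1) := by
            simp only [old, true_and]
            rw [if_pos h]
          rw [if_neg (by simp; omega), if_neg (by simp [up]; omega), e,
            if_neg (by simp only; omega), map_one, if_neg (by omega)]
    · have hl : (snoc R k v i).length = (R i).length := by simp [snoc, hi]
      have e : old (k, (R k).length) (i, j) = (i, j) := by simp [old, Ne.symm hi]
      rw [if_neg (by simp [hi]), if_neg (by simp [up, hi]), hl, e]
      split_ifs
      · rw [split_of_ne (by simp [hi]), shift, if_neg (by simp [Ne.symm hi])]
      · exact map_one _

/-- When the last half-edge is attached, the remaining word is a single letter, so there is only one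
way to attach it. The position signs add up to `tri`, which cancels the sign of composition. -/
theorem cuts_diagonal (E : Multiset (Sym2 V)) (R : Fin p → List V) (φ : Conf p p V → M) :
    cuts (halfList R) φ (diagonal E fun _ => []) =
      (-1 : ℤ) ^ tri (halfList R).length • φ (diagonal E R) := by
  induction R using snoc_induction generalizing φ with
  | nil =>
    have e : halfList (fun _ : Fin p => ([] : List V)) = [] := by simp [halfList]
    rw [e, cuts_nil]
    simp [tri]
  | snoc R k v hk ih =>
    rw [cuts_snoc hk, ih, cutAt, halfList_snoc R k v hk, List.length_append, List.length_singleton,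
      tri_succ]
    have e : (diagonal E R).track (k, (R k).length) = FreeGroup.of (k, (R k).length) :=
      if_pos le_rfl
    rw [e, cut_of, diagonal_insert, smul_smul, length_halfList_eq_pos hk, pow_add]
    rfl

end Conf

namespace Diagram

variable {a b : ℕ × ℕ}

theorem _root_.LoopedDiagrams.Joined.of_eq {V : Type} {E : Multiset (Sym2 V)} {x y : V}
    (h : x = y) : Joined E x y := h ▸ .refl x

theorem identity_isLooped (a : ℕ × ℕ) : (identity a).IsLooped := by
  intro i
  have h := pathTo_of (identity a) (i, 0) (Nat.zero_le _)
  have e : ∀ j, (identity a).slot i j = Sum.inl i := fun j => by simp [slot, identity]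
  exact h.congr (Joined.of_eq (e 0).symm) (Joined.of_eq (e 1))

theorem univ_sum_map {A B C : Type} [Fintype A] [Fintype B] (f : A ⊕ B → C) :
    (Finset.univ : Finset (A ⊕ B)).val.map f =
      (Finset.univ : Finset A).val.map (fun x => f (Sum.inl x)) +
        (Finset.univ : Finset B).val.map fun x => f (Sum.inr x) := by
  rw [← Finset.univ_disjSum_univ, Finset.val_disjSum, Multiset.disjSum, Multiset.map_add,
    Multiset.map_map, Multiset.map_map]
  rfl

theorem identity_edges {A B W : Type} [Fintype A] [Fintype B] (E : Multiset (Sym2 W)) (f : A → W)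
    (g : B → W) :
    ((0 : Multiset (Sym2 (A ⊕ B))).map (Sym2.map Sum.inl) + E.map (Sym2.map Sum.inr) +
      (Finset.univ.val.map fun i => s(Sum.inl (Sum.inl i), Sum.inr (f i))) +
      (Finset.univ.val.map fun i => s(Sum.inl (Sum.inr i), Sum.inr (g i)))).map
        (Sym2.map (Equiv.sumComm (A ⊕ B) W)) =
      E.map (Sym2.map Sum.inl) +
        (Finset.univ : Finset (A ⊕ B)).val.map fun x => s(Sum.inl (Sum.elim f g x), Sum.inr x) := by
  rw [univ_sum_map]
  simp only [Multiset.map_add, Multiset.map_map, Function.comp_def, Sym2.map_map, Sym2.map_mk,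
    Multiset.map_zero, zero_add, add_assoc, Equiv.sumComm_apply, Sum.swap_inl, Sum.swap_inr,
    Sum.elim_inl, Sum.elim_inr]
  simp only [Sym2.eq_swap]

/-- There are no half-edges to glue. The result is `Y` with an additional edge at each incoming
leaf, and these edges are contracted. -/
theorem toQuo_identity_compose (Y : Diagram a b) (hY : Y.IsLooped) :
    toQuo a b ((identity a).compose Y) = cls Y := by
  have e0 : halfList ((identity a).leftRest Y) = [] := by
    have : (identity a).leftRest Y = fun _ => [] := rfl
    rw [this]
    simp [halfList]
  have e1 : (identity a).degree = 0 := by simp [degree, identity]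
  rw [toQuo_compose _ _ (identity_isLooped a) hY, e0, e1, Conf.cuts_nil]
  simp only [tri, Finset.range_zero, Finset.sum_empty, pow_zero, one_smul]
  have : Finite Y.V := Y.finite
  let g : Fin a.1 ⊕ Fin a.2 → Y.V := Sum.elim Y.loopLeaf Y.inLeaf
  have h := cls_pendant (a := a) (b := b) (A := Y.V) (B := Fin a.1 ⊕ Fin a.2) inferInstance
    Y.edges g (fun k => Sum.inl (Y.start k)) (fun k => (Y.rest k).map Sum.inl)
    (fun i => Sum.inr (Sum.inl i)) (fun i => Sum.inr (Sum.inr i)) (fun i => Sum.inl (Y.outLeaf i))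
    Y.loop
  refine Eq.trans ?_ (h.trans (congrArg cls ?_))
  · refine (cls_move (Move.relabel _ (Y.V ⊕ (Fin a.1 ⊕ Fin a.2)) inferInstance
      (Equiv.sumComm (Fin a.1 ⊕ Fin a.2) Y.V))).trans ?_
    refine congrArg cls ((Diagram.mk.injEq ..).mpr ⟨rfl, heq_of_eq ?_, HEq.rfl, heq_of_eq ?_,
      HEq.rfl, HEq.rfl, HEq.rfl, ?_⟩)
    · exact identity_edges Y.edges Y.loopLeaf Y.inLeaf
    · funext k
      exact List.map_map (l := Y.rest k) (f := Sum.inr)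
        (g := Equiv.sumComm (Fin a.1 ⊕ Fin a.2) Y.V)
    · funext i
      change FreeGroup.lift _ (FreeGroup.of (i, 0)) = _
      rw [FreeGroup.lift_apply_of]
      rfl
  · refine (Diagram.mk.injEq ..).mpr ⟨rfl, HEq.rfl, HEq.rfl, heq_of_eq ?_,
      HEq.rfl, HEq.rfl, HEq.rfl, rfl⟩
    funext k
    exact (List.map_map (l := Y.rest k)).trans (List.map_id _)

/-- The unique gluing along the one-letter loops reproduces the white vertices of `X` with the
segments unchanged. The additional edges at start half-edges and outgoing leaves are contracted. -/
theorem toQuo_compose_identity (X : Diagram a b) (hX : X.IsLooped) :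
    toQuo a b (X.compose (identity b)) = cls X := by
  have e0 : X.initialConf (identity b) =
      Conf.diagonal (X.glueEdges (identity b)) fun _ => [] := by
    refine Conf.ext rfl rfl rfl (funext fun s => ?_)
    obtain ⟨k, j⟩ := s
    simp only [Conf.diagonal, initialConf, identity, List.length_nil, Nat.le_zero]
    split_ifs with h
    · rw [h]
    · rfl
  have e1 : (halfList (X.leftRest (identity b))).length = X.degree := by
    rw [length_halfList]; simp [leftRest, degree]
  rw [toQuo_compose _ _ hX (identity_isLooped b), e0, Conf.cuts_diagonal, e1, smul_smul, ← pow_add,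
    Even.neg_one_pow ⟨_, rfl⟩, one_smul]
  have : Finite X.V := X.finite
  let g : Fin b.1 ⊕ Fin b.2 → X.V := Sum.elim X.start X.outLeaf
  have h := cls_pendant (a := a) (b := b) (A := X.V) (B := Fin b.1 ⊕ Fin b.2) inferInstance
    X.edges g (fun k => Sum.inr (Sum.inl k)) (fun k => (X.rest k).map Sum.inl)
    (fun i => Sum.inl (X.loopLeaf i)) (fun i => Sum.inl (X.inLeaf i))
    (fun i => Sum.inr (Sum.inr i)) X.loop
  refine Eq.trans ?_ (h.trans (congrArg cls ?_))
  · refine congrArg cls ((Diagram.mk.injEq ..).mpr ⟨rfl, heq_of_eq ?_, HEq.rfl, HEq.rfl,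
      HEq.rfl, HEq.rfl, HEq.rfl, ?_⟩)
    · rw [univ_sum_map, ← add_assoc]
      refine congrArg₂ (· + ·) (congrArg₂ (· + ·) ?_ rfl) rfl
      exact add_zero (X.edges.map (Sym2.map (Sum.inl : X.V → X.V ⊕ (Fin b.1 ⊕ Fin b.2))))
    · funext i
      have h1 : FreeGroup.lift (Conf.diagonal (X.glueEdges (identity b))
          (X.leftRest (identity b))).track (X.loop i) = FreeGroup.lift FreeGroup.of (X.loop i) :=
        lift_congr fun l hl => if_pos (by simpa [leftRest] using (hX i).validLetters l hl)
      exact h1.trans (FreeGroup.lift_of_apply (X.loop i))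
  · refine (Diagram.mk.injEq ..).mpr ⟨rfl, HEq.rfl, HEq.rfl, heq_of_eq ?_,
      HEq.rfl, HEq.rfl, HEq.rfl, rfl⟩
    funext k
    exact (List.map_map (l := X.rest k)).trans (List.map_id _)

end Diagram

namespace Diagram

variable {a b c : ℕ × ℕ}

/-! ### Invariance under moves -/

/-- A map that contracts some edges, and preserves the others. -/
structure Contraction (D : Diagram a b) (W : Type) (f : D.V → W) (E : Multiset (Sym2 D.V)) :
    Prop where
  surjective : Function.Surjective f
  le : E ≤ D.edges
  joined : ∀ x y, f x = f y → Joined D.edges x y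
  of_mem : ∀ x y, s(x, y) ∈ D.edges → f x = f y ∨ s(x, y) ∈ E

theorem Move.exists_contraction {D D' : Diagram a b} (h : D.Move D') :
    ∃ W hW f E, D.Contraction W f E ∧ D' = D.push W hW f E := by
  cases h with
  | relabel W hW e =>
    exact ⟨W, hW, e, D.edges, ⟨e.surjective, le_rfl, fun x y h => .of_eq (e.injective h),
      fun x y h => Or.inr h⟩, rfl⟩
  | contract u v huv E hE W hW f hf hfuv =>
    refine ⟨W, hW, f, E, ⟨hf, hE ▸ Multiset.le_cons_self _ _, fun x y h => ?_, fun x y h => ?_⟩, rfl⟩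
    · rcases (hfuv x y).1 h with h | h
      · exact .of_eq h
      · exact .of_mem (by rw [hE, h]; exact Multiset.mem_cons_self _ _)
    · rw [hE, Multiset.mem_cons] at h
      exact h.imp (fun h => (hfuv x y).2 (Or.inr h)) id

/-- A chain downstairs can be lifted step by step, since the ends of consecutive lifts lie in one
fibre and fibres are connected. -/
theorem eqvGen_of_map {A B : Type} {r : A → A → Prop} {r' : B → B → Prop} {f : A → B}
    (hf : Function.Surjective f) (h : ∀ x y, f x = f y → Relation.EqvGen r x y)
    (hr : ∀ u v, r' u v → ∃ x y, f x = u ∧ f y = v ∧ Relation.EqvGen r x y) {u v : B}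
    (huv : Relation.EqvGen r' u v) : ∀ x y, f x = u → f y = v → Relation.EqvGen r x y := by
  induction huv with
  | rel u v huv =>
    intro x y hx hy
    obtain ⟨x', y', hx', hy', hxy⟩ := hr u v huv
    exact ((h x x' (hx.trans hx'.symm)).trans _ _ _ hxy).trans _ _ _ (h y' y (hy'.trans hy.symm))
  | refl u => exact fun x y hx hy => h x y (hx.trans hy.symm)
  | symm u v _ ih => exact fun x y hx hy => (ih y x hy hx).symm
  | trans u v w _ _ ih ih' =>
    intro x y hx hy
    obtain ⟨z, hz⟩ := hf v
    exact (ih x z hx hz).trans _ _ _ (ih' z y hz hy)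

section

variable {D : Diagram a b} {W : Type} {hW : Finite W} {f : D.V → W} {E : Multiset (Sym2 D.V)}

theorem Contraction.mem_map (h : D.Contraction W f E) {u v : W}
    (huv : s(u, v) ∈ E.map (Sym2.map f)) : ∃ x y, f x = u ∧ f y = v ∧ s(x, y) ∈ D.edges := by
  obtain ⟨e, he, hef⟩ := Multiset.mem_map.1 huv
  induction e with | _ x y
  have he' := Multiset.mem_of_le h.le he
  rw [Sym2.map_mk, Sym2.eq_iff] at hef
  rcases hef with ⟨h1, h2⟩ | ⟨h1, h2⟩
  · exact ⟨x, y, h1, h2, he'⟩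
  · exact ⟨y, x, h2, h1, Sym2.eq_swap ▸ he'⟩

theorem Contraction.joined_map (h : D.Contraction W f E) {x y : D.V} (hxy : s(x, y) ∈ D.edges) :
    Joined (E.map (Sym2.map f)) (f x) (f y) := by
  rcases h.of_mem x y hxy with h | h
  · exact .of_eq h
  · exact .of_mem (Multiset.mem_map.2 ⟨_, h, rfl⟩)

theorem Contraction.sameArc_iff (h : D.Contraction W f E) (x y : D.V) :
    (D.push W hW f E).SameArc (f x) (f y) ↔ D.SameArc x y := by
  constructor
  · intro hxy
    refine eqvGen_of_map h.surjective h.joined (fun u v huv => ?_) hxy x y rfl rfl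
    obtain ⟨x, y, hx, hy, hxy⟩ := h.mem_map huv
    exact ⟨x, y, hx, hy, .rel _ _ hxy⟩
  · exact fun hxy => Joined.map (fun x y hxy => h.joined_map hxy) hxy

theorem Contraction.sameComponent_iff (h : D.Contraction W f E) (x y : D.V) :
    (D.push W hW f E).SameComponent (f x) (f y) ↔ D.SameComponent x y := by
  constructor
  · intro hxy
    refine eqvGen_of_map h.surjective
      (fun x y hxy => SameArc.sameComponent (h.joined x y hxy)) (fun u v huv => ?_) hxy x y rfl rfl
    rcases huv with huv | ⟨k, hu, hv⟩
    · obtain ⟨x, y, hx, hy, hxy⟩ := h.mem_map huv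
      exact ⟨x, y, hx, hy, .rel _ _ (Or.inl hxy)⟩
    · have e : (D.push W hW f E).start k :: (D.push W hW f E).rest k =
        (D.start k :: D.rest k).map f := rfl
      rw [e] at hu hv
      obtain ⟨x, hx, rfl⟩ := List.mem_map.1 hu
      obtain ⟨y, hy, rfl⟩ := List.mem_map.1 hv
      exact ⟨x, y, rfl, rfl, SameComponent.of_rest hx hy⟩
  · refine fun hxy => SameComponent.map (D' := D.push W hW f E) (f := f) (fun x y hxy => ?_)
      (fun k x hx => ?_) hxy
    · exact SameArc.sameComponent (h.joined_map hxy)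
    · exact .of_rest (k := k) (List.mem_cons_self) (List.mem_cons_of_mem _ (List.mem_map_of_mem hx))

theorem Contraction.isPath_iff (h : D.Contraction W f E) (x y : D.V) (w : List (Letter b.1)) :
    (D.push W hW f E).IsPath (f x) w (f y) ↔ D.IsPath x w y := by
  have e : ∀ k j, (D.push W hW f E).slot k j = f (D.slot k j) := fun k j =>
    slotOf_map f D.start D.rest (k, j)
  induction w generalizing x with
  | nil => exact h.sameArc_iff x y
  | cons l w ih =>
    have h1 : (D.push W hW f E).source l = f (D.source l) := by
      rw [source, source, e, e]
      exact (apply_ite f _ _ _).symm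
    have h2 : (D.push W hW f E).target l = f (D.target l) := by
      rw [target, target, e, e]
      exact (apply_ite f _ _ _).symm
    have h3 : ((D.push W hW f E).rest l.1.1).length = (D.rest l.1.1).length := by simp [push]
    simp only [IsPath]
    rw [h1, h2, h3]
    exact and_congr_right' (and_congr (h.sameArc_iff _ _) (ih _))

end

variable {D D' : Diagram a b}

theorem Move.isLooped_iff (h : D.Move D') : D.IsLooped ↔ D'.IsLooped := by
  obtain ⟨W, hW, f, E, h', rfl⟩ := h.exists_contraction
  exact forall_congr' fun i => (h'.isPath_iff _ _ _).symm

theorem Move.isPositive_iff (h : D.Move D') : D.IsPositive ↔ D'.IsPositive := by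
  obtain ⟨W, hW, f, E, h', rfl⟩ := h.exists_contraction
  exact Iff.rfl

theorem Move.degree_eq (h : D.Move D') : D.degree = D'.degree := by
  obtain ⟨W, hW, f, E, h', rfl⟩ := h.exists_contraction
  exact (degree_push ..).symm

theorem Move.hasPositiveBoundary_iff (h : D.Move D') :
    D.HasPositiveBoundary ↔ D'.HasPositiveBoundary := by
  obtain ⟨W, hW, f, E, h', rfl⟩ := h.exists_contraction
  constructor
  · intro hD v
    obtain ⟨x, rfl⟩ := h'.surjective v
    obtain ⟨y, hy, hy'⟩ := hD x
    refine ⟨f y, (h'.sameComponent_iff x y).2 hy, ?_⟩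
    rcases hy' with ⟨k, rfl⟩ | ⟨t, rfl⟩
    · exact Or.inl ⟨k, rfl⟩
    · exact Or.inr ⟨t, rfl⟩
  · intro hD x
    obtain ⟨v, hv, hv'⟩ := hD (f x)
    rcases hv' with ⟨k, rfl⟩ | ⟨t, rfl⟩
    · exact ⟨_, (h'.sameComponent_iff x _).1 hv, Or.inl ⟨k, rfl⟩⟩
    · exact ⟨_, (h'.sameComponent_iff x _).1 hv, Or.inr ⟨t, rfl⟩⟩

end Diagram

/-! ### Closed classes -/

/-- A class of looped diagrams that is invariant under moves and closed under the operations. -/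
structure DiagramClass.Closed (P : DiagramClass) : Prop where
  isLooped : ∀ {a b} {D : Diagram a b}, P a b D → D.IsLooped
  move : ∀ {a b} {D D' : Diagram a b}, D.Move D' → (P a b D ↔ P a b D')
  face : ∀ {a b} {D : Diagram a b} {k : Fin b.1} {j : ℕ}, D.rest k ≠ [] → j ≤ (D.rest k).length →
    P a b D → P a b (D.face k j)
  confDiag : ∀ {a b c} {X : Diagram a b} {Y : Diagram b c} {C : Conf b.1 c.1 (X.V ⊕ Y.V)},
    P a b X → P b c Y → C.Good (X.glueFrame Y) (X.leftRest Y) → P a c (X.confDiag Y C)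
  identity : ∀ a, P a a (Diagram.identity a)

open Diagram

theorem identity_isPositive (a : ℕ × ℕ) : (identity a).IsPositive := fun i =>
  posWord_iff.1 (posWord_of (i, 0))

theorem identity_hasPositiveBoundary (a : ℕ × ℕ) : (identity a).HasPositiveBoundary := fun v =>
  ⟨v, .refl v, match v with
    | Sum.inl k => Or.inl ⟨k, rfl⟩
    | Sum.inr t => Or.inr ⟨t, rfl⟩⟩

theorem closed_lD : DiagramClass.Closed lD where
  isLooped h := h
  move h := h.isLooped_iff
  face hk hj h := face_isLooped hk hj h
  confDiag hX _ hC := confDiag_isLooped hC hX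
  identity := identity_isLooped

theorem closed_lDPlus : DiagramClass.Closed lDPlus where
  isLooped h := h.1
  move h := and_congr h.isLooped_iff h.hasPositiveBoundary_iff
  face hk hj h := ⟨face_isLooped hk hj h.1, face_hasPositiveBoundary hk hj h.2⟩
  confDiag hX hY hC := ⟨confDiag_isLooped hC hX.1, confDiag_hasPositiveBoundary hC hX.2 hY.2⟩
  identity a := ⟨identity_isLooped a, identity_hasPositiveBoundary a⟩

theorem closed_plD : DiagramClass.Closed plD where
  isLooped h := h.1
  move h := and_congr h.isLooped_iff h.isPositive_iff
  face hk hj h := ⟨face_isLooped hk hj h.1, face_isPositive h.2⟩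
  confDiag hX hY hC := ⟨confDiag_isLooped hC hX.1, confDiag_isPositive hC hX.1 hX.2 hY.2⟩
  identity a := ⟨identity_isLooped a, identity_isPositive a⟩

theorem closed_plDPlus : DiagramClass.Closed plDPlus where
  isLooped h := h.1
  move h := and_congr h.isLooped_iff (and_congr h.isPositive_iff h.hasPositiveBoundary_iff)
  face hk hj h :=
    ⟨face_isLooped hk hj h.1, face_isPositive h.2.1, face_hasPositiveBoundary hk hj h.2.2⟩
  confDiag hX hY hC := ⟨confDiag_isLooped hC hX.1, confDiag_isPositive hC hX.1 hX.2.1 hY.2.1,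
    confDiag_hasPositiveBoundary hC hX.2.2 hY.2.2⟩
  identity a := ⟨identity_isLooped a, identity_isPositive a, identity_hasPositiveBoundary a⟩

/-! ### Linear combinations of diagrams in a class -/

section

variable {P Q : DiagramClass} {a b c : ℕ × ℕ} {M : Type*} [AddCommGroup M]

theorem single_mem_gens {D : Diagram a b} (h : P a b D) : Finsupp.single D 1 ∈ gens P a b :=
  Submodule.subset_span ⟨D, h, rfl⟩

theorem eq_of_mem_gens {f g : Chains a b →ₗ[ℤ] M}
    (h : ∀ D, P a b D → f (Finsupp.single D 1) = g (Finsupp.single D 1)) {x : Chains a b}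
    (hx : x ∈ gens P a b) : f x = g x :=
  LinearMap.eqOn_span (fun x hx => by obtain ⟨D, hD, rfl⟩ := hx; exact h D hD) hx

theorem gens_mono (h : ∀ a b D, P a b D → Q a b D) : gens P a b ≤ gens Q a b :=
  Submodule.span_mono fun _ ⟨D, hD, hx⟩ => ⟨D, h _ _ _ hD, hx⟩

theorem rels_mono (h : ∀ a b D, P a b D → Q a b D) : rels P a b ≤ rels Q a b :=
  Submodule.span_mono (Set.union_subset_union
    (fun _ ⟨D, D', hD, hD', hx⟩ => ⟨D, D', h _ _ _ hD, h _ _ _ hD', hx⟩)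
    (fun _ ⟨D, hD, hx⟩ => ⟨D, h _ _ _ hD, hx⟩))

theorem rels_le_gens : rels P a b ≤ gens P a b := by
  refine Submodule.span_le.2 (Set.union_subset ?_ ?_)
  · rintro _ ⟨D, D', hD, hD', -, rfl⟩
    exact Submodule.sub_mem _ (single_mem_gens hD) (single_mem_gens hD')
  · rintro _ ⟨D, hD, -, rfl⟩
    exact single_mem_gens hD

theorem toQuo_eq_zero {x : Chains a b} : toQuo a b x = 0 ↔ x ∈ rels anyDiagram a b :=
  Submodule.Quotient.mk_eq_zero _

theorem eq_zero_of_mem_rels {f : Chains a b →ₗ[ℤ] M}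
    (h : ∀ D D', P a b D → P a b D' → D.Move D' →
      f (Finsupp.single D 1) = f (Finsupp.single D' 1))
    (h' : ∀ D, P a b D → D.Degenerate → f (Finsupp.single D 1) = 0) {x : Chains a b}
    (hx : x ∈ rels P a b) : f x = 0 := by
  refine LinearMap.mem_ker.1 (Submodule.span_le.2 (Set.union_subset ?_ ?_) hx)
  · rintro _ ⟨D, D', hD, hD', hm, rfl⟩
    rw [SetLike.mem_coe, LinearMap.mem_ker, map_sub, h D D' hD hD' hm, sub_self]
  · rintro _ ⟨D, hD, hd, rfl⟩
    exact LinearMap.mem_ker.2 (h' D hD hd)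

open Classical in
/-- The projection onto the linear combinations of diagrams in a class. -/
noncomputable def restrictTo (P : DiagramClass) (a b : ℕ × ℕ) : Chains a b →ₗ[ℤ] Chains a b :=
  Finsupp.linearCombination ℤ fun D => if P a b D then Finsupp.single D 1 else 0

theorem restrictTo_of_pos {D : Diagram a b} (h : P a b D) :
    restrictTo P a b (Finsupp.single D 1) = Finsupp.single D 1 := by
  rw [restrictTo, Finsupp.linearCombination_single, if_pos h, one_smul]

theorem restrictTo_of_neg {D : Diagram a b} (h : ¬P a b D) :
    restrictTo P a b (Finsupp.single D 1) = 0 := by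
  rw [restrictTo, Finsupp.linearCombination_single, if_neg h, smul_zero]

/-- A move never leaves the class, so a move relation is either kept or sent to zero, and so is a
degenerate diagram. -/
theorem restrictTo_mem_rels (hP : ∀ D D', D.Move D' → (P a b D ↔ P a b D')) {x : Chains a b}
    (hx : x ∈ rels anyDiagram a b) : restrictTo P a b x ∈ rels P a b := by
  rw [← Submodule.Quotient.mk_eq_zero]
  refine eq_zero_of_mem_rels (P := anyDiagram) (f := (rels P a b).mkQ.comp (restrictTo P a b))
    (fun D D' _ _ hm => ?_) (fun D _ hd => ?_) hx
  · by_cases h : P a b D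
    · rw [LinearMap.comp_apply, LinearMap.comp_apply, restrictTo_of_pos h,
        restrictTo_of_pos ((hP D D' hm).1 h), ← sub_eq_zero, ← map_sub]
      exact (Submodule.Quotient.mk_eq_zero _).2
        (Submodule.subset_span (Or.inl ⟨D, D', h, (hP D D' hm).1 h, hm, rfl⟩))
    · rw [LinearMap.comp_apply, LinearMap.comp_apply, restrictTo_of_neg h,
        restrictTo_of_neg fun h' => h ((hP D D' hm).2 h')]
  · by_cases h : P a b D
    · rw [LinearMap.comp_apply, restrictTo_of_pos h]
      exact (Submodule.Quotient.mk_eq_zero _).2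
        (Submodule.subset_span (Or.inr ⟨D, h, hd, rfl⟩))
    · rw [LinearMap.comp_apply, restrictTo_of_neg h, map_zero]

/-- The projection fixes `x` and turns relations among arbitrary diagrams into relations inside the
class. So no relation between diagrams of the class needs diagrams outside it. -/
theorem mem_rels_of_mem_gens (hP : ∀ D D', D.Move D' → (P a b D ↔ P a b D')) {x : Chains a b}
    (hx : x ∈ gens P a b) (hx' : x ∈ rels anyDiagram a b) : x ∈ rels P a b := by
  have h : restrictTo P a b x = LinearMap.id x :=
    eq_of_mem_gens (fun D hD => restrictTo_of_pos hD) hx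
  have := restrictTo_mem_rels hP hx'
  rwa [h] at this

theorem boundary_mem_gens {D : Diagram a b}
    (h : ∀ k j, D.rest k ≠ [] → j ≤ (D.rest k).length → P a b (D.face k j)) :
    D.boundary ∈ gens P a b := by
  rw [boundary_eq_sum]
  refine Submodule.sum_mem _ fun s hs => Submodule.smul_mem _ _ (single_mem_gens ?_)
  obtain ⟨h1, h2⟩ := mem_faceSegs.1 hs
  exact h _ _ (fun h => h1 (by rw [h]; rfl)) h2

/-- `map_compose` for the identity map describes the composite before passing to a quotient; all its
terms come from good configurations. -/
theorem compose_mem_gens {X : Diagram a b} {Y : Diagram b c} (hX : X.IsLooped) (hY : Y.IsLooped)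
    (h : ∀ C : Conf b.1 c.1 (X.V ⊕ Y.V), C.Good (X.glueFrame Y) (X.leftRest Y) →
      P a c (X.confDiag Y C)) : X.compose Y ∈ gens P a c := by
  have h1 : X.compose Y = _ := map_compose X Y hX hY (AddMonoidHom.id _)
  rw [h1]
  exact Submodule.smul_mem _ _ (Conf.cuts_mem_good (gens P a c).toAddSubgroup
    (fun C hC => single_mem_gens (h C hC)) (initialConf_good X hY))

/-- The diagrams of degree `k` in a class. -/
def ofDegree (P : DiagramClass) (k : ℕ) : DiagramClass := fun a b D => P a b D ∧ D.degree = k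

theorem gens_ofDegree_le {k : ℕ} : gens (ofDegree P k) a b ≤ gens P a b :=
  gens_mono fun _ _ _ h => h.1

namespace DiagramClass.Closed

theorem differential_mem (hP : P.Closed) {x : Chains a b} (hx : x ∈ gens P a b) :
    differential a b x ∈ gens P a b := by
  refine (Submodule.span_le (p := (gens P a b).comap (differential a b))).2 ?_ hx
  rintro _ ⟨D, hD, rfl⟩
  rw [SetLike.mem_coe, Submodule.mem_comap, differential_single, one_smul]
  exact boundary_mem_gens fun k j hk hj => hP.face hk hj hD

theorem differential_mem_ofDegree (hP : P.Closed) {k : ℕ} {x : Chains a b}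
    (hx : x ∈ gens (ofDegree P (k + 1)) a b) : differential a b x ∈ gens (ofDegree P k) a b := by
  refine (Submodule.span_le (p := (gens (ofDegree P k) a b).comap (differential a b))).2 ?_ hx
  rintro _ ⟨D, hD, rfl⟩
  rw [SetLike.mem_coe, Submodule.mem_comap, differential_single, one_smul]
  refine boundary_mem_gens fun k' j hk hj => ⟨hP.face hk hj hD.1, ?_⟩
  have := degree_face hk hj
  have := hD.2
  omega

/-- The classes of the factors and of the result are independent of each other, so that the same
argument also shows that degrees add. -/
theorem composition_mem_of (hP : P.Closed) {P₁ P₂ Q : DiagramClass}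
    (h₁ : ∀ D, P₁ a b D → P a b D) (h₂ : ∀ D, P₂ b c D → P b c D)
    (h : ∀ (X : Diagram a b) (Y : Diagram b c) (C : Conf b.1 c.1 (X.V ⊕ Y.V)), P₁ a b X →
      P₂ b c Y → C.Good (X.glueFrame Y) (X.leftRest Y) → Q a c (X.confDiag Y C))
    {x : Chains a b} {y : Chains b c} (hx : x ∈ gens P₁ a b) (hy : y ∈ gens P₂ b c) :
    composition a b c x y ∈ gens Q a c := by
  refine (Submodule.span_le (p := (gens Q a c).comap ((composition a b c).flip y))).2 ?_ hx
  rintro _ ⟨X, hX, rfl⟩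
  refine (Submodule.span_le (p := (gens Q a c).comap
    (composition a b c (Finsupp.single X 1)))).2 ?_ hy
  rintro _ ⟨Y, hY, rfl⟩
  rw [SetLike.mem_coe, Submodule.mem_comap, composition_single, one_smul, one_smul]
  exact compose_mem_gens (hP.isLooped (h₁ _ hX)) (hP.isLooped (h₂ _ hY)) fun C => h X Y C hX hY

theorem composition_mem (hP : P.Closed) {x : Chains a b} {y : Chains b c} (hx : x ∈ gens P a b)
    (hy : y ∈ gens P b c) : composition a b c x y ∈ gens P a c :=
  hP.composition_mem_of (fun _ h => h) (fun _ h => h) (fun _ _ _ hX hY => hP.confDiag hX hY) hx hy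

theorem composition_mem_ofDegree (hP : P.Closed) {i j : ℕ} {x : Chains a b} {y : Chains b c}
    (hx : x ∈ gens (ofDegree P i) a b) (hy : y ∈ gens (ofDegree P j) b c) :
    composition a b c x y ∈ gens (ofDegree P (i + j)) a c :=
  hP.composition_mem_of (fun _ h => h.1) (fun _ h => h.1) (fun X Y C hX hY hC =>
    ⟨hP.confDiag hX.1 hY.1 hC, by rw [degree_confDiag hC, hX.2, hY.2]⟩) hx hy

theorem toQuo_differential (hP : P.Closed) {x : Chains a b} (hx : x ∈ rels P a b) :
    toQuo a b (differential a b x) = 0 := by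
  refine eq_zero_of_mem_rels (f := (toQuo a b).comp (differential a b))
    (fun D D' _ _ hm => ?_) (fun D hD hd => ?_) hx
  · rw [LinearMap.comp_apply, LinearMap.comp_apply, differential_single, differential_single,
      one_smul, one_smul, toQuo_boundary_move hm]
  · rw [LinearMap.comp_apply, differential_single, one_smul,
      toQuo_boundary_degenerate hd (hP.isLooped hD)]

theorem toQuo_composition_left (hP : P.Closed) {x : Chains a b} {y : Chains b c}
    (hx : x ∈ rels P a b) (hy : y ∈ gens P b c) : toQuo a c (composition a b c x y) = 0 := by
  refine eq_of_mem_gens (f := (toQuo a c).comp (composition a b c x)) (g := 0)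
    (fun Y hY => ?_) hy
  have hY := hP.isLooped hY
  refine eq_zero_of_mem_rels
    (f := (toQuo a c).comp ((composition a b c).flip (Finsupp.single Y 1)))
    (fun D D' hD hD' hm => ?_) (fun D hD hd => ?_) hx
  · simp only [LinearMap.comp_apply, LinearMap.flip_apply, composition_single, one_smul]
    exact toQuo_compose_move_left hm (hP.isLooped hD) (hP.isLooped hD') hY
  · simp only [LinearMap.comp_apply, LinearMap.flip_apply, composition_single, one_smul]
    exact toQuo_compose_degenerate_left hd (hP.isLooped hD) hY

theorem toQuo_composition_right (hP : P.Closed) {x : Chains a b} {y : Chains b c}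
    (hx : x ∈ gens P a b) (hy : y ∈ rels P b c) : toQuo a c (composition a b c x y) = 0 := by
  refine eq_of_mem_gens (f := (toQuo a c).comp ((composition a b c).flip y)) (g := 0)
    (fun X hX => ?_) hx
  have hX := hP.isLooped hX
  refine eq_zero_of_mem_rels (f := (toQuo a c).comp (composition a b c (Finsupp.single X 1)))
    (fun D D' hD hD' hm => ?_) (fun D hD hd => ?_) hy
  · simp only [LinearMap.comp_apply, composition_single, one_smul]
    exact toQuo_compose_move_right hX hm (hP.isLooped hD) (hP.isLooped hD')
  · simp only [LinearMap.comp_apply, composition_single, one_smul]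
    exact toQuo_compose_degenerate_right hX hd (hP.isLooped hD)

/-! ### The dg-category -/

/-- Identities in the morphism complex of a class may be checked among all diagrams, where
intermediate steps can leave the class. -/
theorem toHom_eq_zero (hP : P.Closed) {x : gens P a b} :
    toHom P a b x = 0 ↔ toQuo a b x = 0 := by
  rw [toQuo_eq_zero]
  refine (Submodule.Quotient.mk_eq_zero _).trans ⟨fun h => ?_, fun h => ?_⟩
  · exact rels_mono (fun _ _ _ _ => trivial) h
  · exact mem_rels_of_mem_gens (fun _ _ => hP.move) x.2 h

theorem toHom_eq (hP : P.Closed) {x y : gens P a b} :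
    toHom P a b x = toHom P a b y ↔ toQuo a b x = toQuo a b y := by
  rw [← sub_eq_zero, ← map_sub, hP.toHom_eq_zero, Submodule.coe_sub, map_sub, sub_eq_zero]

/-- The differential of linear combinations of diagrams in a class. -/
noncomputable def dGens (hP : P.Closed) (a b : ℕ × ℕ) : gens P a b →ₗ[ℤ] gens P a b :=
  (differential a b).restrict fun _ => hP.differential_mem

/-- The differential. -/
noncomputable def dHom (hP : P.Closed) (a b : ℕ × ℕ) : Hom P a b →ₗ[ℤ] Hom P a b :=
  Submodule.liftQ _ ((toHom P a b).comp (hP.dGens a b)) fun _ hx =>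
    hP.toHom_eq_zero.2 (hP.toQuo_differential hx)

/-- The composition of linear combinations of diagrams in a class. -/
noncomputable def compGens (hP : P.Closed) (a b c : ℕ × ℕ) :
    gens P a b →ₗ[ℤ] gens P b c →ₗ[ℤ] Hom P a c :=
  LinearMap.mk₂ ℤ (fun x y => toHom P a c ⟨composition a b c x y, hP.composition_mem x.2 y.2⟩)
    (fun x x' _ => by rw [← map_add]; congr 1; ext1; simp)
    (fun n _ _ => by rw [← map_smul]; congr 1; ext1; simp)
    (fun _ y y' => by rw [← map_add]; congr 1; ext1; simp)
    (fun n _ _ => by rw [← map_smul]; congr 1; ext1; simp)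

/-- The composition. -/
noncomputable def compHom (hP : P.Closed) (a b c : ℕ × ℕ) :
    Hom P a b →ₗ[ℤ] Hom P b c →ₗ[ℤ] Hom P a c :=
  (hP.compGens a b c).liftQ₂ _ _
    (fun _ hx => LinearMap.ext fun y => hP.toHom_eq_zero.2 (hP.toQuo_composition_left hx y.2))
    (fun _ hy => LinearMap.ext fun x => hP.toHom_eq_zero.2 (hP.toQuo_composition_right x.2 hy))

theorem toHom_surjective (P : DiagramClass) (a b : ℕ × ℕ) :
    Function.Surjective (toHom P a b) := Submodule.mkQ_surjective _

theorem mem_grade {k : ℕ} {z : Hom P a b} :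
    z ∈ grade P a b k ↔ ∃ x : gens P a b, (x : Chains a b) ∈ gens (ofDegree P k) a b ∧
      toHom P a b x = z := by
  constructor
  · intro hz
    refine (Submodule.span_le (p := ((gens (ofDegree P k) a b).submoduleOf (gens P a b)).map
      (toHom P a b))).2 ?_ hz
    rintro _ ⟨D, x, hD, hk, hx, rfl⟩
    refine ⟨x, ?_, rfl⟩
    change (x : Chains a b) ∈ gens (ofDegree P k) a b
    rw [hx]
    exact single_mem_gens ⟨hD, hk⟩
  · rintro ⟨⟨x, hx'⟩, hx, rfl⟩
    refine Submodule.span_induction (p := fun x _ => ∀ hx', toHom P a b ⟨x, hx'⟩ ∈ grade P a b k)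
      ?_ ?_ ?_ ?_ hx hx'
    · rintro _ ⟨D, ⟨hD, hk⟩, rfl⟩ hx'
      exact Submodule.subset_span ⟨D, _, hD, hk, rfl, rfl⟩
    · intro hx'
      exact Submodule.zero_mem _
    · intro x y hx hy ihx ihy _
      exact Submodule.add_mem _ (ihx (gens_ofDegree_le hx)) (ihy (gens_ofDegree_le hy))
    · intro n x hx ih _
      exact Submodule.smul_mem _ n (ih (gens_ofDegree_le hx))

end DiagramClass.Closed

end

namespace DiagramClass.Closed

variable {P : DiagramClass} {w a b c : ℕ × ℕ}

/-! ### The grading -/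

/-- The inclusion of the morphism complexes. -/
noncomputable def homToQuo (P : DiagramClass) (a b : ℕ × ℕ) : Hom P a b →ₗ[ℤ] Quo a b :=
  Submodule.liftQ _ ((toQuo a b).comp (gens P a b).subtype) fun x hx =>
    toQuo_eq_zero.2 (rels_mono (fun _ _ _ _ => trivial) (show (x : Chains a b) ∈ rels P a b from hx))

theorem homToQuo_injective (hP : P.Closed) : Function.Injective (homToQuo P a b) := by
  refine (injective_iff_map_eq_zero _).2 fun z hz => ?_
  obtain ⟨x, rfl⟩ := toHom_surjective P a b z
  exact hP.toHom_eq_zero.2 hz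

/-- The projection to the part of degree `k`. -/
noncomputable def degreeProj (a b : ℕ × ℕ) (k : ℕ) : Quo a b →ₗ[ℤ] Quo a b :=
  Submodule.liftQ _ ((toQuo a b).comp (restrictTo (ofDegree anyDiagram k) a b)) fun _ hx =>
    toQuo_eq_zero.2 (rels_mono (fun _ _ _ _ => trivial)
      (restrictTo_mem_rels (P := ofDegree anyDiagram k)
        (fun _ _ hm => and_congr_right' (by rw [hm.degree_eq])) hx))

theorem degreeProj_of_mem {j k : ℕ} {z : Hom P a b} (hz : z ∈ grade P a b j) :
    degreeProj a b k (homToQuo P a b z) = if j = k then homToQuo P a b z else 0 := by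
  obtain ⟨x, hx, rfl⟩ := mem_grade.1 hz
  change toQuo a b (restrictTo (ofDegree anyDiagram k) a b x) = if j = k then toQuo a b x else 0
  split_ifs with h
  · subst h
    exact congrArg _ (eq_of_mem_gens (g := LinearMap.id)
      (fun D hD => restrictTo_of_pos ⟨trivial, hD.2⟩) hx)
  · have : restrictTo (ofDegree anyDiagram k) a b x = (0 : Chains a b →ₗ[ℤ] Chains a b) x :=
      eq_of_mem_gens (fun D hD => restrictTo_of_neg fun h' => h (hD.2.symm.trans h'.2)) hx
    rw [this, LinearMap.zero_apply, map_zero]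

/-- The projection recovers each component from the sum, which shows that the sum is direct; the
projection exists because moves preserve the degree. -/
theorem degreeProj_coe (x : DirectSum ℕ fun k => grade P a b k) (k : ℕ) :
    degreeProj a b k (homToQuo P a b (DirectSum.coeAddMonoidHom (grade P a b) x)) =
      homToQuo P a b (x k) := by
  induction x using DirectSum.induction_on with
  | zero => simp
  | of j z =>
    rw [DirectSum.coeAddMonoidHom_of, degreeProj_of_mem z.2]
    split_ifs with h
    · subst h
      rw [DirectSum.of_eq_same]
    · rw [DirectSum.of_eq_of_ne _ _ _ (Ne.symm h), Submodule.coe_zero, map_zero]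
  | add x y hx hy =>
    rw [map_add, map_add, map_add, hx, hy, DirectSum.add_apply, Submodule.coe_add, map_add]

theorem isInternal (hP : P.Closed) (a b : ℕ × ℕ) : DirectSum.IsInternal (grade P a b) := by
  constructor
  · refine (injective_iff_map_eq_zero _).2 fun x hx => DFinsupp.ext fun k => ?_
    refine Subtype.ext (hP.homToQuo_injective ?_)
    have := degreeProj_coe x k
    rw [hx, map_zero, map_zero] at this
    exact this.symm.trans (map_zero _).symm
  · intro z
    obtain ⟨⟨x, hx⟩, rfl⟩ := toHom_surjective P a b z
    -- Every generator is homogeneous, so the graded parts span.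
    refine Submodule.span_induction (p := fun x _ => ∀ hx', ∃ y,
      DirectSum.coeAddMonoidHom (grade P a b) y = toHom P a b ⟨x, hx'⟩) ?_ ?_ ?_ ?_ hx hx
    · rintro _ ⟨D, hD, rfl⟩ hx'
      exact ⟨DirectSum.of (fun k => grade P a b k) D.degree
        ⟨_, Submodule.subset_span ⟨D, _, hD, rfl, rfl, rfl⟩⟩, DirectSum.coeAddMonoidHom_of ..⟩
    · exact fun _ => ⟨0, map_zero _⟩
    · intro x y hx hy ihx ihy _
      obtain ⟨u, hu⟩ := ihx hx
      obtain ⟨v, hv⟩ := ihy hy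
      exact ⟨u + v, by rw [map_add, hu, hv]; rfl⟩
    · intro n x hx ih _
      obtain ⟨u, hu⟩ := ih hx
      exact ⟨n • u, by rw [map_zsmul, hu]; rfl⟩

/-! ### The identities of a dg-category -/

theorem toQuo_differential_differential {x : Chains a b} (hx : x ∈ gens P a b) :
    toQuo a b (differential a b (differential a b x)) = 0 :=
  eq_of_mem_gens (f := (toQuo a b).comp ((differential a b).comp (differential a b))) (g := 0)
    (fun D _ => by
      simp only [LinearMap.comp_apply, differential_single, one_smul, LinearMap.zero_apply]
      exact toQuo_differential_boundary D) hx

theorem toQuo_differential_composition (hP : P.Closed) {i : ℕ} {x : Chains a b} {y : Chains b c}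
    (hx : x ∈ gens (ofDegree P i) a b) (hy : y ∈ gens P b c) :
    toQuo a c (differential a c (composition a b c x y)) =
      toQuo a c (composition a b c (differential a b x) y) +
        (-1 : ℤ) ^ i • toQuo a c (composition a b c x (differential b c y)) := by
  refine eq_of_mem_gens (f := (toQuo a c).comp ((differential a c).comp ((composition a b c).flip y)))
    (g := (toQuo a c).comp (((composition a b c).flip y).comp (differential a b)) +
      (-1 : ℤ) ^ i • (toQuo a c).comp ((composition a b c).flip (differential b c y)))
    (fun X hX => ?_) hx
  refine eq_of_mem_gens
    (f := (toQuo a c).comp ((differential a c).comp (composition a b c (Finsupp.single X 1))))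
    (g := (toQuo a c).comp (composition a b c (differential a b (Finsupp.single X 1))) +
      (-1 : ℤ) ^ i • (toQuo a c).comp ((composition a b c (Finsupp.single X 1)).comp
        (differential b c))) (fun Y hY => ?_) hy
  simp only [LinearMap.comp_apply, LinearMap.add_apply, LinearMap.smul_apply, composition_single,
    differential_single, one_smul]
  rw [toQuo_differential_compose X Y (hP.isLooped hX.1) (hP.isLooped hY), hX.2]

theorem toQuo_composition_assoc (hP : P.Closed) {x : Chains w a} {y : Chains a b} {z : Chains b c}
    (hx : x ∈ gens P w a) (hy : y ∈ gens P a b) (hz : z ∈ gens P b c) :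
    toQuo w c (composition w b c (composition w a b x y) z) =
      toQuo w c (composition w a c x (composition a b c y z)) := by
  refine eq_of_mem_gens
    (f := (toQuo w c).comp (((composition w b c).flip z).comp ((composition w a b).flip y)))
    (g := (toQuo w c).comp ((composition w a c).flip (composition a b c y z))) (fun X hX => ?_) hx
  refine eq_of_mem_gens
    (f := (toQuo w c).comp (((composition w b c).flip z).comp
      (composition w a b (Finsupp.single X 1))))
    (g := (toQuo w c).comp ((composition w a c (Finsupp.single X 1)).comp
      ((composition a b c).flip z))) (fun Y hY => ?_) hy
  refine eq_of_mem_gens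
    (f := (toQuo w c).comp (composition w b c
      (composition w a b (Finsupp.single X 1) (Finsupp.single Y 1))))
    (g := (toQuo w c).comp ((composition w a c (Finsupp.single X 1)).comp
      (composition a b c (Finsupp.single Y 1)))) (fun Z hZ => ?_) hz
  simp only [LinearMap.comp_apply]
  rw [composition_single X Y, composition_single Y Z, one_smul, one_smul, one_smul, one_smul]
  exact toQuo_compose_assoc X Y Z (hP.isLooped hX) (hP.isLooped hY) (hP.isLooped hZ)

theorem toQuo_one_composition (hP : P.Closed) {x : Chains a b} (hx : x ∈ gens P a b) :
    toQuo a b (composition a a b (Finsupp.single (Diagram.identity a) 1) x) = toQuo a b x :=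
  eq_of_mem_gens (f := (toQuo a b).comp (composition a a b (Finsupp.single (Diagram.identity a) 1)))
    (g := toQuo a b) (fun D hD => by
      rw [LinearMap.comp_apply, composition_single, one_smul, one_smul,
        toQuo_identity_compose D (hP.isLooped hD)]
      rfl) hx

theorem toQuo_composition_one (hP : P.Closed) {x : Chains a b} (hx : x ∈ gens P a b) :
    toQuo a b (composition a b b x (Finsupp.single (Diagram.identity b) 1)) = toQuo a b x :=
  eq_of_mem_gens
    (f := (toQuo a b).comp ((composition a b b).flip (Finsupp.single (Diagram.identity b) 1)))
    (g := toQuo a b) (fun D hD => by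
      rw [LinearMap.comp_apply, LinearMap.flip_apply, composition_single, one_smul, one_smul,
        toQuo_compose_identity D (hP.isLooped hD)]
      rfl) hx

theorem boundary_eq_zero {D : Diagram a b} (h : D.degree = 0) : D.boundary = 0 := by
  rw [boundary]
  refine Finset.sum_eq_zero fun k _ => if_pos ?_
  exact List.length_eq_zero_iff.1 (Finset.sum_eq_zero_iff.1 h k (Finset.mem_univ k))

theorem differential_eq_zero {x : Chains a b} (hx : x ∈ gens (ofDegree P 0) a b) :
    differential a b x = 0 :=
  eq_of_mem_gens (g := 0) (fun D hD => by
    rw [differential_single, boundary_eq_zero hD.2, smul_zero, LinearMap.zero_apply]) hx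

theorem degree_identity (a : ℕ × ℕ) : (Diagram.identity a).degree = 0 := by
  simp [degree, Diagram.identity]

/-- The dg-category of the diagrams in a closed class. -/
noncomputable def dgCategory (hP : P.Closed) : DGCategory (Hom P) (grade P) where
  isInternal := hP.isInternal
  d := hP.dHom
  d_mem a b k z hz := by
    obtain ⟨x, hx, rfl⟩ := mem_grade.1 hz
    exact mem_grade.2 ⟨_, hP.differential_mem_ofDegree hx, rfl⟩
  d_eq_zero a b z hz := by
    obtain ⟨x, hx, rfl⟩ := mem_grade.1 hz
    refine hP.toHom_eq_zero.2 ?_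
    change toQuo a b (differential a b x) = 0
    rw [differential_eq_zero hx, map_zero]
  d_d a b z := by
    obtain ⟨x, rfl⟩ := toHom_surjective P a b z
    exact hP.toHom_eq_zero.2 (toQuo_differential_differential x.2)
  comp := hP.compHom
  comp_mem a b c i j z hz z' hz' := by
    obtain ⟨x, hx, rfl⟩ := mem_grade.1 hz
    obtain ⟨y, hy, rfl⟩ := mem_grade.1 hz'
    exact mem_grade.2 ⟨_, hP.composition_mem_ofDegree hx hy, rfl⟩
  d_comp a b c i z hz z' := by
    obtain ⟨x, hx, rfl⟩ := mem_grade.1 hz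
    obtain ⟨y, rfl⟩ := toHom_surjective P b c z'
    refine hP.homToQuo_injective ?_
    rw [map_add, map_zsmul]
    exact hP.toQuo_differential_composition hx y.2
  comp_assoc w a b c z z' z'' := by
    obtain ⟨x, rfl⟩ := toHom_surjective P w a z
    obtain ⟨y, rfl⟩ := toHom_surjective P a b z'
    obtain ⟨y', rfl⟩ := toHom_surjective P b c z''
    exact hP.toHom_eq.2 (hP.toQuo_composition_assoc x.2 y.2 y'.2)
  one a := toHom P a a ⟨Finsupp.single (Diagram.identity a) 1, single_mem_gens (hP.identity a)⟩
  one_mem a := mem_grade.2 ⟨_, single_mem_gens ⟨hP.identity a, degree_identity a⟩, rfl⟩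
  d_one a := by
    refine hP.toHom_eq_zero.2 ?_
    change toQuo a a (differential a a (Finsupp.single (Diagram.identity a) 1)) = 0
    rw [differential_single, boundary_eq_zero (degree_identity a), smul_zero, map_zero]
  one_comp a b z := by
    obtain ⟨x, rfl⟩ := toHom_surjective P a b z
    exact hP.toHom_eq.2 (hP.toQuo_one_composition x.2)
  comp_one a b z := by
    obtain ⟨x, rfl⟩ := toHom_surjective P a b z
    exact hP.toHom_eq.2 (hP.toQuo_composition_one x.2)

end DiagramClass.Closed

end LoopedDiagrams

open LoopedDiagrams in
/-- For each of the four classes of diagrams, the boundary operator, the composition and the identity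
diagrams stay inside the class and induce on the morphism complexes the structure of a dg-category
(in particular, composition is a chain map); the last three are subcategories of the first. -/
theorem mainTheorem5 (P : DiagramClass) (hP : P = lD ∨ P = lDPlus ∨ P = plD ∨ P = plDPlus) :
    (∃ C : DGCategory (Hom P) (grade P),
      (∀ a b (x : gens P a b), ∃ h : differential a b x ∈ gens P a b,
        C.d a b (toHom P a b x) = toHom P a b ⟨differential a b x, h⟩) ∧
      (∀ a b c (x : gens P a b) (y : gens P b c),
        ∃ h : composition a b c x y ∈ gens P a c,
          C.comp a b c (toHom P a b x) (toHom P b c y) =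
            toHom P a c ⟨composition a b c x y, h⟩) ∧
      (∀ a, ∃ h : Finsupp.single (Diagram.identity a) 1 ∈ gens P a a,
        C.one a = toHom P a a ⟨Finsupp.single (Diagram.identity a) 1, h⟩)) ∧
    (∀ a b, gens P a b ≤ gens lD a b) ∧
    (∀ a b, gens P a b ⊓ rels lD a b = rels P a b) := by
  have hC : P.Closed := by
    rcases hP with rfl | rfl | rfl | rfl
    · exact closed_lD
    · exact closed_lDPlus
    · exact closed_plD
    · exact closed_plDPlus
  refine ⟨⟨hC.dgCategory, fun a b x => ⟨hC.differential_mem x.2, rfl⟩,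
    fun a b c x y => ⟨hC.composition_mem x.2 y.2, rfl⟩,
    fun a => ⟨single_mem_gens (hC.identity a), rfl⟩⟩,
    fun a b => gens_mono fun _ _ _ h => hC.isLooped h, fun a b => le_antisymm ?_ ?_⟩
  -- Relations between looped diagrams are in particular relations between arbitrary diagrams, and
  -- the projection onto the class brings them back.
  · rintro x ⟨hx, hx'⟩
    exact mem_rels_of_mem_gens (fun _ _ => hC.move) hx (rels_mono (fun _ _ _ _ => trivial) hx')
  · exact le_inf rels_le_gens (rels_mono fun _ _ _ h => hC.isLooped h)
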